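/- **Setting.** Let $\mathbb{R}^{n_1\times\cdots\times n_d}$ carry the entrywise inner product and the Frobenius norm $\|\cdot\|_F$, and put $N=n_3\cdots n_d$. For a tensor $\mathcal X$ let $\overline{\mathcal X}$ be its (unnormalized) discrete Fourier transform along the modes $3,\dots,d$, let $\overline{X}^{(i)}\in\mathbb{C}^{n_1\times n_2}$, $i=(i_3,\dots,i_d)$, be the frontal slices of $\overline{\mathcal X}$, and let $\overline X$ be the block diagonal matrix with these slices as blocks. $\sigma_j(M)$ is the $j$-th largest singular value of a matrix $M$ and $\#\sigma_1(M)$ the multiplicity of the largest one. The tensor nuclear norm is $\|\mathcal X\|_*=\frac1N\sum_i\sum_{j\le\min\{n_1,n_2\}}\sigma_j(\overline X^{(i)})$; let $\mathcal B=\{\|\mathcal X\|_*\le1\}$ and let $\Pi_{\mathcal B}$ be the Euclidean projection onto $\mathcal B$. A t-SVD of $\mathcal X$ consists of SVDs $\overline X^{(i)}=\overline U^{(i)}\overline S^{(i)}(\overline V^{(i)})^{\mathrm H}$ of all slices (singular values in decreasing order) such that $\overline U^{(i)},\overline V^{(i)}$ are the slices of the Fourier transforms of real tensors $\mathcal U,\mathcal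 V$. The rank-$r$ truncated projection of $\mathcal X$ onto $\mathcal B$ is computed from the leading $r$ components of the SVDs of the slices only: find $s\ge0$ with $\frac1N\sum_i\sum_{j\le r}\max\{0,\sigma_j(\overline X^{(i)})-s\}=1$ and return the tensor $\mathcal Y$ with $\overline Y^{(i)}=\sum_{j\le r}\max\{0,\sigma_j(\overline X^{(i)})-s\}\,u^{(i)}_j(v^{(i)}_j)^{\mathrm H}$, where $u_j^{(i)},v_j^{(i)}$ are the columns of $\overline U^{(i)},\overline V^{(i)}$. Let $f:\mathbb{R}^{n_1\times\cdots\times n_d}\to\mathbb{R}$ be convex, differentiable on $\mathcal B$, and $\beta$-smooth there, i.e. $\|\nabla f(\mathcal X)-\nabla f(\mathcal Y)\|_F\le\beta\|\mathcal X-\mathcal Y\|_F$ for $\mathcal X,\mathcal Y\in\mathcal B$, with $\beta>0$. Let $\mathcal X^*$ be a minimizer of $f$ over $\mathcal B$, and assume $G:=\nabla f(\mathcal X^*)\ne0$. Put $$m=\max_{i:\ \overline G^{(i)}\ne0}\#\sigma_1(\overline G^{(i)}),\qquad \mathrm{nnzb}=\#\{i:\overline G^{(i)}\neq 0\},\qquad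 \delta(r)=\sigma_1(\overline G)-\max_i\sigma_{r+1}(\overline G^{(i)}),$$ $$R_0(r)=\frac{1}{2\beta\sqrt N}\max\left\{\frac{\delta(r)}{1+\frac{\sqrt{m\cdot\mathrm{nnzb}}}{\#\sigma_1(\overline G)}},\ \frac{\delta(r-m+1)}{\frac1{\sqrt{m}}+\frac{\sqrt{m\cdot\mathrm{nnzb}}}{\#\sigma_1(\overline G)}}\right\}.$$ Projected gradient descent starts at some $\mathcal X_1\in\mathcal B$ and iterates $\mathcal X_{t+1}=\Pi_{\mathcal B}[\mathcal X_t-\frac1\beta\nabla f(\mathcal X_t)]$, $t\ge1$. **Theorem (local convergence of projected gradient descent).** (1) Let $m\le r<\min\{n_1,n_2\}$ and $\|\mathcal X_1-\mathcal X^*\|_F\le R_0(r)$. Then for every $t\ge1$ the rank-$r$ truncated projection of $\mathcal X_t-\frac1\beta\nabla f(\mathcal X_t)$ onto $\mathcal B$ exists, does not depend on the choice of the t-SVD or of $s$, and equals $\mathcal X_{t+1}$; so all the projections can be replaced by rank-$r$ truncated projections without changing the sequence $(\mathcal X_t)_{t\ge1}$. In particular, for all $t\ge2$, $$f(\mathcal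 X_t)-f(\mathcal X^*)\le\frac{\beta\|\mathcal X_1-\mathcal X^*\|_F^2}{2(t-1)}.$$ (2) Suppose moreover that $f(\mathcal X)=g(\mathcal A(\mathcal X))+\langle\mathcal C,\mathcal X\rangle$, where $\mathcal A:\mathbb{R}^{n_1\times\cdots\times n_d}\to\mathbb{R}^{q}$ is linear and $g:\mathbb{R}^q\to\mathbb{R}$ is $\alpha$-strongly convex, $\alpha>0$, and that $\mathcal X^*$ is the unique minimizer of $f$ over $\mathcal B$ and satisfies strict complementarity, i.e. $-\nabla f(\mathcal X^*)$ lies in the relative interior of the normal cone of $\mathcal B$ at $\mathcal X^*$. Then there is a $\gamma>0$, independent of $\mathcal X_1$, such that $f(\mathcal X)-f(\mathcal X^*)\ge\gamma\|\mathcal X-\mathcal X^*\|_F^2$ for all $\mathcal X\in\mathcal B$, and such that for every run of projected gradient descent (from any $\mathcal X_1\in\mathcal B$) and all $t\ge2$, $$f(\mathcal X_t)-f(\mathcal X^*)\le\frac{\beta\|\mathcal X_1-\mathcal X^*\|_F^2}{2}\left(\frac1{1+\frac{2\gamma}{\beta}}\right)^{t-1}.$$ -/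

import Mathlib

namespace TNN

/-- The multi-indices `(i_3, …, i_d)` of the frontal slices; here `k = d - 2` and
`n j` is the size of the `(j + 3)`-rd mode. -/
abbrev SliceIdx {k : ℕ} (n : Fin k → ℕ) : Type := (j : Fin k) → Fin (n j)

/-- Real tensors of size `n₁ × n₂ × n 0 × ⋯ × n (k-1)`, with the entrywise inner product and
the Frobenius norm. -/
abbrev Tensor (n₁ n₂ : ℕ) {k : ℕ} (n : Fin k → ℕ) : Type :=
  EuclideanSpace ℝ (Fin n₁ × Fin n₂ × SliceIdx n)

variable {n₁ n₂ k : ℕ} {n : Fin k → ℕ}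

/-- `N = n_3 ⋯ n_d`, the number of frontal slices. -/
def numSlices (n : Fin k → ℕ) : ℕ := ∏ j, n j

/-- The frontal slice with index `i` of the discrete Fourier transform of `X` along all modes but
the first two (the unnormalized transform, with `ω_j = exp (-2π√-1 / n_j)`). -/
noncomputable def fslice (X : Tensor n₁ n₂ n) (i : SliceIdx n) :
    Matrix (Fin n₁) (Fin n₂) ℂ :=
  Matrix.of fun a b => ∑ l : SliceIdx n, ((X (a, b, l) : ℝ) : ℂ) *
    ∏ j, Complex.exp (-(2 * Real.pi * Complex.I) / (n j : ℂ)) ^ ((i j : ℕ) * (l j : ℕ))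

/-- The block diagonal matrix whose diagonal blocks are the frontal slices of the Fourier
transform of `X`. -/
noncomputable def bdiag (X : Tensor n₁ n₂ n) :
    Matrix (Fin n₁ × SliceIdx n) (Fin n₂ × SliceIdx n) ℂ :=
  Matrix.blockDiagonal (fslice X)

/-- The singular values of a complex matrix in decreasing order, counted from `0`:
`sv M j` is `σ_{j+1}(M)`. -/
noncomputable def sv {p q : Type*} [Fintype p] [Fintype q] [DecidableEq q]
    (M : Matrix p q ℂ) (j : ℕ) : ℝ :=
  (Matrix.toEuclideanLin M).singularValues j

/-- `#σ_1(M)`: the multiplicity of the largest singular value, among the `min p q` singular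
values of a `p × q` matrix. -/
noncomputable def topMult {p q : Type*} [Fintype p] [Fintype q] [DecidableEq q]
    (M : Matrix p q ℂ) : ℕ :=
  Set.ncard {j : ℕ | j < min (Fintype.card p) (Fintype.card q) ∧ sv M j = sv M 0}

/-- The tensor nuclear norm: the sum of the singular values of all frontal slices of the Fourier
transform, divided by `N`. -/
noncomputable def tnn (X : Tensor n₁ n₂ n) : ℝ :=
  (1 / (numSlices n : ℝ)) * ∑ i : SliceIdx n, ∑ j ∈ Finset.range (min n₁ n₂), sv (fslice X i) j

/-- The ball of radius `τ` of the tensor nuclear norm. -/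
def ball (n₁ n₂ : ℕ) {k : ℕ} (n : Fin k → ℕ) (τ : ℝ) : Set (Tensor n₁ n₂ n) :=
  {X | tnn X ≤ τ}

/-- `Y` is a Euclidean projection of `X` onto the set `K`. -/
def IsProj {E : Type*} [NormedAddCommGroup E] (K : Set E) (X Y : E) : Prop :=
  Y ∈ K ∧ ∀ Z ∈ K, ‖X - Y‖ ≤ ‖X - Z‖

/-- The real tensors `U` and `V` are the orthogonal factors of a t-SVD of `X`: in the Fourier
domain each frontal slice is factored by a matrix SVD with decreasingly ordered singular values.
That `U` and `V` are real is the conjugate symmetry of the SVDs of the slices. -/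
def IsTSVD (X : Tensor n₁ n₂ n) (U : Tensor n₁ n₁ n) (V : Tensor n₂ n₂ n) : Prop :=
  ∀ i : SliceIdx n,
    fslice U i ∈ Matrix.unitaryGroup (Fin n₁) ℂ ∧
    fslice V i ∈ Matrix.unitaryGroup (Fin n₂) ℂ ∧
    fslice X i = fslice U i *
      (Matrix.of fun (a : Fin n₁) (b : Fin n₂) =>
        if (a : ℕ) = (b : ℕ) then ((sv (fslice X i) a : ℝ) : ℂ) else 0) *
      (fslice V i).conjTranspose

/-- `Y` is an output of the rank-`r` truncated projection of `X` onto the tensor nuclear norm ball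
of radius `τ`: take a t-SVD, keep only the leading `r` components of each frontal slice in the
Fourier domain, and soft-threshold their singular values by an `s ≥ 0` for which the thresholded
values have sum `N τ`. -/
def IsTruncProj (r : ℕ) (τ : ℝ) (X Y : Tensor n₁ n₂ n) : Prop :=
  ∃ (U : Tensor n₁ n₁ n) (V : Tensor n₂ n₂ n) (s : ℝ), IsTSVD X U V ∧ 0 ≤ s ∧
    (1 / (numSlices n : ℝ)) *
      ∑ i : SliceIdx n, ∑ j ∈ Finset.range r, max 0 (sv (fslice X i) j - s) = τ ∧
    ∀ i : SliceIdx n, fslice Y i = fslice U i *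
      (Matrix.of fun (a : Fin n₁) (b : Fin n₂) =>
        if (a : ℕ) = (b : ℕ) ∧ (a : ℕ) < r then
          ((max 0 (sv (fslice X i) a - s) : ℝ) : ℂ) else 0) *
      (fslice V i).conjTranspose

/-- Iterates `X 1, X 2, …` of projected gradient descent with step size `1 / β` over the unit
ball of the tensor nuclear norm (`X 0` is not used). -/
def IsPGD (f : Tensor n₁ n₂ n → ℝ) (β : ℝ) (X : ℕ → Tensor n₁ n₂ n) : Prop :=
  X 1 ∈ ball n₁ n₂ n 1 ∧
  ∀ t : ℕ, 1 ≤ t →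
    IsProj (ball n₁ n₂ n 1) (X t - (1 / β) • gradient f (X t)) (X (t + 1))

/-- The largest multiplicity `#σ_1^max` of the top singular value of a frontal slice of the
Fourier transform of `G`. Only nonzero slices are taken into account: the zero slices carry no top
singular vectors. -/
noncomputable def maxTopMult (G : Tensor n₁ n₂ n) : ℕ :=
  ⨆ i : {i : SliceIdx n // fslice G i ≠ 0}, topMult (fslice G i.1)

/-- The number of nonzero frontal slices of the Fourier transform of `G`. -/
noncomputable def nnzb (G : Tensor n₁ n₂ n) : ℕ :=
  Set.ncard {i : SliceIdx n | fslice G i ≠ 0}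

/-- The generalized complementarity measure
`δ(r) = σ_1(Ḡ) - max_i σ_{r+1}(Ḡ^{(i)})`, for `G` the gradient at the optimum. -/
noncomputable def gap (G : Tensor n₁ n₂ n) (r : ℕ) : ℝ :=
  sv (bdiag G) 0 - ⨆ i : SliceIdx n, sv (fslice G i) r

/-- The radius `R_0(r)` for the step size `1 / β`, where `G` is the gradient at the optimum. -/
noncomputable def radius (β : ℝ) (G : Tensor n₁ n₂ n) (r : ℕ) : ℝ :=
  1 / (2 * β * √(numSlices n : ℝ)) *
    max
      (gap G r /
        (1 + √((maxTopMult G : ℝ) * (nnzb G : ℝ)) / (topMult (bdiag G) : ℝ)))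
      (gap G (r - maxTopMult G + 1) /
        (1 / √(maxTopMult G : ℝ) +
          √((maxTopMult G : ℝ) * (nnzb G : ℝ)) / (topMult (bdiag G) : ℝ)))

/-- The normal cone of the set `K` at the point `x`. -/
def normalCone {E : Type*} [NormedAddCommGroup E] [InnerProductSpace ℝ E] (K : Set E) (x : E) :
    Set E :=
  {y | ∀ z ∈ K, inner ℝ y (z - x) ≤ 0}

/-- Strict complementarity at `Xs`: `0 ∈ ∇f(Xs) + ri (N(Xs))`, with `N(Xs)` the normal cone of the
unit ball of the tensor nuclear norm. -/
def StrictCompl (f : Tensor n₁ n₂ n → ℝ) (Xs : Tensor n₁ n₂ n) : Prop :=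
  -gradient f Xs ∈ intrinsicInterior ℝ (normalCone (ball n₁ n₂ n 1) Xs)

end TNN

/-!
Write `G` for the gradient at the minimizer `Xs` and `σ` for the largest singular value of its
Fourier slices. Optimality of `Xs` over the unit ball is equality in the duality between the tensor
nuclear norm and the largest singular value, so every slice of `Xs` attains equality against the
contraction `W` obtained by dividing the corresponding slice of `-G` by `σ`. This forces the slice
of `Xs` to be `W ∘ H` with `H` positive semidefinite and supported where `W` is isometric.

*Part 1.* Therefore a slice of `Xs - G / β` has singular values exceeding `σ / β` only on the
isometric space of `W`, and its `(l + 1)`-th one is at most `(σ - δ(l)) / β` if `l` is at least the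
dimension of that space. Distances to `Xs` do not increase along the iteration, so each gradient
step stays within `2 ‖X 1 - Xs‖` of `Xs - G / β`. Let `s` be the largest `(r + 1)`-th singular value
of the slices of such a step. By Weyl type inequalities, inside the radius the singular values
soft-thresholded at level `s` still sum up to at least `N`; the exact threshold is thus at least
`s`, and truncation discards only singular values that the threshold annihilates anyway.

*Part 2.* The face of the ball exposed by `-G` spans the space of all tensors with slices `W ∘ H`,
`H` symmetric and supported on the isometric space of `W`, and a point `X` of the ball lies at
squared distance `O(⟪G, X - Xs⟫)` from that space. Strict complementarity puts `Xs` in the relative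
interior of the face, so uniqueness of the minimizer makes the linear map `(A, ⟪G, ·⟫)` injective
on the span. Together with the strong convexity of `g` this gives quadratic growth, and quadratic
growth turns the sublinear rate into a linear one.
-/

namespace TNN

open Module InnerProductSpace ComplexConjugate

section SingularValues

variable {𝕜 : Type*} [RCLike 𝕜]
  {E : Type*} [NormedAddCommGroup E] [InnerProductSpace 𝕜 E]
  {F : Type*} [NormedAddCommGroup F] [InnerProductSpace 𝕜 F]

theorem norm_sq_apply_eq_sum {ι : Type*} [Fintype ι] (b : OrthonormalBasis ι 𝕜 E)
    (T : E →ₗ[𝕜] F) (hT : Pairwise fun j k => inner 𝕜 (T (b j)) (T (b k)) = 0) (x : E) :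
    ‖T x‖ ^ 2 = ∑ j, ‖inner 𝕜 (b j) x‖ ^ 2 * ‖T (b j)‖ ^ 2 := by
  have hx : T x = ∑ j, inner 𝕜 (b j) x • T (b j) := by
    conv_lhs => rw [← b.sum_repr' x]
    simp only [map_sum, map_smul]
  have hpythagoras : inner 𝕜 (T x) (T x) =
      ((∑ j, ‖inner 𝕜 (b j) x‖ ^ 2 * ‖T (b j)‖ ^ 2 : ℝ) : 𝕜) := by
    rw [hx]
    simp only [inner_sum, sum_inner, inner_smul_left, inner_smul_right]
    push_cast
    refine Finset.sum_congr rfl fun j _ => ?_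
    rw [Finset.sum_eq_single j (fun k _ hk => by rw [hT hk]; ring) (by simp),
      inner_self_eq_norm_sq_to_K, ← mul_assoc, RCLike.mul_conj]
  rw [inner_self_eq_norm_sq_to_K] at hpythagoras
  exact_mod_cast hpythagoras

theorem orthonormal_inv_norm_smul {ι : Type*} {w : ι → F}
    (hw : Pairwise fun j k => inner 𝕜 (w j) (w k) = 0) (h0 : ∀ j, w j ≠ 0) :
    Orthonormal 𝕜 fun j => ((‖w j‖⁻¹ : ℝ) : 𝕜) • w j :=
  ⟨fun j => by simp [norm_smul, h0 j], fun j k hjk => by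
    simp [inner_smul_left, inner_smul_right, hw hjk]⟩

/-- The span of the first `j` vectors of an orthonormal basis. For singular bases it is the
optimal subspace in the min-max characterization of singular values. -/
def headSpan {p : ℕ} (b : OrthonormalBasis (Fin p) 𝕜 E) (j : ℕ) : Submodule 𝕜 E :=
  Submodule.span 𝕜 (b '' {k | (k : ℕ) < j})

theorem finrank_headSpan {p : ℕ} (b : OrthonormalBasis (Fin p) 𝕜 E) (j : ℕ) :
    finrank 𝕜 (headSpan b j) = min p j := by
  classical
  have hcard := finrank_span_set_eq_card (R := 𝕜) (s := b '' {k | (k : ℕ) < j})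
    (b.orthonormal.linearIndependent.linearIndepOn_id.mono (Set.image_subset_range _ _))
  rw [headSpan, hcard, Set.toFinset_image,
    Finset.card_image_of_injective _ b.orthonormal.linearIndependent.injective]
  simpa using Fin.card_filter_val_lt (n := p) (m := j)

theorem mem_headSpan_iff {p : ℕ} {b : OrthonormalBasis (Fin p) 𝕜 E} {j : ℕ} {x : E} :
    x ∈ headSpan b j ↔ ∀ k : Fin p, j ≤ k → inner 𝕜 (b k) x = 0 := by
  constructor
  · intro hx k hk
    refine Submodule.span_le (p := (LinearMap.ker (innerₛₗ 𝕜 (b k)))).2 ?_ hx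
    rintro _ ⟨l, hl, rfl⟩
    exact b.orthonormal.2 fun h => (h ▸ hl : (k : ℕ) < j).not_ge hk
  · intro hx
    rw [← b.sum_repr' x]
    refine Submodule.sum_mem _ fun k _ => ?_
    by_cases hk : j ≤ k
    · rw [hx k hk, zero_smul]
      exact Submodule.zero_mem _
    · exact Submodule.smul_mem _ _ (Submodule.subset_span ⟨k, not_le.1 hk, rfl⟩)

theorem inner_eq_zero_of_mem_headSpan_orthogonal {p : ℕ} {b : OrthonormalBasis (Fin p) 𝕜 E} {j : ℕ}
    {x : E} (hx : x ∈ (headSpan b j)ᗮ) {k : Fin p} (hk : (k : ℕ) < j) : inner 𝕜 (b k) x = 0 :=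
  hx _ (Submodule.subset_span ⟨k, hk, rfl⟩)

theorem exists_ne_zero_mem_inf_orthogonal [FiniteDimensional 𝕜 E] {S U : Submodule 𝕜 E}
    (h : finrank 𝕜 S < finrank 𝕜 U) : ∃ x ∈ U, x ∈ Sᗮ ∧ x ≠ 0 := by
  by_contra! hc
  have hbot : U ⊓ Sᗮ = ⊥ := by
    rw [Submodule.eq_bot_iff]
    exact fun x hx => hc x hx.1 hx.2
  have hsup := Submodule.finrank_sup_add_finrank_inf_eq U Sᗮ
  have horth := S.finrank_add_finrank_orthogonal
  have hle := Submodule.finrank_le (U ⊔ Sᗮ)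
  rw [hbot, finrank_bot] at hsup
  omega

theorem norm_apply_le_of_mem_headSpan_orthogonal {p : ℕ} {b : OrthonormalBasis (Fin p) 𝕜 E}
    {T : E →ₗ[𝕜] F} (hT : Pairwise fun j k => inner 𝕜 (T (b j)) (T (b k)) = 0) {j : ℕ} {c : ℝ}
    (hc0 : 0 ≤ c) (hc : ∀ k : Fin p, j ≤ k → ‖T (b k)‖ ≤ c) {x : E} (hx : x ∈ (headSpan b j)ᗮ) :
    ‖T x‖ ≤ c * ‖x‖ := by
  refine le_of_sq_le_sq ?_ (by positivity)
  rw [norm_sq_apply_eq_sum b T hT, mul_pow, ← b.sum_sq_norm_inner_right x, Finset.mul_sum]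
  refine Finset.sum_le_sum fun k _ => ?_
  rcases lt_or_ge (k : ℕ) j with hk | hk
  · simp [inner_eq_zero_of_mem_headSpan_orthogonal hx hk]
  · rw [mul_comm]
    gcongr
    exact hc k hk

theorem le_norm_apply_of_mem_headSpan {p : ℕ} {b : OrthonormalBasis (Fin p) 𝕜 E}
    {T : E →ₗ[𝕜] F} (hT : Pairwise fun j k => inner 𝕜 (T (b j)) (T (b k)) = 0) {j : ℕ} {c : ℝ}
    (hc0 : 0 ≤ c) (hc : ∀ k : Fin p, (k : ℕ) < j → c ≤ ‖T (b k)‖) {x : E} (hx : x ∈ headSpan b j) :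
    c * ‖x‖ ≤ ‖T x‖ := by
  refine le_of_sq_le_sq ?_ (norm_nonneg _)
  rw [norm_sq_apply_eq_sum b T hT, mul_pow, ← b.sum_sq_norm_inner_right x, Finset.mul_sum]
  refine Finset.sum_le_sum fun k _ => ?_
  rcases lt_or_ge (k : ℕ) j with hk | hk
  · rw [mul_comm]
    gcongr
    exact hc k hk
  · simp [mem_headSpan_iff.1 hx k hk]

theorem norm_apply_le_of_norm_apply_basis_le {p : ℕ} {b : OrthonormalBasis (Fin p) 𝕜 E}
    {T : E →ₗ[𝕜] F} (hT : Pairwise fun j k => inner 𝕜 (T (b j)) (T (b k)) = 0) {c : ℝ}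
    (hc0 : 0 ≤ c) (hc : ∀ k, ‖T (b k)‖ ≤ c) (x : E) : ‖T x‖ ≤ c * ‖x‖ :=
  norm_apply_le_of_mem_headSpan_orthogonal (j := 0) hT hc0 (fun k _ => hc k) (by simp [headSpan])

theorem exists_leftSingularBasis [FiniteDimensional 𝕜 F] {p q : ℕ} (hq : finrank 𝕜 F = q)
    {T : E →ₗ[𝕜] F} {b : OrthonormalBasis (Fin p) 𝕜 E}
    (hb : Pairwise fun j k => inner 𝕜 (T (b j)) (T (b k)) = 0) :
    ∃ a : OrthonormalBasis (Fin q) 𝕜 F, ∀ (j : Fin p) (hj : (j : ℕ) < q),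
      T (b j) = (‖T (b j)‖ : 𝕜) • a ⟨j, hj⟩ := by
  let v : Fin q → F := fun j => if h : (j : ℕ) < p then
    ((‖T (b ⟨j, h⟩)‖⁻¹ : ℝ) : 𝕜) • T (b ⟨j, h⟩) else 0
  let s : Set (Fin q) := {j | ∃ h : (j : ℕ) < p, T (b ⟨j, h⟩) ≠ 0}
  have hv : Orthonormal 𝕜 (s.domRestrict v) := by
    convert orthonormal_inv_norm_smul (𝕜 := 𝕜) (w := fun j : s => T (b ⟨j.1, j.2.1⟩))
      (fun j k hjk => hb fun h => hjk (Subtype.ext (Fin.ext (Fin.mk.inj h))))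
      (fun j => j.2.2) using 2 with j
    exact dif_pos j.2.1
  obtain ⟨a, ha⟩ := hv.exists_orthonormalBasis_extension_of_card_eq (by simpa using hq)
  refine ⟨a, fun j hj => ?_⟩
  by_cases h0 : T (b j) = 0
  · simp [h0]
  · have hnorm : (‖T (b j)‖ : 𝕜) ≠ 0 := by simpa using h0
    rw [ha ⟨j, hj⟩ ⟨j.2, h0⟩]
    simp only [v, dif_pos j.2, RCLike.ofReal_inv, smul_inv_smul₀ hnorm]

variable [FiniteDimensional 𝕜 E] [FiniteDimensional 𝕜 F]

theorem exists_rightSingularBasis {p : ℕ} (hp : finrank 𝕜 E = p) (T : E →ₗ[𝕜] F) :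
    ∃ b : OrthonormalBasis (Fin p) 𝕜 E, (Pairwise fun j k => inner 𝕜 (T (b j)) (T (b k)) = 0) ∧
      ∀ j, ‖T (b j)‖ = T.singularValues j := by
  set b := T.isSymmetric_adjoint_comp_self.eigenvectorBasis hp
  have hinner : ∀ j k, inner 𝕜 (T (b j)) (T (b k)) =
      if j = k then ((T.singularValues j ^ 2 : ℝ) : 𝕜) else 0 := by
    intro j k
    rw [← LinearMap.adjoint_inner_left, ← LinearMap.comp_apply,
      T.isSymmetric_adjoint_comp_self.apply_eigenvectorBasis hp, inner_smul_left,
      OrthonormalBasis.inner_eq_ite, T.sq_singularValues_fin hp]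
    split_ifs <;> simp
  refine ⟨b, fun j k h => (hinner j k).trans (if_neg h), fun j => ?_⟩
  have hsq := hinner j j
  rw [if_pos rfl, inner_self_eq_norm_sq_to_K] at hsq
  exact (sq_eq_sq₀ (norm_nonneg _) (T.singularValues_nonneg _)).1 (by exact_mod_cast hsq)

theorem le_singularValues_of_subspace (T : E →ₗ[𝕜] F) {U : Submodule 𝕜 E} {j : ℕ} {c : ℝ}
    (hU : j < finrank 𝕜 U) (h : ∀ x ∈ U, c * ‖x‖ ≤ ‖T x‖) : c ≤ T.singularValues j := by
  obtain ⟨b, hb, hn⟩ := exists_rightSingularBasis rfl T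
  obtain ⟨x, hxU, hxS, hx0⟩ := exists_ne_zero_mem_inf_orthogonal (S := headSpan b j) (U := U)
    (by rw [finrank_headSpan]; omega)
  have hle := norm_apply_le_of_mem_headSpan_orthogonal hb (T.singularValues_nonneg j)
    (fun k hk => (hn k).trans_le (T.singularValues_antitone hk)) hxS
  exact le_of_mul_le_mul_right ((h x hxU).trans hle) (norm_pos_iff.2 hx0)

theorem singularValues_le_of_subspace (T : E →ₗ[𝕜] F) {S : Submodule 𝕜 E} {j : ℕ} {c : ℝ}
    (hc : 0 ≤ c) (hS : finrank 𝕜 S ≤ j) (h : ∀ x ∈ Sᗮ, ‖T x‖ ≤ c * ‖x‖) :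
    T.singularValues j ≤ c := by
  rcases le_or_gt (finrank 𝕜 E) j with hj | hj
  · rwa [T.singularValues_of_finrank_le hj]
  obtain ⟨b, hb, hn⟩ := exists_rightSingularBasis rfl T
  obtain ⟨x, hxU, hxS, hx0⟩ := exists_ne_zero_mem_inf_orthogonal
    (S := S) (U := headSpan b (j + 1)) (by rw [finrank_headSpan]; omega)
  have hle := le_norm_apply_of_mem_headSpan hb (T.singularValues_nonneg j)
    (fun k hk => (T.singularValues_antitone (Nat.lt_succ_iff.1 hk)).trans_eq (hn k).symm) hxU
  exact le_of_mul_le_mul_right (hle.trans (h x hxS)) (norm_pos_iff.2 hx0)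

theorem singularValues_eq_norm_apply_basis {p : ℕ} (b : OrthonormalBasis (Fin p) 𝕜 E)
    (T : E →ₗ[𝕜] F) (hT : Pairwise fun j k => inner 𝕜 (T (b j)) (T (b k)) = 0)
    (hanti : Antitone fun j => ‖T (b j)‖) (j : Fin p) : T.singularValues j = ‖T (b j)‖ := by
  apply le_antisymm
  · refine singularValues_le_of_subspace T (norm_nonneg _) (S := headSpan b j)
      (by rw [finrank_headSpan]; omega) fun x hx => ?_
    exact norm_apply_le_of_mem_headSpan_orthogonal hT (norm_nonneg _) (fun k hk => hanti hk) hx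
  · refine le_singularValues_of_subspace T (U := headSpan b (j + 1))
      (by rw [finrank_headSpan]; omega) fun x hx => ?_
    exact le_norm_apply_of_mem_headSpan hT (norm_nonneg _)
      (fun k hk => hanti (Nat.lt_succ_iff.1 hk)) hx

theorem norm_apply_le_singularValues_zero_mul (T : E →ₗ[𝕜] F) (x : E) :
    ‖T x‖ ≤ T.singularValues 0 * ‖x‖ := by
  obtain ⟨b, hb, hn⟩ := exists_rightSingularBasis rfl T
  exact norm_apply_le_of_norm_apply_basis_le hb (T.singularValues_nonneg 0)
    (fun k => (hn k).trans_le (T.singularValues_antitone k.val.zero_le)) x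

theorem singularValues_eq_zero_of_finrank_codomain_le (T : E →ₗ[𝕜] F) {j : ℕ}
    (hj : finrank 𝕜 F ≤ j) : T.singularValues j = 0 :=
  T.singularValues_eq_zero_iff_le_finrank_range.2 ((Submodule.finrank_le _).trans hj)

theorem exists_svd {p q : ℕ} (hp : finrank 𝕜 E = p) (hq : finrank 𝕜 F = q) (T : E →ₗ[𝕜] F) :
    ∃ (b : OrthonormalBasis (Fin p) 𝕜 E) (a : OrthonormalBasis (Fin q) 𝕜 F),
      ∀ j : Fin p, T (b j) = if h : (j : ℕ) < q then
        (T.singularValues j : 𝕜) • a ⟨j, h⟩ else 0 := by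
  obtain ⟨b, hb, hn⟩ := exists_rightSingularBasis hp T
  obtain ⟨a, ha⟩ := exists_leftSingularBasis hq hb
  refine ⟨b, a, fun j => ?_⟩
  split_ifs with h
  · rw [← hn, ← ha j h]
  · rw [← norm_eq_zero, hn,
      singularValues_eq_zero_of_finrank_codomain_le T (hq.trans_le (not_lt.1 h))]

end SingularValues

section DiagMap

variable {𝕜 : Type*} [RCLike 𝕜]
  {E : Type*} [NormedAddCommGroup E] [InnerProductSpace 𝕜 E]
  {F : Type*} [NormedAddCommGroup F] [InnerProductSpace 𝕜 F]
  {p q : ℕ} (b : OrthonormalBasis (Fin p) 𝕜 E) (a : OrthonormalBasis (Fin q) 𝕜 F)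

/-- The linear map `∑ j, c j • a j (b j)ᴴ`, the sum running over `j < min q p`. -/
noncomputable def diagMap (c : ℕ → ℝ) : E →ₗ[𝕜] F :=
  b.toBasis.constr 𝕜 fun j => if h : (j : ℕ) < q then (c j : 𝕜) • a ⟨j, h⟩ else 0

theorem diagMap_basis (c : ℕ → ℝ) (j : Fin p) :
    diagMap b a c (b j) = if h : (j : ℕ) < q then (c j : 𝕜) • a ⟨j, h⟩ else 0 := by
  rw [diagMap, ← b.coe_toBasis, Basis.constr_basis]

theorem eq_diagMap {T : E →ₗ[𝕜] F} {c : ℕ → ℝ}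
    (hT : ∀ j : Fin p, T (b j) = if h : (j : ℕ) < q then (c j : 𝕜) • a ⟨j, h⟩ else 0) :
    T = diagMap b a c :=
  b.toBasis.ext fun j => by rw [b.coe_toBasis, hT, diagMap_basis]

theorem diagMap_add (c d : ℕ → ℝ) : diagMap b a (c + d) = diagMap b a c + diagMap b a d := by
  symm
  refine eq_diagMap b a fun j => ?_
  rw [LinearMap.add_apply, diagMap_basis, diagMap_basis]
  split_ifs <;> simp [add_smul]

theorem diagMap_sub (c d : ℕ → ℝ) : diagMap b a (c - d) = diagMap b a c - diagMap b a d := by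
  rw [eq_sub_iff_add_eq, ← diagMap_add, sub_add_cancel]

theorem pairwise_inner_diagMap_basis (c : ℕ → ℝ) :
    Pairwise fun j k => inner 𝕜 (diagMap b a c (b j)) (diagMap b a c (b k)) = 0 := by
  intro j k hjk
  simp only [diagMap_basis]
  split_ifs with hj hk
  · have hne : (⟨j, hj⟩ : Fin q) ≠ ⟨k, hk⟩ := fun h => hjk (Fin.ext (Fin.mk.inj h))
    rw [inner_smul_left, inner_smul_right, a.orthonormal.2 hne, mul_zero, mul_zero]
  all_goals simp

theorem norm_diagMap_le {c : ℕ → ℝ} {t : ℝ} (ht : 0 ≤ t) (hc : ∀ j < min q p, |c j| ≤ t) (x : E) :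
    ‖diagMap b a c x‖ ≤ t * ‖x‖ := by
  refine norm_apply_le_of_norm_apply_basis_le (pairwise_inner_diagMap_basis b a c) ht
    (fun k => ?_) x
  rw [diagMap_basis]
  split_ifs with h
  · simpa [norm_smul] using hc k (lt_min h k.2)
  · simpa using ht

theorem diagMap_self_basis (c : ℕ → ℝ) (j : Fin p) : diagMap b b c (b j) = (c j : 𝕜) • b j := by
  rw [diagMap_basis, dif_pos j.2]

theorem inner_diagMap_self_left (c : ℕ → ℝ) (x y : E) :
    inner 𝕜 (diagMap b b c x) y = ∑ j : Fin p, (c j : 𝕜) * (inner 𝕜 x (b j) * inner 𝕜 (b j) y) := by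
  conv_lhs => rw [← b.sum_repr' x]
  simp only [map_sum, map_smul, diagMap_self_basis, sum_inner, inner_smul_left, inner_conj_symm,
    RCLike.conj_ofReal]
  exact Finset.sum_congr rfl fun j _ => by ring

theorem isPositive_diagMap_self {c : ℕ → ℝ} (hc : ∀ j, 0 ≤ c j) :
    (diagMap b b c).IsPositive := by
  refine ⟨fun x y => ?_, fun x => ?_⟩
  · rw [inner_diagMap_self_left, ← inner_conj_symm x, inner_diagMap_self_left, map_sum]
    refine Finset.sum_congr rfl fun j _ => ?_
    simp only [map_mul, inner_conj_symm, RCLike.conj_ofReal]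
    ring
  · rw [inner_diagMap_self_left, map_sum]
    refine Finset.sum_nonneg fun j _ => ?_
    rw [RCLike.re_ofReal_mul, inner_mul_symm_re_eq_norm]
    exact mul_nonneg (hc j) (norm_nonneg _)

theorem exists_eq_diagMap [FiniteDimensional 𝕜 E] [FiniteDimensional 𝕜 F] (T : E →ₗ[𝕜] F) :
    ∃ (b : OrthonormalBasis (Fin (finrank 𝕜 E)) 𝕜 E) (a : OrthonormalBasis (Fin (finrank 𝕜 F)) 𝕜 F),
      T = diagMap b a T.singularValues := by
  obtain ⟨b, a, h⟩ := exists_svd rfl rfl T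
  exact ⟨b, a, eq_diagMap b a h⟩

theorem sum_fin_dite {φ : (j : Fin p) → (j : ℕ) < q → ℝ} {ψ : ℕ → ℝ}
    (h : ∀ j hj, φ j hj = ψ j) :
    ∑ j : Fin p, (if hj : (j : ℕ) < q then φ j hj else 0) = ∑ j ∈ Finset.range (min q p), ψ j := by
  have hφ (j : Fin p) : (if hj : (j : ℕ) < q then φ j hj else 0) =
      (fun j : ℕ => if j < q then ψ j else 0) j := by
    by_cases hj : (j : ℕ) < q <;> simp [hj, h]
  have hrange : {j ∈ Finset.range p | j < q} = Finset.range (min q p) := by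
    ext j
    simp [and_comm]
  rw [Finset.sum_congr rfl fun j _ => hφ j,
    ← Finset.sum_range (fun j : ℕ => if j < q then ψ j else 0), ← Finset.sum_filter, hrange]

end DiagMap

section HilbertSchmidt

variable {𝕜 : Type*} [RCLike 𝕜]
  {E : Type*} [NormedAddCommGroup E] [InnerProductSpace 𝕜 E] [FiniteDimensional 𝕜 E]
  {F : Type*} [NormedAddCommGroup F] [InnerProductSpace 𝕜 F] [FiniteDimensional 𝕜 F]
  {G : Type*} [NormedAddCommGroup G] [InnerProductSpace 𝕜 G] [FiniteDimensional 𝕜 G]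

/-- The real part of the Hilbert-Schmidt inner product. -/
noncomputable def hs (T S : E →ₗ[𝕜] F) : ℝ :=
  RCLike.re (LinearMap.trace 𝕜 E (LinearMap.adjoint T ∘ₗ S))

theorem hs_eq_sum {ι : Type*} [Fintype ι] (b : OrthonormalBasis ι 𝕜 E) (T S : E →ₗ[𝕜] F) :
    hs T S = ∑ j, RCLike.re (inner 𝕜 (T (b j)) (S (b j))) := by
  rw [hs, LinearMap.trace_eq_sum_inner _ b, map_sum]
  simp [LinearMap.adjoint_inner_right]

theorem hs_comm (T S : E →ₗ[𝕜] F) : hs T S = hs S T := by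
  rw [hs_eq_sum (stdOrthonormalBasis 𝕜 E), hs_eq_sum (stdOrthonormalBasis 𝕜 E)]
  exact Finset.sum_congr rfl fun j _ => inner_re_symm _ _

theorem hs_add_right (T S R : E →ₗ[𝕜] F) : hs T (S + R) = hs T S + hs T R := by
  simp [hs, LinearMap.comp_add]

theorem hs_smul_right (c : ℝ) (T S : E →ₗ[𝕜] F) : hs T ((c : 𝕜) • S) = c * hs T S := by
  simp [hs, LinearMap.comp_smul]

theorem hs_add_left (T S R : E →ₗ[𝕜] F) : hs (T + S) R = hs T R + hs S R := by
  rw [hs_comm, hs_add_right, hs_comm R, hs_comm R]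

theorem hs_smul_left (c : ℝ) (T S : E →ₗ[𝕜] F) : hs ((c : 𝕜) • T) S = c * hs T S := by
  rw [hs_comm, hs_smul_right, hs_comm]

theorem hs_neg_right (T S : E →ₗ[𝕜] F) : hs T (-S) = -hs T S := by
  simp [hs, LinearMap.comp_neg]

theorem hs_neg_left (T S : E →ₗ[𝕜] F) : hs (-T) S = -hs T S := by
  rw [hs_comm, hs_neg_right, hs_comm]

theorem hs_sub_right (T S R : E →ₗ[𝕜] F) : hs T (S - R) = hs T S - hs T R := by
  rw [sub_eq_add_neg, hs_add_right, hs_neg_right, sub_eq_add_neg]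

theorem hs_sub_left (T S R : E →ₗ[𝕜] F) : hs (T - S) R = hs T R - hs S R := by
  rw [sub_eq_add_neg, hs_add_left, hs_neg_left, sub_eq_add_neg]

theorem hs_self_eq_sum {ι : Type*} [Fintype ι] (b : OrthonormalBasis ι 𝕜 E) (T : E →ₗ[𝕜] F) :
    hs T T = ∑ j, ‖T (b j)‖ ^ 2 := by
  simp only [hs_eq_sum b, inner_self_eq_norm_sq]

theorem hs_self_nonneg (T : E →ₗ[𝕜] F) : 0 ≤ hs T T := by
  rw [hs_self_eq_sum (stdOrthonormalBasis 𝕜 E)]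
  positivity

theorem eq_zero_of_hs_self_le_zero {T : E →ₗ[𝕜] F} (h : hs T T ≤ 0) : T = 0 := by
  rw [hs_self_eq_sum (stdOrthonormalBasis 𝕜 E)] at h
  refine (stdOrthonormalBasis 𝕜 E).toBasis.ext fun j => ?_
  have hj := (Finset.sum_eq_zero_iff_of_nonneg fun j _ => sq_nonneg _).1
    (h.antisymm (Finset.sum_nonneg fun j _ => sq_nonneg _)) j (Finset.mem_univ j)
  simpa using hj

theorem hs_le_sqrt_mul_sqrt (T S : E →ₗ[𝕜] F) : hs T S ≤ √(hs T T) * √(hs S S) := by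
  have b := stdOrthonormalBasis 𝕜 E
  rw [hs_eq_sum b, hs_self_eq_sum b, hs_self_eq_sum b]
  exact (Finset.sum_le_sum fun j _ => re_inner_le_norm _ _).trans
    (Real.sum_mul_le_sqrt_mul_sqrt _ _ _)

theorem hs_add_self_le (T S : E →ₗ[𝕜] F) : hs (T + S) (T + S) ≤ 2 * (hs T T + hs S S) := by
  have h := hs_self_nonneg (T - S)
  simp only [hs_sub_right, hs_sub_left, hs_add_right, hs_add_left, hs_comm S T] at h ⊢
  linarith

theorem hs_adjoint (T S : E →ₗ[𝕜] F) : hs (LinearMap.adjoint T) (LinearMap.adjoint S) = hs T S := by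
  rw [hs_comm T, hs, hs, LinearMap.adjoint_adjoint, LinearMap.trace_comp_comm']

theorem hs_comp_self_le {W : F →ₗ[𝕜] G} (hW : ∀ y, ‖W y‖ ≤ ‖y‖) (T : E →ₗ[𝕜] F) :
    hs (W ∘ₗ T) (W ∘ₗ T) ≤ hs T T := by
  simp only [hs_self_eq_sum (stdOrthonormalBasis 𝕜 E), LinearMap.comp_apply]
  gcongr
  exact hW _

theorem hs_rankOne (w : F) (v : E) (T : E →ₗ[𝕜] F) :
    hs (rankOne 𝕜 w v : E →ₗ[𝕜] F) T = RCLike.re (inner 𝕜 w (T v)) := by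
  have b := stdOrthonormalBasis 𝕜 E
  rw [hs_eq_sum b]
  conv_rhs => rw [← b.sum_repr' v, map_sum, inner_sum, map_sum]
  refine Finset.sum_congr rfl fun j _ => ?_
  simp [inner_smul_left, inner_smul_right]

/-- The nuclear norm of a linear map. -/
noncomputable def nuc (T : E →ₗ[𝕜] F) : ℝ := ∑ j ∈ Finset.range (finrank 𝕜 E), T.singularValues j

theorem nuc_nonneg (T : E →ₗ[𝕜] F) : 0 ≤ nuc T :=
  Finset.sum_nonneg fun j _ => T.singularValues_nonneg j

theorem sum_range_singularValues {φ : ℝ → ℝ} (hφ : φ 0 = 0) (T : E →ₗ[𝕜] F) {K : ℕ}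
    (hK : min (finrank 𝕜 F) (finrank 𝕜 E) ≤ K) :
    ∑ j ∈ Finset.range (finrank 𝕜 E), φ (T.singularValues j) =
      ∑ j ∈ Finset.range K, φ (T.singularValues j) := by
  have hzero : ∀ j, min (finrank 𝕜 F) (finrank 𝕜 E) ≤ j → φ (T.singularValues j) = 0 := by
    intro j hj
    rcases min_le_iff.1 hj with h | h
    · rw [singularValues_eq_zero_of_finrank_codomain_le T h, hφ]
    · rw [T.singularValues_of_finrank_le h, hφ]
  have hext : ∀ L, min (finrank 𝕜 F) (finrank 𝕜 E) ≤ L →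
      ∑ j ∈ Finset.range (min (finrank 𝕜 F) (finrank 𝕜 E)), φ (T.singularValues j) =
      ∑ j ∈ Finset.range L, φ (T.singularValues j) := fun L hL =>
    Finset.sum_subset (Finset.range_subset_range.2 hL) fun j _ hj =>
      hzero j (not_lt.1 fun h => hj (Finset.mem_range.2 h))
  rw [← hext _ (min_le_right _ _), hext K hK]

theorem nuc_eq_sum_basis {b : OrthonormalBasis (Fin (finrank 𝕜 E)) 𝕜 E} {T : E →ₗ[𝕜] F}
    (hn : ∀ j, ‖T (b j)‖ = T.singularValues j) : nuc T = ∑ j, ‖T (b j)‖ := by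
  rw [nuc, Finset.sum_range]
  simp [hn]

theorem hs_le_mul_nuc {W : E →ₗ[𝕜] F} {c : ℝ} (hW : ∀ x, ‖W x‖ ≤ c * ‖x‖) (T : E →ₗ[𝕜] F) :
    hs W T ≤ c * nuc T := by
  obtain ⟨b, -, hn⟩ := exists_rightSingularBasis rfl T
  rw [hs_eq_sum b, nuc_eq_sum_basis hn, Finset.mul_sum]
  refine Finset.sum_le_sum fun j _ => (re_inner_le_norm _ _).trans ?_
  have hWb : ‖W (b j)‖ ≤ c := by simpa using hW (b j)
  gcongr

theorem hs_le_nuc {W : E →ₗ[𝕜] F} (hW : ∀ x, ‖W x‖ ≤ ‖x‖) (T : E →ₗ[𝕜] F) :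
    hs W T ≤ nuc T := by
  simpa using hs_le_mul_nuc (c := 1) (by simpa using hW) T

theorem hs_self_eq_sum_sq (T : E →ₗ[𝕜] F) :
    hs T T = ∑ j ∈ Finset.range (finrank 𝕜 E), T.singularValues j ^ 2 := by
  obtain ⟨b, -, hn⟩ := exists_rightSingularBasis rfl T
  rw [hs_self_eq_sum b, Finset.sum_range]
  simp [hn]

theorem singularValues_le_sqrt_hs_div (T : E →ₗ[𝕜] F) (m : ℕ) :
    T.singularValues m ≤ √(hs T T) / √((m : ℝ) + 1) := by
  rw [← Real.sqrt_div (hs_self_nonneg T)]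
  apply Real.le_sqrt_of_sq_le
  rw [le_div_iff₀ (by positivity), hs_self_eq_sum_sq,
    sum_range_singularValues (φ := fun x => x ^ 2) (by simp) T
      (K := max (finrank 𝕜 E) (m + 1)) ((min_le_right _ _).trans (le_max_left _ _))]
  calc T.singularValues m ^ 2 * ((m : ℝ) + 1)
      = ∑ j ∈ Finset.range (m + 1), T.singularValues m ^ 2 := by
        rw [Finset.sum_const, Finset.card_range, nsmul_eq_mul, mul_comm, Nat.cast_succ]
    _ ≤ ∑ j ∈ Finset.range (m + 1), T.singularValues j ^ 2 := by
        refine Finset.sum_le_sum fun j hj => ?_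
        exact pow_le_pow_left₀ (T.singularValues_nonneg m)
          (T.singularValues_antitone (Nat.lt_succ_iff.1 (Finset.mem_range.1 hj))) 2
    _ ≤ _ := Finset.sum_le_sum_of_subset_of_nonneg
        (Finset.range_subset_range.2 (le_max_right _ _)) fun j _ _ => sq_nonneg _

theorem hs_diagMap_diagMap {p q : ℕ} (b : OrthonormalBasis (Fin p) 𝕜 E)
    (a : OrthonormalBasis (Fin q) 𝕜 F) (c d : ℕ → ℝ) :
    hs (diagMap b a c) (diagMap b a d) = ∑ j ∈ Finset.range (min q p), c j * d j := by
  rw [hs_eq_sum b, ← sum_fin_dite (φ := fun j _ => c j * d j) (fun _ _ => rfl)]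
  refine Finset.sum_congr rfl fun j _ => ?_
  rw [diagMap_basis, diagMap_basis]
  split_ifs
  · simp [inner_smul_left, inner_smul_right, mul_comm]
  · simp

theorem hs_diagMap_le {p q : ℕ} (b : OrthonormalBasis (Fin p) 𝕜 E)
    (a : OrthonormalBasis (Fin q) 𝕜 F) {W : E →ₗ[𝕜] F} (hW : ∀ x, ‖W x‖ ≤ ‖x‖) {c : ℕ → ℝ}
    (hc : ∀ j, 0 ≤ c j) : hs W (diagMap b a c) ≤ ∑ j ∈ Finset.range (min q p), c j := by
  rw [hs_eq_sum b, ← sum_fin_dite (φ := fun j _ => c j) (fun _ _ => rfl)]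
  refine Finset.sum_le_sum fun j _ => ?_
  rw [diagMap_basis]
  split_ifs with h
  · have hWb : ‖W (b j)‖ ≤ 1 := by simpa using hW (b j)
    refine (re_inner_le_norm _ _).trans ?_
    rw [norm_smul, a.norm_eq_one, mul_one, RCLike.norm_ofReal, abs_of_nonneg (hc j)]
    exact mul_le_of_le_one_left (hc j) hWb
  · simp

theorem exists_hs_eq_nuc (T : E →ₗ[𝕜] F) :
    ∃ W : E →ₗ[𝕜] F, (∀ x, ‖W x‖ ≤ ‖x‖) ∧ hs W T = nuc T := by
  obtain ⟨b, a, h⟩ := exists_eq_diagMap T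
  refine ⟨diagMap b a fun _ => 1, fun x => ?_, ?_⟩
  · simpa using norm_diagMap_le b a zero_le_one (by simp) x
  · conv_lhs => rw [h]
    rw [hs_diagMap_diagMap, nuc, sum_range_singularValues (φ := fun x => x) rfl T le_rfl]
    simp

theorem nuc_le_of_forall_hs_le {T : E →ₗ[𝕜] F} {t : ℝ}
    (h : ∀ W : E →ₗ[𝕜] F, (∀ x, ‖W x‖ ≤ ‖x‖) → hs W T ≤ t) : nuc T ≤ t := by
  obtain ⟨W, hW, hWT⟩ := exists_hs_eq_nuc T
  exact hWT ▸ h W hW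

theorem nuc_add_le (T S : E →ₗ[𝕜] F) : nuc (T + S) ≤ nuc T + nuc S :=
  nuc_le_of_forall_hs_le fun W hW => by
    rw [hs_add_right]
    exact add_le_add (hs_le_nuc hW T) (hs_le_nuc hW S)

theorem nuc_smul_le {c : ℝ} (hc : 0 ≤ c) (T : E →ₗ[𝕜] F) : nuc ((c : 𝕜) • T) ≤ c * nuc T :=
  nuc_le_of_forall_hs_le fun W hW => by
    rw [hs_smul_right]
    exact mul_le_mul_of_nonneg_left (hs_le_nuc hW T) hc

theorem nuc_diagMap_le {p q : ℕ} (b : OrthonormalBasis (Fin p) 𝕜 E)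
    (a : OrthonormalBasis (Fin q) 𝕜 F) {c : ℕ → ℝ} (hc : ∀ j, 0 ≤ c j) :
    nuc (diagMap b a c) ≤ ∑ j ∈ Finset.range (min q p), c j :=
  nuc_le_of_forall_hs_le fun _ hW => hs_diagMap_le b a hW hc

theorem nuc_rankOne_le (w : F) (v : E) : nuc (rankOne 𝕜 w v : E →ₗ[𝕜] F) ≤ ‖w‖ * ‖v‖ :=
  nuc_le_of_forall_hs_le fun U hU => by
    rw [hs_comm, hs_rankOne]
    exact (re_inner_le_norm _ _).trans (mul_le_mul_of_nonneg_left (hU v) (norm_nonneg _))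

theorem hs_le_sum_threshold {W : E →ₗ[𝕜] F} (hW : ∀ x, ‖W x‖ ≤ ‖x‖) (T : E →ₗ[𝕜] F) {s : ℝ}
    (hs0 : 0 ≤ s) :
    hs W T ≤ ∑ j ∈ Finset.range (finrank 𝕜 E), max 0 (T.singularValues j - s) + s * nuc W := by
  obtain ⟨b, a, h⟩ := exists_eq_diagMap T
  have hsplit : T = diagMap b a (fun j => max 0 (T.singularValues j - s)) +
      diagMap b a (fun j => min (T.singularValues j) s) := by
    rw [← diagMap_add]
    conv_lhs => rw [h]
    congr 1
    ext j
    simp only [Pi.add_apply, max_def, min_def]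
    split_ifs <;> linarith
  rw [sum_range_singularValues (φ := fun x => max 0 (x - s)) (by simpa using hs0) T le_rfl]
  conv_lhs => rw [hsplit, hs_add_right]
  refine add_le_add (hs_diagMap_le b a hW fun j => le_max_left _ _) ?_
  rw [hs_comm]
  refine hs_le_mul_nuc (norm_diagMap_le b a hs0 fun j _ => ?_) W
  rw [abs_of_nonneg (le_min (T.singularValues_nonneg j) hs0)]
  exact min_le_right _ _

end HilbertSchmidt

section Positive

variable {𝕜 : Type*} [RCLike 𝕜] {E : Type*} [NormedAddCommGroup E] [InnerProductSpace 𝕜 E]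

theorem norm_sub_norm_smul_sq_le {w u : E} (hw : ‖w‖ ≤ 1) :
    ‖u - (‖u‖ : 𝕜) • w‖ ^ 2 ≤ 2 * (‖u‖ * (‖u‖ - RCLike.re (inner 𝕜 w u))) := by
  have hsq : ‖w‖ ^ 2 ≤ 1 := pow_le_one₀ (norm_nonneg _) hw
  rw [norm_sub_sq (𝕜 := 𝕜), inner_smul_right, RCLike.re_ofReal_mul, inner_re_symm, norm_smul,
    RCLike.norm_ofReal, abs_norm, mul_pow]
  nlinarith [mul_le_mul_of_nonneg_left hsq (sq_nonneg ‖u‖)]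

theorem norm_sq_mul_one_sub_norm_sq_le (w u : E) :
    ‖u‖ ^ 2 * (1 - ‖w‖ ^ 2) ≤ 2 * (‖u‖ * (‖u‖ - RCLike.re (inner 𝕜 w u))) := by
  have hinner : RCLike.re (inner 𝕜 w u) ≤ ‖w‖ * ‖u‖ := re_inner_le_norm w u
  nlinarith [mul_le_mul_of_nonneg_left hinner (norm_nonneg u),
    mul_nonneg (sq_nonneg ‖u‖) (sq_nonneg (1 - ‖w‖))]

theorem apply_eq_zero_of_isPositive {H : E →ₗ[𝕜] E} (hH : H.IsPositive) {x : E}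
    (hx : RCLike.re (inner 𝕜 (H x) x) = 0) : H x = 0 := by
  have hquad (t : ℝ) :
      0 ≤ RCLike.re (inner 𝕜 (H (H x)) (H x)) * (t * t) + 2 * ‖H x‖ ^ 2 * t + 0 := by
    have h := hH.2 (x + (t : 𝕜) • H x)
    have hsymm : inner 𝕜 (H (H x)) x = inner 𝕜 (H x) (H x) := hH.1 (H x) x
    simp only [map_add, map_smul, inner_add_left, inner_add_right, inner_smul_left,
      inner_smul_right, hsymm, RCLike.conj_ofReal, hx, RCLike.re_ofReal_mul,
      inner_self_eq_norm_sq] at h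
    linarith
  have hdiscrim := discrim_le_zero hquad
  rw [discrim] at hdiscrim
  have hzero : ‖H x‖ ^ 2 = 0 := by nlinarith [sq_nonneg (‖H x‖ ^ 2)]
  simpa using hzero

theorem exists_pos_mul_norm_sq_le_of_isPositive [FiniteDimensional 𝕜 E] {V : Submodule 𝕜 E}
    {H : E →ₗ[𝕜] E} (hH : H.IsPositive) (hV : ∀ x ∈ V, H x = 0 → x = 0) :
    ∃ κ : ℝ, 0 < κ ∧ ∀ x ∈ V, κ * ‖x‖ ^ 2 ≤ RCLike.re (inner 𝕜 (H x) x) := by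
  have : ProperSpace E := FiniteDimensional.proper 𝕜 E
  have hcont : Continuous fun x => RCLike.re (inner 𝕜 (H x) x) :=
    RCLike.continuous_re.comp (H.continuous_of_finiteDimensional.inner continuous_id)
  have hcomp : IsCompact (Metric.sphere (0 : E) 1 ∩ V) :=
    (isCompact_sphere 0 1).inter_right V.closed_of_finiteDimensional
  obtain ⟨κ, hκ, hmin⟩ : ∃ κ : ℝ, 0 < κ ∧ ∀ x ∈ Metric.sphere (0 : E) 1 ∩ V,
      κ ≤ RCLike.re (inner 𝕜 (H x) x) := by
    refine hcomp.exists_forall_le' hcont.continuousOn fun x hx => (hH.2 x).lt_of_ne' fun h => ?_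
    have hx0 := hV x hx.2 (apply_eq_zero_of_isPositive hH h)
    simp [hx0] at hx
  refine ⟨κ, hκ, fun x hx => ?_⟩
  rcases eq_or_ne x 0 with rfl | hx0
  · simp
  · have hunit := hmin (((‖x‖⁻¹ : ℝ) : 𝕜) • x) ⟨by simp [norm_smul, hx0], V.smul_mem _ hx⟩
    rw [map_smul, inner_smul_left, inner_smul_right, RCLike.conj_ofReal, RCLike.re_ofReal_mul,
      RCLike.re_ofReal_mul, ← mul_assoc, ← mul_inv, ← sq, ← div_eq_inv_mul,
      le_div_iff₀ (by positivity)] at hunit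
    exact hunit

theorem exists_isPositive_add_smul [FiniteDimensional 𝕜 E] {V : Submodule 𝕜 E}
    {H K : E →ₗ[𝕜] E} (hH : H.IsPositive) (hK : K.IsSymmetric) (hHV : ∀ x, H x ∈ V)
    (hKV : ∀ x, K x ∈ V) (hV : ∀ x ∈ V, H x = 0 → x = 0) :
    ∃ ε : ℝ, 0 < ε ∧ ∀ t : ℝ, 0 ≤ t → t ≤ ε → (H + (t : 𝕜) • K).IsPositive := by
  obtain ⟨κ, hκ, hcoercive⟩ := exists_pos_mul_norm_sq_le_of_isPositive hH hV
  set L := K.toContinuousLinearMap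
  refine ⟨κ / (‖L‖ + 1), by positivity, fun t ht0 ht => ?_⟩
  have hsymm : (H + (t : 𝕜) • K).IsSymmetric := hH.1.add (hK.smul (by simp))
  refine ⟨hsymm, fun x => ?_⟩
  have hmem : ∀ z, (H + (t : 𝕜) • K) z ∈ V := fun z => V.add_mem (hHV z) (V.smul_mem _ (hKV z))
  have horth : ∀ z ∈ Vᗮ, (H + (t : 𝕜) • K) z = 0 := fun z hz => by
    rw [← inner_self_eq_zero (𝕜 := 𝕜), hsymm]
    exact Submodule.inner_left_of_mem_orthogonal (hmem _) hz
  obtain ⟨y, hy, z, hz, rfl⟩ := V.exists_add_mem_mem_orthogonal x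
  have hKy : -(‖L‖ * ‖y‖ ^ 2) ≤ RCLike.re (inner 𝕜 (K y) y) := by
    have hnorm : ‖K y‖ ≤ ‖L‖ * ‖y‖ := L.le_opNorm y
    have hinner := re_inner_le_norm (𝕜 := 𝕜) (-K y) y
    rw [inner_neg_left, map_neg, norm_neg] at hinner
    nlinarith [mul_le_mul_of_nonneg_right hnorm (norm_nonneg y)]
  have htL : t * ‖L‖ ≤ κ := by
    rw [le_div_iff₀ (by positivity)] at ht
    linarith
  rw [map_add, horth z hz, add_zero, inner_add_right,
    Submodule.inner_right_of_mem_orthogonal (hmem y) hz, add_zero, LinearMap.add_apply,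
    LinearMap.smul_apply, inner_add_left, inner_smul_left, RCLike.conj_ofReal, map_add,
    RCLike.re_ofReal_mul]
  nlinarith [hcoercive y hy, mul_le_mul_of_nonneg_left hKy ht0,
    mul_le_mul_of_nonneg_right htL (sq_nonneg ‖y‖)]

end Positive

section Contraction

variable {𝕜 : Type*} [RCLike 𝕜]
  {E : Type*} [NormedAddCommGroup E] [InnerProductSpace 𝕜 E] [FiniteDimensional 𝕜 E]
  {F : Type*} [NormedAddCommGroup F] [InnerProductSpace 𝕜 F] [FiniteDimensional 𝕜 F]

/-- The subspace `{x | Wᴴ W x = x}` on which a contraction `W` is isometric. -/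
noncomputable def isometricSubspace (W : E →ₗ[𝕜] F) : Submodule 𝕜 E :=
  LinearMap.eqLocus (LinearMap.adjoint W ∘ₗ W) LinearMap.id

theorem mem_isometricSubspace {W : E →ₗ[𝕜] F} {x : E} :
    x ∈ isometricSubspace W ↔ LinearMap.adjoint W (W x) = x := Iff.rfl

theorem isPositive_id_sub_adjoint_comp_self {W : E →ₗ[𝕜] F} (hW : ∀ x, ‖W x‖ ≤ ‖x‖) :
    (LinearMap.id - LinearMap.adjoint W ∘ₗ W).IsPositive := by
  refine ⟨LinearMap.IsSymmetric.id.sub (LinearMap.isPositive_adjoint_comp_self W).1, fun x => ?_⟩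
  rw [LinearMap.sub_apply, inner_sub_left, LinearMap.comp_apply, LinearMap.adjoint_inner_left,
    map_sub, LinearMap.id_apply, inner_self_eq_norm_sq, inner_self_eq_norm_sq, sub_nonneg]
  exact pow_le_pow_left₀ (norm_nonneg _) (hW x) 2

theorem exists_pos_mul_norm_sub_starProjection_sq_le {W : E →ₗ[𝕜] F} (hW : ∀ x, ‖W x‖ ≤ ‖x‖) :
    ∃ κ : ℝ, 0 < κ ∧ ∀ x,
      κ * ‖x - (isometricSubspace W).starProjection x‖ ^ 2 ≤ ‖x‖ ^ 2 - ‖W x‖ ^ 2 := by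
  have hpos := isPositive_id_sub_adjoint_comp_self hW
  set D := LinearMap.id - LinearMap.adjoint W ∘ₗ W
  set V := isometricSubspace W
  have hker : ∀ x ∈ V, D x = 0 := fun x hx => sub_eq_zero.2 (mem_isometricSubspace.1 hx).symm
  have hinj : ∀ x ∈ Vᗮ, D x = 0 → x = 0 := fun x hx hDx =>
    inner_self_eq_zero.1 (hx x (mem_isometricSubspace.2 (sub_eq_zero.1 hDx).symm))
  obtain ⟨κ, hκ, hcoercive⟩ := exists_pos_mul_norm_sq_le_of_isPositive hpos hinj
  refine ⟨κ, hκ, fun x => (hcoercive _ (V.sub_starProjection_mem_orthogonal x)).trans_eq ?_⟩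
  have hDP := hker _ (V.starProjection_apply_mem x)
  rw [map_sub, hDP, sub_zero, inner_sub_right, hpos.1 x (V.starProjection x), hDP,
    inner_zero_right, sub_zero, LinearMap.sub_apply, inner_sub_left, LinearMap.comp_apply,
    LinearMap.adjoint_inner_left, map_sub, LinearMap.id_apply, inner_self_eq_norm_sq,
    inner_self_eq_norm_sq]

theorem nuc_comp_le_hs {W : E →ₗ[𝕜] F} (hW : ∀ x, ‖W x‖ ≤ ‖x‖) {H : E →ₗ[𝕜] E}
    (hH : H.IsPositive) (hHW : ∀ x, H x ∈ isometricSubspace W) :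
    nuc (W ∘ₗ H) ≤ hs W (W ∘ₗ H) := by
  refine nuc_le_of_forall_hs_le fun V hV => ?_
  set b := hH.1.eigenvectorBasis rfl
  rw [hs_eq_sum b, hs_eq_sum b]
  refine Finset.sum_le_sum fun j _ => ?_
  have heig : H (b j) = ((hH.1.eigenvalues rfl j : ℝ) : 𝕜) • b j :=
    hH.1.apply_eigenvectorBasis rfl j
  have hright : RCLike.re (inner 𝕜 (W (b j)) ((W ∘ₗ H) (b j))) = hH.1.eigenvalues rfl j := by
    rw [← LinearMap.adjoint_inner_right, LinearMap.comp_apply, mem_isometricSubspace.1 (hHW _),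
      heig, inner_smul_right, RCLike.re_ofReal_mul, inner_self_eq_norm_sq, b.norm_eq_one, one_pow,
      mul_one]
  have hleft : ‖V (b j)‖ * ‖W (b j)‖ ≤ 1 :=
    mul_le_one₀ (by simpa using hV (b j)) (norm_nonneg _) (by simpa using hW (b j))
  rw [hright, LinearMap.comp_apply, heig, map_smul, inner_smul_right, RCLike.re_ofReal_mul]
  exact mul_le_of_le_one_right (hH.nonneg_eigenvalues rfl j)
    ((re_inner_le_norm _ _).trans hleft)

theorem sum_norm_mul_norm_sub_inner_le {W : E →ₗ[𝕜] F} (hW : ∀ x, ‖W x‖ ≤ ‖x‖) {T : E →ₗ[𝕜] F}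
    {b : OrthonormalBasis (Fin (finrank 𝕜 E)) 𝕜 E} (hn : ∀ j, ‖T (b j)‖ = T.singularValues j) :
    ∑ j, ‖T (b j)‖ * (‖T (b j)‖ - RCLike.re (inner 𝕜 (W (b j)) (T (b j)))) ≤
      nuc T * (nuc T - hs W T) := by
  have hnuc := nuc_eq_sum_basis hn
  have hdefect (j) : 0 ≤ ‖T (b j)‖ - RCLike.re (inner 𝕜 (W (b j)) (T (b j))) := by
    have hWb : ‖W (b j)‖ ≤ 1 := by simpa using hW (b j)
    exact sub_nonneg.2 ((re_inner_le_norm _ _).trans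
      (mul_le_of_le_one_left (norm_nonneg _) hWb))
  calc ∑ j, ‖T (b j)‖ * (‖T (b j)‖ - RCLike.re (inner 𝕜 (W (b j)) (T (b j))))
      ≤ ∑ j, nuc T * (‖T (b j)‖ - RCLike.re (inner 𝕜 (W (b j)) (T (b j)))) := by
        refine Finset.sum_le_sum fun j _ => mul_le_mul_of_nonneg_right ?_ (hdefect j)
        rw [hnuc]
        exact Finset.single_le_sum (f := fun j => ‖T (b j)‖) (fun j _ => norm_nonneg _)
          (Finset.mem_univ j)
    _ = nuc T * (nuc T - hs W T) := by
        rw [← Finset.mul_sum, Finset.sum_sub_distrib, ← hnuc, ← hs_eq_sum b]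

theorem hs_sub_comp_diagMap_self_le {W : E →ₗ[𝕜] F} (hW : ∀ x, ‖W x‖ ≤ ‖x‖) {T : E →ₗ[𝕜] F}
    {b : OrthonormalBasis (Fin (finrank 𝕜 E)) 𝕜 E} (hn : ∀ j, ‖T (b j)‖ = T.singularValues j) :
    hs (T - W ∘ₗ diagMap b b T.singularValues) (T - W ∘ₗ diagMap b b T.singularValues) ≤
      2 * (nuc T * (nuc T - hs W T)) := by
  rw [hs_self_eq_sum b]
  refine (Finset.sum_le_sum fun j _ => ?_).trans ((Finset.mul_sum ..).symm.trans_le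
    (mul_le_mul_of_nonneg_left (sum_norm_mul_norm_sub_inner_le hW hn) zero_le_two))
  rw [LinearMap.sub_apply, LinearMap.comp_apply, diagMap_self_basis, ← hn, map_smul]
  exact norm_sub_norm_smul_sq_le (by simpa using hW (b j))

theorem mul_hs_comp_diagMap_self_le {W : E →ₗ[𝕜] F} (hW : ∀ x, ‖W x‖ ≤ ‖x‖) {T : E →ₗ[𝕜] F}
    {b : OrthonormalBasis (Fin (finrank 𝕜 E)) 𝕜 E} (hn : ∀ j, ‖T (b j)‖ = T.singularValues j)
    {κ : ℝ} {Q : E →ₗ[𝕜] E} (hQ : ∀ x, κ * ‖Q x‖ ^ 2 ≤ ‖x‖ ^ 2 - ‖W x‖ ^ 2) :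
    κ * hs (Q ∘ₗ diagMap b b T.singularValues) (Q ∘ₗ diagMap b b T.singularValues) ≤
      2 * (nuc T * (nuc T - hs W T)) := by
  rw [hs_self_eq_sum b, Finset.mul_sum]
  refine (Finset.sum_le_sum fun j _ => ?_).trans ((Finset.mul_sum ..).symm.trans_le
    (mul_le_mul_of_nonneg_left (sum_norm_mul_norm_sub_inner_le hW hn) zero_le_two))
  refine le_trans ?_ (norm_sq_mul_one_sub_norm_sq_le (𝕜 := 𝕜) (W (b j)) (T (b j)))
  have hQb := hQ (b j)
  rw [b.norm_eq_one, one_pow] at hQb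
  rw [LinearMap.comp_apply, diagMap_self_basis, ← hn, map_smul, norm_smul, RCLike.norm_ofReal,
    abs_norm, mul_pow, mul_left_comm]
  exact mul_le_mul_of_nonneg_left hQb (sq_nonneg _)

-- `H` is the compression of `|T|` to the isometric subspace of `W`.
theorem exists_isPositive_hs_sub_comp_le {W : E →ₗ[𝕜] F} (hW : ∀ x, ‖W x‖ ≤ ‖x‖) :
    ∃ C : ℝ, 0 ≤ C ∧ ∀ T : E →ₗ[𝕜] F, ∃ H : E →ₗ[𝕜] E, H.IsPositive ∧
      (∀ x, H x ∈ isometricSubspace W) ∧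
      hs (T - W ∘ₗ H) (T - W ∘ₗ H) ≤ C * (nuc T * (nuc T - hs W T)) := by
  obtain ⟨κ, hκ, hgap⟩ := exists_pos_mul_norm_sub_starProjection_sq_le hW
  refine ⟨4 + 16 / κ, by positivity, fun T => ?_⟩
  obtain ⟨b, -, hn⟩ := exists_rightSingularBasis rfl T
  set V := isometricSubspace W
  set P : E →ₗ[𝕜] E := V.starProjection.toLinearMap
  set Q : E →ₗ[𝕜] E := LinearMap.id - P
  set A := diagMap b b T.singularValues
  set S := nuc T * (nuc T - hs W T)
  have hP : P.IsSymmetric := V.starProjection_isSymmetric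
  have hA : A.IsPositive := isPositive_diagMap_self b T.singularValues_nonneg
  have hPcontr (x : E) : ‖P x‖ ≤ ‖x‖ := V.norm_starProjection_apply_le x
  have hQA : hs (Q ∘ₗ A) (Q ∘ₗ A) ≤ 2 / κ * S := by
    rw [div_mul_eq_mul_div, le_div_iff₀' hκ]
    exact mul_hs_comp_diagMap_self_le hW hn hgap
  have hAQ : hs (A ∘ₗ Q) (A ∘ₗ Q) = hs (Q ∘ₗ A) (Q ∘ₗ A) := by
    rw [← hs_adjoint, LinearMap.adjoint_comp, hA.adjoint_eq,
      (LinearMap.IsSymmetric.id.sub hP).adjoint_eq]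
  have hPAQ := (hs_comp_self_le hW (P ∘ₗ A ∘ₗ Q)).trans (hs_comp_self_le hPcontr (A ∘ₗ Q))
  refine ⟨P ∘ₗ A ∘ₗ P, ?_, fun x => V.starProjection_apply_mem _, ?_⟩
  · simpa only [hP.adjoint_eq] using hA.conj_adjoint P
  have hsplit : T - W ∘ₗ P ∘ₗ A ∘ₗ P =
      (T - W ∘ₗ A) + (W ∘ₗ (Q ∘ₗ A) + W ∘ₗ (P ∘ₗ (A ∘ₗ Q))) := by
    ext x
    simp [Q]
  calc hs (T - W ∘ₗ P ∘ₗ A ∘ₗ P) (T - W ∘ₗ P ∘ₗ A ∘ₗ P)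
      ≤ 2 * (2 * S + 2 * (2 / κ * S + 2 / κ * S)) := by
        rw [hsplit]
        refine (hs_add_self_le _ _).trans (mul_le_mul_of_nonneg_left ?_ zero_le_two)
        refine add_le_add (hs_sub_comp_diagMap_self_le hW hn) ?_
        refine (hs_add_self_le _ _).trans (mul_le_mul_of_nonneg_left ?_ zero_le_two)
        exact add_le_add ((hs_comp_self_le hW _).trans hQA)
          (hPAQ.trans (hAQ.trans_le hQA))
    _ = (4 + 16 / κ) * S := by ring

theorem exists_isPositive_eq_comp_of_hs_eq_nuc {W T : E →ₗ[𝕜] F} (hW : ∀ x, ‖W x‖ ≤ ‖x‖)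
    (h : hs W T = nuc T) :
    ∃ H : E →ₗ[𝕜] E, H.IsPositive ∧ (∀ x, H x ∈ isometricSubspace W) ∧ T = W ∘ₗ H := by
  obtain ⟨C, -, hC⟩ := exists_isPositive_hs_sub_comp_le hW
  obtain ⟨H, hH, hHW, hdist⟩ := hC T
  refine ⟨H, hH, hHW, sub_eq_zero.1 (eq_zero_of_hs_self_le_zero ?_)⟩
  simpa [h] using hdist

end Contraction

section ProjectedGradient

open Filter Topology

variable {H : Type*} [NormedAddCommGroup H] [InnerProductSpace ℝ H] {f : H → ℝ} {K : Set H} {β : ℝ}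

theorem IsProj.inner_nonpos {P Y Z : H} (hK : Convex ℝ K) (h : IsProj K P Y) (hZ : Z ∈ K) :
    inner ℝ (P - Y) (Z - Y) ≤ 0 := by
  have : Nonempty K := ⟨⟨Y, h.1⟩⟩
  refine (norm_eq_iInf_iff_real_inner_le_zero hK h.1).1 (le_antisymm ?_ ?_) Z hZ
  · exact le_ciInf fun w => h.2 w w.2
  · exact ciInf_le ⟨0, Set.forall_mem_range.2 fun w => norm_nonneg _⟩ (⟨Y, h.1⟩ : K)

theorem IsProj.eq_of_forall_inner_nonpos {P Y Y' : H} (hK : Convex ℝ K) (h : IsProj K P Y)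
    (hY' : Y' ∈ K) (h' : ∀ Z ∈ K, inner ℝ (P - Y') (Z - Y') ≤ 0) : Y' = Y := by
  have hsum : inner ℝ (Y' - Y) (Y' - Y) =
      inner ℝ (P - Y) (Y' - Y) + inner ℝ (P - Y') (Y - Y') := by
    rw [← neg_sub Y' Y, inner_neg_right, ← sub_eq_add_neg, ← inner_sub_left,
      sub_sub_sub_cancel_left]
  have hle : inner ℝ (Y' - Y) (Y' - Y) ≤ 0 :=
    hsum ▸ add_nonpos (h.inner_nonpos hK hY') (h' Y h.1)
  exact sub_eq_zero.1 (real_inner_self_nonpos.1 hle)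

theorem two_mul_inner_sub_sub (x y z : H) :
    2 * inner ℝ (x - y) (y - z) = ‖x - z‖ ^ 2 - ‖y - z‖ ^ 2 - ‖y - x‖ ^ 2 := by
  rw [← sub_add_sub_cancel x y z, norm_add_sq_real, norm_sub_rev y x]
  ring

variable [CompleteSpace H]

theorem hasDerivAt_add_smul {x v : H} {t : ℝ} (h : DifferentiableAt ℝ f (x + t • v)) :
    HasDerivAt (fun s : ℝ => f (x + s • v)) (inner ℝ (gradient f (x + t • v)) v) t := by
  have hline : HasDerivAt (fun s : ℝ => x + s • v) v t := by
    simpa using ((hasDerivAt_id t).smul_const v).const_add x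
  rw [inner_gradient_left]
  exact h.hasFDerivAt.comp_hasDerivAt t hline

theorem tendsto_slope_add_smul {x v : H} (h : DifferentiableAt ℝ f x) :
    Tendsto (fun t : ℝ => t⁻¹ * (f (x + t • v) - f x)) (𝓝[>] 0)
      (𝓝 (inner ℝ (gradient f x) v)) := by
  have hder := hasDerivAt_add_smul (f := f) (x := x) (v := v) (t := 0) (by simpa using h)
  simpa using hder.tendsto_slope_zero_right

theorem inner_gradient_le_of_forall_add_smul_le {x v : H} (h : DifferentiableAt ℝ f x) {D c : ℝ}
    (hle : ∀ t : ℝ, 0 < t → t < 1 → f (x + t • v) ≤ f x + t * (D - (1 - t) * c)) :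
    inner ℝ (gradient f x) v ≤ D - c := by
  have hlim : Tendsto (fun t : ℝ => D - (1 - t) * c) (𝓝[>] 0) (𝓝 (D - c)) := by
    have : Continuous fun t : ℝ => D - (1 - t) * c := by fun_prop
    simpa using (this.tendsto 0).mono_left nhdsWithin_le_nhds
  refine le_of_tendsto_of_tendsto (tendsto_slope_add_smul h) hlim ?_
  filter_upwards [Ioo_mem_nhdsGT (one_pos (α := ℝ))] with t ht
  rw [inv_mul_le_iff₀ ht.1]
  linarith [hle t ht.1 ht.2]

theorem inner_gradient_sub_le_of_convexOn (hf : ConvexOn ℝ K f) {x y : H} (hx : x ∈ K)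
    (hy : y ∈ K) (h : DifferentiableAt ℝ f x) : inner ℝ (gradient f x) (y - x) ≤ f y - f x := by
  have := inner_gradient_le_of_forall_add_smul_le (c := 0) (D := f y - f x) (v := y - x) h
    fun t ht0 ht1 => by
      have hconv := hf.2 hx hy (sub_nonneg.2 ht1.le) ht0.le (by ring)
      rw [show (1 - t) • x + t • y = x + t • (y - x) by module, smul_eq_mul, smul_eq_mul] at hconv
      linarith
  simpa using this

theorem inner_gradient_sub_nonneg_of_isMinOn (hK : Convex ℝ K) {x y : H} (hx : x ∈ K)
    (h : DifferentiableAt ℝ f x) (hmin : ∀ z ∈ K, f x ≤ f z) (hy : y ∈ K) :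
    0 ≤ inner ℝ (gradient f x) (y - x) := by
  refine ge_of_tendsto (tendsto_slope_add_smul h) ?_
  filter_upwards [Ioo_mem_nhdsGT (one_pos (α := ℝ))] with t ht
  have hmem : x + t • (y - x) ∈ K := hK.add_smul_sub_mem hx hy ⟨ht.1.le, ht.2.le⟩
  exact mul_nonneg (inv_nonneg.2 ht.1.le) (sub_nonneg.2 (hmin _ hmem))

/-- `f` is `β`-smooth on `K`: it is differentiable at the points of `K` (as a function on the whole
space) and its gradient is `β`-Lipschitz on `K`. -/
structure IsSmoothOn (f : H → ℝ) (β : ℝ) (K : Set H) : Prop where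
  differentiableAt : ∀ x ∈ K, DifferentiableAt ℝ f x
  norm_gradient_sub_le : ∀ x ∈ K, ∀ y ∈ K, ‖gradient f x - gradient f y‖ ≤ β * ‖x - y‖

theorem IsSmoothOn.le_add_inner_gradient (hf : IsSmoothOn f β K) (hK : Convex ℝ K) {x y : H}
    (hx : x ∈ K) (hy : y ∈ K) :
    f y ≤ f x + inner ℝ (gradient f x) (y - x) + β / 2 * ‖y - x‖ ^ 2 := by
  set v := y - x
  set ψ : ℝ → ℝ := fun t =>
    f (x + t • v) - (t * inner ℝ (gradient f x) v + t ^ 2 * (β / 2 * ‖v‖ ^ 2))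
  have hmem : ∀ t ∈ Set.Icc (0 : ℝ) 1, x + t • v ∈ K := fun t ht => hK.add_smul_sub_mem hx hy ht
  have hder : ∀ t ∈ Set.Icc (0 : ℝ) 1, HasDerivAt ψ
      (inner ℝ (gradient f (x + t • v) - gradient f x) v - t * (β * ‖v‖ ^ 2)) t := by
    intro t ht
    have hquad := ((hasDerivAt_id t).mul_const (inner ℝ (gradient f x) v)).add
      ((hasDerivAt_pow 2 t).mul_const (β / 2 * ‖v‖ ^ 2))
    refine ((hasDerivAt_add_smul (hf.differentiableAt _ (hmem t ht))).sub hquad).congr_deriv ?_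
    rw [inner_sub_left]
    push_cast
    ring
  have hanti : AntitoneOn ψ (Set.Icc 0 1) := by
    refine antitoneOn_of_deriv_nonpos (convex_Icc 0 1)
      (fun t ht => (hder t ht).continuousAt.continuousWithinAt)
      (fun t ht => (hder t (interior_subset ht)).differentiableAt.differentiableWithinAt)
      fun t ht => ?_
    have ht' := interior_subset ht
    have hgrad := hf.norm_gradient_sub_le _ (hmem t ht') x hx
    rw [add_sub_cancel_left, norm_smul, Real.norm_of_nonneg ht'.1] at hgrad
    rw [(hder t ht').deriv, sub_nonpos]
    calc inner ℝ (gradient f (x + t • v) - gradient f x) v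
        ≤ ‖gradient f (x + t • v) - gradient f x‖ * ‖v‖ := real_inner_le_norm _ _
      _ ≤ β * (t * ‖v‖) * ‖v‖ := by gcongr
      _ = t * (β * ‖v‖ ^ 2) := by ring
  have hle := hanti (Set.left_mem_Icc.2 zero_le_one) (Set.right_mem_Icc.2 zero_le_one) zero_le_one
  have hxy : x + v = y := add_sub_cancel x y
  simp only [ψ, one_smul, zero_smul, add_zero, hxy] at hle
  linarith

section Step

variable {x y z : H}

theorem inner_gradient_le_of_isProj (hβ : 0 < β) (hK : Convex ℝ K)
    (hproj : IsProj K (x - (1 / β) • gradient f x) y) (hz : z ∈ K) :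
    inner ℝ (gradient f x) (y - z) ≤ β * inner ℝ (x - y) (y - z) := by
  have h := hproj.inner_nonpos hK hz
  rw [sub_right_comm, ← neg_sub y z, inner_neg_right, inner_sub_left, real_inner_smul_left] at h
  rw [← div_le_iff₀' hβ, div_eq_inv_mul, ← one_div]
  linarith

theorem sub_le_of_isProj (hβ : 0 < β) (hconv : ConvexOn ℝ K f) (hf : IsSmoothOn f β K)
    (hx : x ∈ K) (hproj : IsProj K (x - (1 / β) • gradient f x) y) (hz : z ∈ K) :
    f y - f z ≤ β / 2 * (‖x - z‖ ^ 2 - ‖y - z‖ ^ 2) := by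
  have hdescent := hf.le_add_inner_gradient hconv.1 hx hproj.1
  have htangent := inner_gradient_sub_le_of_convexOn hconv hx hz (hf.differentiableAt x hx)
  have hstep := inner_gradient_le_of_isProj hβ hconv.1 hproj hz
  have hsplit : inner ℝ (gradient f x) (y - x) =
      inner ℝ (gradient f x) (y - z) + inner ℝ (gradient f x) (z - x) := by
    rw [← inner_add_right, sub_add_sub_cancel]
  have hthree : β * inner ℝ (x - y) (y - z) =
      β / 2 * (‖x - z‖ ^ 2 - ‖y - z‖ ^ 2) - β / 2 * ‖y - x‖ ^ 2 := by
    linear_combination (β / 2) * two_mul_inner_sub_sub x y z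
  linarith

theorem sub_le_two_mul_norm_mul_norm_of_isProj (hβ : 0 < β) (hconv : ConvexOn ℝ K f)
    (hf : IsSmoothOn f β K) (hx : x ∈ K) (hproj : IsProj K (x - (1 / β) • gradient f x) y)
    (hz : z ∈ K) : f y - f z ≤ 2 * β * (‖x - y‖ * ‖y - z‖) := by
  have htangent := inner_gradient_sub_le_of_convexOn hconv hproj.1 hz
    (hf.differentiableAt y hproj.1)
  have hstep := inner_gradient_le_of_isProj hβ hconv.1 hproj hz
  have hchange : inner ℝ (gradient f y - gradient f x) (y - z) ≤ β * ‖x - y‖ * ‖y - z‖ := by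
    refine (real_inner_le_norm _ _).trans ?_
    rw [norm_sub_rev x y]
    gcongr
    exact hf.norm_gradient_sub_le y hproj.1 x hx
  have hinner : β * inner ℝ (x - y) (y - z) ≤ β * (‖x - y‖ * ‖y - z‖) := by
    gcongr
    exact real_inner_le_norm _ _
  rw [← neg_sub y z, inner_neg_right] at htangent
  rw [inner_sub_left] at hchange
  linarith

-- If `‖y - z‖ ≥ ‖x - z‖ / 5` then `sub_le_of_isProj` gives the factor `24 / 25`; otherwise the
-- gradient at `y` is nearly orthogonal to `y - z` and the previous bound is small enough.
theorem sub_le_mul_norm_sq_of_isProj (hβ : 0 < β) (hconv : ConvexOn ℝ K f) (hf : IsSmoothOn f β K)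
    (hx : x ∈ K) (hproj : IsProj K (x - (1 / β) • gradient f x) y) (hz : z ∈ K) :
    f y - f z ≤ β / 2 * (24 / 25 * ‖x - z‖ ^ 2) := by
  rcases le_total (‖x - z‖ / 5) ‖y - z‖ with hfar | hnear
  · refine (sub_le_of_isProj hβ hconv hf hx hproj hz).trans ?_
    have : (‖x - z‖ / 5) ^ 2 ≤ ‖y - z‖ ^ 2 := by gcongr
    gcongr
    linarith
  · have htriangle : ‖x - y‖ ≤ ‖x - z‖ + ‖y - z‖ := by
      rw [norm_sub_rev y z]
      exact norm_sub_le_norm_sub_add_norm_sub x z y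
    calc f y - f z ≤ 2 * β * (‖x - y‖ * ‖y - z‖) :=
          sub_le_two_mul_norm_mul_norm_of_isProj hβ hconv hf hx hproj hz
      _ ≤ 2 * β * ((‖x - z‖ + ‖x - z‖ / 5) * (‖x - z‖ / 5)) := by gcongr; linarith
      _ = β / 2 * (24 / 25 * ‖x - z‖ ^ 2) := by ring

end Step

/-- A run `X 1, X 2, …` of projected gradient descent for `f` over `K` with step size `1 / β`; as in
`IsPGD`, the value `X 0` plays no role. -/
def IsProjGradRun (f : H → ℝ) (β : ℝ) (K : Set H) (X : ℕ → H) : Prop :=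
  X 1 ∈ K ∧ ∀ t, 1 ≤ t → IsProj K (X t - (1 / β) • gradient f (X t)) (X (t + 1))

namespace IsProjGradRun

variable {X : ℕ → H} {z : H}

theorem mem (hX : IsProjGradRun f β K X) {t : ℕ} (ht : 1 ≤ t) : X t ∈ K := by
  induction t, ht using Nat.le_induction with
  | base => exact hX.1
  | succ t ht _ => exact (hX.2 t ht).1

theorem norm_sub_le (hX : IsProjGradRun f β K X) (hβ : 0 < β) (hconv : ConvexOn ℝ K f)
    (hf : IsSmoothOn f β K) (hz : z ∈ K) (hmin : ∀ w ∈ K, f z ≤ f w) {t : ℕ} (ht : 1 ≤ t) :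
    ‖X t - z‖ ≤ ‖X 1 - z‖ := by
  induction t, ht using Nat.le_induction with
  | base => exact le_rfl
  | succ t ht ih =>
    refine le_trans (le_of_sq_le_sq ?_ (norm_nonneg _)) ih
    have hle := sub_le_of_isProj hβ hconv hf (hX.mem ht) (hX.2 t ht) hz
    have hdecr := nonneg_of_mul_nonneg_right
      ((sub_nonneg.2 (hmin _ (hX.2 t ht).1)).trans hle) (half_pos hβ)
    exact sub_nonneg.1 hdecr

theorem apply_succ_le (hX : IsProjGradRun f β K X) (hβ : 0 < β) (hconv : ConvexOn ℝ K f)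
    (hf : IsSmoothOn f β K) {t : ℕ} (ht : 1 ≤ t) : f (X (t + 1)) ≤ f (X t) := by
  have hle := sub_le_of_isProj hβ hconv hf (hX.mem ht) (hX.2 t ht) (hX.mem ht)
  have hnonneg : 0 ≤ β / 2 * ‖X (t + 1) - X t‖ ^ 2 := by positivity
  rw [sub_self, norm_zero] at hle
  linarith

theorem sub_mul_add_norm_sq_le (hX : IsProjGradRun f β K X) (hβ : 0 < β)
    (hconv : ConvexOn ℝ K f) (hf : IsSmoothOn f β K) (hz : z ∈ K) {t : ℕ} (ht : 1 ≤ t) :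
    ((t : ℝ) - 1) * (f (X t) - f z) + β / 2 * ‖X t - z‖ ^ 2 ≤ β / 2 * ‖X 1 - z‖ ^ 2 := by
  induction t, ht using Nat.le_induction with
  | base => simp
  | succ t ht ih =>
    have hstep := sub_le_of_isProj hβ hconv hf (hX.mem ht) (hX.2 t ht) hz
    have ht0 : (0 : ℝ) ≤ (t : ℝ) - 1 := sub_nonneg.2 (by exact_mod_cast ht)
    have hdecr := mul_le_mul_of_nonneg_left (hX.apply_succ_le hβ hconv hf ht) ht0
    push_cast
    linarith

theorem sub_le_div (hX : IsProjGradRun f β K X) (hβ : 0 < β) (hconv : ConvexOn ℝ K f)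
    (hf : IsSmoothOn f β K) (hz : z ∈ K) {t : ℕ} (ht : 2 ≤ t) :
    f (X t) - f z ≤ β * ‖X 1 - z‖ ^ 2 / (2 * ((t : ℝ) - 1)) := by
  have ht1 : (2 : ℝ) ≤ t := by exact_mod_cast ht
  have hle := hX.sub_mul_add_norm_sq_le hβ hconv hf hz (one_le_two.trans ht)
  have hnonneg : 0 ≤ β / 2 * ‖X t - z‖ ^ 2 := by positivity
  rw [le_div_iff₀ (by linarith)]
  linarith

theorem norm_sub_sq_le_pow_mul (hX : IsProjGradRun f β K X) (hβ : 0 < β) (hconv : ConvexOn ℝ K f)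
    (hf : IsSmoothOn f β K) (hz : z ∈ K) {γ : ℝ} (hγ : 0 < γ)
    (hgrowth : ∀ x ∈ K, γ * ‖x - z‖ ^ 2 ≤ f x - f z) (t : ℕ) :
    ‖X (t + 1) - z‖ ^ 2 ≤ (1 / (1 + 2 * γ / β)) ^ t * ‖X 1 - z‖ ^ 2 := by
  induction t with
  | zero => simp
  | succ t ih =>
    have hstep := sub_le_of_isProj hβ hconv hf (hX.mem t.succ_pos) (hX.2 _ t.succ_pos) hz
    have hgrow := hgrowth _ (hX.mem (t + 1).succ_pos)
    have hscale : ‖X (t + 1 + 1) - z‖ ^ 2 * (1 + 2 * γ / β) = 2 / β *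
        (β / 2 * ‖X (t + 1 + 1) - z‖ ^ 2 + γ * ‖X (t + 1 + 1) - z‖ ^ 2) := by
      field_simp
    have hcontract : ‖X (t + 1 + 1) - z‖ ^ 2 * (1 + 2 * γ / β) ≤ ‖X (t + 1) - z‖ ^ 2 :=
      calc _ ≤ 2 / β * (β / 2 * ‖X (t + 1) - z‖ ^ 2) := by
            rw [hscale]
            gcongr
            linarith
        _ = ‖X (t + 1) - z‖ ^ 2 := by field_simp
    calc ‖X (t + 1 + 1) - z‖ ^ 2 ≤ 1 / (1 + 2 * γ / β) * ‖X (t + 1) - z‖ ^ 2 := by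
          rwa [one_div, ← div_eq_inv_mul, le_div_iff₀ (by positivity)]
      _ ≤ 1 / (1 + 2 * γ / β) * ((1 / (1 + 2 * γ / β)) ^ t * ‖X 1 - z‖ ^ 2) := by gcongr
      _ = (1 / (1 + 2 * γ / β)) ^ (t + 1) * ‖X 1 - z‖ ^ 2 := by ring

-- Contracting distances up to `X (t - 1)` and then passing to function values would leave the
-- exponent `t - 2`; for small `γ` the last step gains the missing factor.
theorem sub_le_mul_pow (hX : IsProjGradRun f β K X) (hβ : 0 < β) (hconv : ConvexOn ℝ K f)
    (hf : IsSmoothOn f β K) (hz : z ∈ K) {γ : ℝ} (hγ : 0 < γ) (hγβ : γ ≤ β / 48)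
    (hgrowth : ∀ x ∈ K, γ * ‖x - z‖ ^ 2 ≤ f x - f z) {t : ℕ} (ht : 2 ≤ t) :
    f (X t) - f z ≤ β * ‖X 1 - z‖ ^ 2 / 2 * (1 / (1 + 2 * γ / β)) ^ (t - 1) := by
  obtain ⟨s, rfl⟩ : ∃ s, t = s + 1 + 1 := ⟨t - 2, by lia⟩
  have hfactor : 24 / 25 ≤ 1 / (1 + 2 * γ / β) := by
    have : 2 * γ / β ≤ 1 / 24 := by
      rw [div_le_iff₀ hβ]
      linarith
    rw [le_div_iff₀ (by positivity)]
    linarith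
  calc f (X (s + 1 + 1)) - f z ≤ β / 2 * (24 / 25 * ‖X (s + 1) - z‖ ^ 2) :=
        sub_le_mul_norm_sq_of_isProj hβ hconv hf (hX.mem s.succ_pos) (hX.2 _ s.succ_pos) hz
    _ ≤ β / 2 * (1 / (1 + 2 * γ / β) * ((1 / (1 + 2 * γ / β)) ^ s * ‖X 1 - z‖ ^ 2)) := by
        gcongr
        exact hX.norm_sub_sq_le_pow_mul hβ hconv hf hz hγ hgrowth s
    _ = β * ‖X 1 - z‖ ^ 2 / 2 * (1 / (1 + 2 * γ / β)) ^ (s + 1) := by ring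

end IsProjGradRun

end ProjectedGradient

section Conjugation

variable {𝕜 : Type*} [RCLike 𝕜] {ι κ μ : Type*}

/-- Entrywise complex conjugation of a vector. -/
noncomputable def conjVec (x : EuclideanSpace 𝕜 ι) : EuclideanSpace 𝕜 ι :=
  WithLp.toLp 2 fun i => conj (x i)

theorem conjVec_conjVec (x : EuclideanSpace 𝕜 ι) : conjVec (conjVec x) = x := by
  ext i
  simp [conjVec]

theorem conjVec_add (x y : EuclideanSpace 𝕜 ι) : conjVec (x + y) = conjVec x + conjVec y := by
  ext i
  simp [conjVec]

theorem conjVec_smul (c : 𝕜) (x : EuclideanSpace 𝕜 ι) :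
    conjVec (c • x) = conj c • conjVec x := by
  ext i
  simp [conjVec]

/-- The linear map whose matrix is the entrywise conjugate of the matrix of `T`. -/
noncomputable def conjMap (T : EuclideanSpace 𝕜 ι →ₗ[𝕜] EuclideanSpace 𝕜 κ) :
    EuclideanSpace 𝕜 ι →ₗ[𝕜] EuclideanSpace 𝕜 κ where
  toFun x := conjVec (T (conjVec x))
  map_add' x y := by rw [conjVec_add, map_add, conjVec_add]
  map_smul' c x := by simp [conjVec_smul]

theorem conjMap_apply (T : EuclideanSpace 𝕜 ι →ₗ[𝕜] EuclideanSpace 𝕜 κ)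
    (x : EuclideanSpace 𝕜 ι) : conjMap T x = conjVec (T (conjVec x)) := rfl

theorem conjMap_conjVec (T : EuclideanSpace 𝕜 ι →ₗ[𝕜] EuclideanSpace 𝕜 κ)
    (x : EuclideanSpace 𝕜 ι) : conjMap T (conjVec x) = conjVec (T x) := by
  rw [conjMap_apply, conjVec_conjVec]

theorem conjMap_comp (S : EuclideanSpace 𝕜 κ →ₗ[𝕜] EuclideanSpace 𝕜 μ)
    (T : EuclideanSpace 𝕜 ι →ₗ[𝕜] EuclideanSpace 𝕜 κ) :
    conjMap (S ∘ₗ T) = conjMap S ∘ₗ conjMap T := by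
  ext1 x
  simp only [LinearMap.comp_apply, conjMap_apply, conjVec_conjVec]

variable [Fintype ι]

theorem toEuclideanLin_map_conj [DecidableEq ι] (A : Matrix κ ι 𝕜) :
    Matrix.toEuclideanLin (A.map conj) = conjMap (Matrix.toEuclideanLin A) := by
  ext x a
  simp [conjMap_apply, conjVec, Matrix.toLpLin_apply, Matrix.mulVec, dotProduct]

theorem inner_conjVec (x y : EuclideanSpace 𝕜 ι) :
    inner 𝕜 (conjVec x) (conjVec y) = conj (inner 𝕜 x y) := by
  simp [conjVec, PiLp.inner_apply]

theorem inner_conjVec_left (x y : EuclideanSpace 𝕜 ι) :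
    inner 𝕜 (conjVec x) y = conj (inner 𝕜 x (conjVec y)) := by
  rw [← inner_conjVec, conjVec_conjVec]

theorem norm_conjVec (x : EuclideanSpace 𝕜 ι) : ‖conjVec x‖ = ‖x‖ := by
  simp [conjVec, EuclideanSpace.norm_eq]

theorem conjMap_isSymmetric {H : EuclideanSpace 𝕜 ι →ₗ[𝕜] EuclideanSpace 𝕜 ι}
    (hH : H.IsSymmetric) : (conjMap H).IsSymmetric := fun x y => by
  rw [conjMap_apply, conjMap_apply, inner_conjVec_left, hH, ← inner_conjVec, conjVec_conjVec]

theorem exists_orthonormalBasis_eq {E : Type*} [NormedAddCommGroup E] [InnerProductSpace 𝕜 E]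
    [FiniteDimensional 𝕜 E] {v : ι → E} (hv : Orthonormal 𝕜 v)
    (hc : finrank 𝕜 E = Fintype.card ι) : ∃ b : OrthonormalBasis ι 𝕜 E, ⇑b = v := by
  obtain ⟨b, hb⟩ := Orthonormal.exists_orthonormalBasis_extension_of_card_eq hc
    (v := v) (s := Set.univ) (hv.comp _ Subtype.val_injective)
  exact ⟨b, funext fun i => hb i (Set.mem_univ i)⟩

variable [Fintype κ]

theorem adjoint_conjMap (T : EuclideanSpace 𝕜 ι →ₗ[𝕜] EuclideanSpace 𝕜 κ) :
    LinearMap.adjoint (conjMap T) = conjMap (LinearMap.adjoint T) := by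
  refine ((LinearMap.eq_adjoint_iff _ _).2 fun x y => ?_).symm
  rw [conjMap_apply, conjMap_apply, inner_conjVec_left, LinearMap.adjoint_inner_left,
    ← inner_conjVec, conjVec_conjVec]

theorem conjVec_mem_isometricSubspace {W : EuclideanSpace 𝕜 ι →ₗ[𝕜] EuclideanSpace 𝕜 κ}
    {x : EuclideanSpace 𝕜 ι} (hx : x ∈ isometricSubspace W) :
    conjVec x ∈ isometricSubspace (conjMap W) := by
  rw [mem_isometricSubspace] at hx ⊢
  rw [adjoint_conjMap, conjMap_conjVec, conjMap_conjVec, hx]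

theorem singularValues_conjMap {p : ℕ} (T : EuclideanSpace 𝕜 (Fin p) →ₗ[𝕜] EuclideanSpace 𝕜 κ)
    (j : ℕ) : (conjMap T).singularValues j = T.singularValues j := by
  rcases le_or_gt p j with hj | hj
  · rw [LinearMap.singularValues_of_finrank_le _ (by simpa using hj),
      LinearMap.singularValues_of_finrank_le _ (by simpa using hj)]
  obtain ⟨b, hb, hn⟩ := exists_rightSingularBasis (p := p) (by simp) T
  have horth : Orthonormal 𝕜 fun j => conjVec (b j) := by
    rw [orthonormal_iff_ite]
    intro i j
    rw [inner_conjVec, OrthonormalBasis.inner_eq_ite]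
    split_ifs <;> simp
  obtain ⟨c, hc⟩ := exists_orthonormalBasis_eq horth (by simp)
  have hTc : ∀ j, conjMap T (c j) = conjVec (T (b j)) := fun j => by rw [hc, conjMap_conjVec]
  have hnorm : ∀ j, ‖conjMap T (c j)‖ = T.singularValues j := fun j => by
    rw [hTc, norm_conjVec, hn]
  have hpair : Pairwise fun j k => inner 𝕜 (conjMap T (c j)) (conjMap T (c k)) = 0 :=
    fun j k hjk => by simp only [hTc, inner_conjVec, hb hjk, map_zero]
  have hanti : Antitone fun j => ‖conjMap T (c j)‖ := fun j k hjk => by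
    simpa only [hnorm] using T.singularValues_antitone hjk
  exact (singularValues_eq_norm_apply_basis c _ hpair hanti ⟨j, hj⟩).trans (hnorm _)

theorem nuc_conjMap {p : ℕ} (T : EuclideanSpace 𝕜 (Fin p) →ₗ[𝕜] EuclideanSpace 𝕜 κ) :
    nuc (conjMap T) = nuc T :=
  Finset.sum_congr rfl fun j _ => singularValues_conjMap T j

theorem sv_map_conj {p : ℕ} (A : Matrix κ (Fin p) ℂ) (j : ℕ) : sv (A.map conj) j = sv A j := by
  rw [sv, toEuclideanLin_map_conj, singularValues_conjMap, sv]

end Conjugation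

section Fourier

theorem isPrimitiveRoot_exp_neg {q : ℕ} (hq : 0 < q) :
    IsPrimitiveRoot (Complex.exp (-(2 * Real.pi * Complex.I) / (q : ℂ))) q := by
  rw [neg_div, Complex.exp_neg]
  exact (Complex.isPrimitiveRoot_exp q hq.ne').inv

theorem conj_exp_neg (q : ℕ) :
    conj (Complex.exp (-(2 * Real.pi * Complex.I) / (q : ℂ))) =
      (Complex.exp (-(2 * Real.pi * Complex.I) / (q : ℂ)))⁻¹ := by
  rw [← Complex.exp_neg, ← Complex.exp_conj]
  congr 1
  simp [neg_div, Complex.conj_ofNat]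

theorem sum_pow_mul_inv_pow_eq_ite {K : Type*} [Field K] {q : ℕ} {ω : K}
    (hω : IsPrimitiveRoot ω q) (l l' : Fin q) :
    ∑ x : Fin q, (ω ^ (l : ℕ) * ω⁻¹ ^ (l' : ℕ)) ^ (x : ℕ) = if l = l' then (q : K) else 0 := by
  have hω0 : ω ≠ 0 := hω.ne_zero l.pos.ne'
  split_ifs with h
  · simp [h, hω0]
  set z := ω ^ (l : ℕ) * ω⁻¹ ^ (l' : ℕ) with hz
  have hz1 : z ≠ 1 := by
    rw [hz, inv_pow, Ne, mul_inv_eq_one₀ (pow_ne_zero _ hω0)]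
    exact fun hpow => h (Fin.ext (hω.pow_inj l.2 l'.2 hpow))
  have hzq : z ^ q = 1 := by
    rw [hz, mul_pow, pow_right_comm, pow_right_comm ω⁻¹, inv_pow, hω.pow_eq_one, one_pow, inv_one,
      one_pow, one_mul]
  rw [← Finset.sum_range (fun x => z ^ x), geom_sum_eq hz1, hzq, sub_self, zero_div]

variable {n₁ n₂ k : ℕ} {n : Fin k → ℕ}

/-- The kernel of the discrete Fourier transform along all modes but the first two. -/
noncomputable def chi (i l : SliceIdx n) : ℂ :=
  ∏ j, Complex.exp (-(2 * Real.pi * Complex.I) / (n j : ℂ)) ^ ((i j : ℕ) * (l j : ℕ))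

theorem fslice_apply (X : Tensor n₁ n₂ n) (i : SliceIdx n) (a : Fin n₁) (b : Fin n₂) :
    fslice X i a b = ∑ l, ((X (a, b, l) : ℝ) : ℂ) * chi i l := rfl

theorem chi_comm (i l : SliceIdx n) : chi i l = chi l i := by
  simp only [chi, mul_comm]

theorem sum_chi_mul_conj (l l' : SliceIdx n) :
    ∑ i, chi i l * conj (chi i l') = if l = l' then (numSlices n : ℂ) else 0 := by
  set ω : Fin k → ℂ := fun j => Complex.exp (-(2 * Real.pi * Complex.I) / (n j : ℂ))
  have hprod : ∀ i : SliceIdx n, chi i l * conj (chi i l') =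
      ∏ j, (ω j ^ (l j : ℕ) * (ω j)⁻¹ ^ (l' j : ℕ)) ^ (i j : ℕ) := by
    intro i
    rw [chi, chi, map_prod, ← Finset.prod_mul_distrib]
    refine Finset.prod_congr rfl fun j _ => ?_
    rw [map_pow, conj_exp_neg, mul_pow, ← pow_mul, ← pow_mul, mul_comm (i j : ℕ),
      mul_comm (i j : ℕ)]
  simp only [hprod]
  rw [← Fintype.piFinset_univ, ← Finset.prod_univ_sum (fun _ => Finset.univ)
    fun j (x : Fin (n j)) => (ω j ^ (l j : ℕ) * (ω j)⁻¹ ^ (l' j : ℕ)) ^ (x : ℕ)]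
  simp only [fun j => sum_pow_mul_inv_pow_eq_ite (isPrimitiveRoot_exp_neg (l j).pos) (l j) (l' j),
    ω]
  split_ifs with h
  · simp [h, numSlices]
  · obtain ⟨j, hj⟩ := Function.ne_iff.1 h
    exact Finset.prod_eq_zero (Finset.mem_univ j) (if_neg hj)

theorem sum_sum_mul_conj_chi_mul_chi (u : SliceIdx n → ℂ) (i : SliceIdx n) :
    ∑ l, (∑ i', u i' * conj (chi i' l)) * chi i l = (numSlices n : ℂ) * u i := by
  have horth : ∀ i', ∑ l, u i' * conj (chi i' l) * chi i l =
      if i = i' then (numSlices n : ℂ) * u i' else 0 := by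
    intro i'
    simp only [mul_assoc, ← Finset.mul_sum, mul_comm (conj _), chi_comm i, chi_comm i',
      sum_chi_mul_conj]
    split_ifs <;> ring
  simp only [Finset.sum_mul]
  rw [Finset.sum_comm]
  simp only [horth, Finset.sum_ite_eq, Finset.mem_univ, if_true]

/-- The index `-i` modulo the mode sizes. -/
def conjIdx (i : SliceIdx n) : SliceIdx n :=
  fun j => ⟨(n j - i j) % n j, Nat.mod_lt _ (i j).pos⟩

theorem conjIdx_involutive : Function.Involutive (conjIdx (n := n)) := by
  intro i
  funext j
  apply Fin.ext
  have hi := (i j).2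
  simp only [conjIdx]
  rcases Nat.eq_zero_or_pos (i j : ℕ) with h | h
  · simp [h]
  · rw [Nat.mod_eq_of_lt (by omega : n j - (i j : ℕ) < n j), Nat.mod_eq_of_lt (by omega)]
    omega

theorem sum_conjIdx {A : Type*} [AddCommMonoid A] (φ : SliceIdx n → A) :
    ∑ i, φ (conjIdx i) = ∑ i, φ i :=
  Equiv.sum_comp conjIdx_involutive.toPerm φ

theorem chi_conjIdx (i l : SliceIdx n) : chi (conjIdx i) l = conj (chi i l) := by
  rw [chi, chi, map_prod]
  refine Finset.prod_congr rfl fun j _ => ?_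
  have hprim := isPrimitiveRoot_exp_neg (i j).pos
  rw [map_pow, conj_exp_neg, pow_mul, pow_mul]
  congr 1
  have hi := (i j).2
  simp only [conjIdx]
  rcases Nat.eq_zero_or_pos (i j : ℕ) with h | h
  · simp [h]
  · rw [Nat.mod_eq_of_lt (by omega : n j - (i j : ℕ) < n j), inv_pow,
      ← mul_eq_one_iff_eq_inv₀ (pow_ne_zero _ (Complex.exp_ne_zero _)), ← pow_add,
      Nat.sub_add_cancel hi.le, hprim.pow_eq_one]

theorem fslice_conjIdx (X : Tensor n₁ n₂ n) (i : SliceIdx n) :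
    fslice X (conjIdx i) = (fslice X i).map conj := by
  ext a b
  simp [fslice_apply, chi_conjIdx]

theorem numSlices_pos (i : SliceIdx n) : (0 : ℝ) < numSlices n := by
  rw [numSlices, Nat.cast_pos]
  exact Finset.prod_pos fun j _ => (i j).pos

/-- The real tensor obtained from a family of complex slices by the inverse Fourier transform,
taking real parts. -/
noncomputable def ofSlices (M : SliceIdx n → Matrix (Fin n₁) (Fin n₂) ℂ) : Tensor n₁ n₂ n :=
  WithLp.toLp 2 fun x => (1 / (numSlices n : ℝ)) *
    ∑ i, (M i x.1 x.2.1 * conj (chi i x.2.2)).re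

theorem ofSlices_apply (M : SliceIdx n → Matrix (Fin n₁) (Fin n₂) ℂ) (a : Fin n₁) (b : Fin n₂)
    (l : SliceIdx n) : ofSlices M (a, b, l) =
      (1 / (numSlices n : ℝ)) * ∑ i, (M i a b * conj (chi i l)).re := rfl

theorem ofSlices_sub (M M' : SliceIdx n → Matrix (Fin n₁) (Fin n₂) ℂ) :
    ofSlices (M - M') = ofSlices M - ofSlices M' := by
  ext ⟨a, b, l⟩
  simp only [PiLp.sub_apply, ofSlices_apply, Pi.sub_apply, Matrix.sub_apply, sub_mul,
    Complex.sub_re, Finset.sum_sub_distrib, mul_sub]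

theorem ofSlices_fslice (X : Tensor n₁ n₂ n) : ofSlices (fslice X) = X := by
  ext ⟨a, b, l⟩
  have hinv : ∑ i, fslice X i a b * conj (chi i l) = (numSlices n : ℂ) * (X (a, b, l) : ℂ) := by
    simp only [fslice_apply, Finset.sum_mul]
    rw [Finset.sum_comm]
    simp only [mul_assoc, ← Finset.mul_sum, sum_chi_mul_conj]
    simp [mul_comm]
  rw [ofSlices_apply, ← Complex.re_sum, hinv, ← Complex.ofReal_natCast, ← Complex.ofReal_mul,
    Complex.ofReal_re]
  field_simp [(numSlices_pos l).ne']

theorem ofReal_sum_re_mul_conj_chi (u : SliceIdx n → ℂ) (l : SliceIdx n) :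
    ((∑ i, (u i * conj (chi i l)).re : ℝ) : ℂ) =
      ∑ i, (1 / 2) * (u i + conj (u (conjIdx i))) * conj (chi i l) := by
  have hflip : ∑ i, conj (u i) * chi i l = ∑ i, conj (u (conjIdx i)) * conj (chi i l) := by
    rw [← sum_conjIdx]
    simp only [chi_conjIdx]
  push_cast
  simp only [Complex.re_eq_add_conj, map_mul, Complex.conj_conj, ← Finset.sum_div,
    Finset.sum_add_distrib, hflip, mul_assoc, ← Finset.mul_sum, add_mul]
  ring

theorem fslice_ofSlices (M : SliceIdx n → Matrix (Fin n₁) (Fin n₂) ℂ) (i : SliceIdx n) :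
    fslice (ofSlices M) i = ((1 / 2 : ℝ) : ℂ) • (M i + (M (conjIdx i)).map conj) := by
  ext a b
  have hN : (numSlices n : ℂ) ≠ 0 := by exact_mod_cast (numSlices_pos i).ne'
  simp only [fslice_apply, ofSlices_apply, Complex.ofReal_mul, mul_assoc, ← Finset.mul_sum]
  rw [Finset.sum_congr rfl fun l _ => by rw [ofReal_sum_re_mul_conj_chi (fun i => M i a b)],
    sum_sum_mul_conj_chi_mul_chi]
  simp [hN]

theorem fslice_ofSlices_of_conj {M : SliceIdx n → Matrix (Fin n₁) (Fin n₂) ℂ}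
    (hM : ∀ i, M (conjIdx i) = (M i).map conj) : fslice (ofSlices M) = M := by
  funext i
  rw [fslice_ofSlices, hM]
  ext a b
  simp
  ring

theorem fslice_add (X Y : Tensor n₁ n₂ n) (i : SliceIdx n) :
    fslice (X + Y) i = fslice X i + fslice Y i := by
  ext a b
  simp [fslice_apply, add_mul, Finset.sum_add_distrib]

theorem fslice_smul (c : ℝ) (X : Tensor n₁ n₂ n) (i : SliceIdx n) :
    fslice (c • X) i = (c : ℂ) • fslice X i := by
  ext a b
  simp [fslice_apply, mul_assoc, Finset.mul_sum]

/-- The frontal slices in the Fourier domain, as linear maps. -/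
noncomputable def slice (X : Tensor n₁ n₂ n) (i : SliceIdx n) :
    EuclideanSpace ℂ (Fin n₂) →ₗ[ℂ] EuclideanSpace ℂ (Fin n₁) :=
  Matrix.toEuclideanLin (fslice X i)

theorem slice_add (X Y : Tensor n₁ n₂ n) (i : SliceIdx n) :
    slice (X + Y) i = slice X i + slice Y i := by
  rw [slice, fslice_add, map_add, slice, slice]

theorem slice_smul (c : ℝ) (X : Tensor n₁ n₂ n) (i : SliceIdx n) :
    slice (c • X) i = (c : ℂ) • slice X i := by
  rw [slice, fslice_smul, map_smul, slice]

theorem slice_neg (X : Tensor n₁ n₂ n) (i : SliceIdx n) : slice (-X) i = -slice X i := by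
  simpa using slice_smul (-1) X i

theorem slice_sub (X Y : Tensor n₁ n₂ n) (i : SliceIdx n) :
    slice (X - Y) i = slice X i - slice Y i := by
  rw [sub_eq_add_neg, slice_add, slice_neg, sub_eq_add_neg]

theorem slice_conjIdx (X : Tensor n₁ n₂ n) (i : SliceIdx n) :
    slice X (conjIdx i) = conjMap (slice X i) := by
  rw [slice, fslice_conjIdx, toEuclideanLin_map_conj, slice]

theorem slice_ofSlices (M : SliceIdx n → Matrix (Fin n₁) (Fin n₂) ℂ) (i : SliceIdx n) :
    slice (ofSlices M) i = ((1 / 2 : ℝ) : ℂ) •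
      (Matrix.toEuclideanLin (M i) + conjMap (Matrix.toEuclideanLin (M (conjIdx i)))) := by
  rw [slice, fslice_ofSlices, map_smul, map_add, toEuclideanLin_map_conj]

theorem sv_fslice (X : Tensor n₁ n₂ n) (i : SliceIdx n) (j : ℕ) :
    sv (fslice X i) j = (slice X i).singularValues j := rfl

theorem hs_toEuclideanLin {ι κ : Type*} [Fintype ι] [DecidableEq ι] [Fintype κ]
    (A B : Matrix κ ι ℂ) :
    hs (Matrix.toEuclideanLin A) (Matrix.toEuclideanLin B) =
      ∑ a, ∑ b, (conj (A a b) * B a b).re := by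
  rw [hs_eq_sum (EuclideanSpace.basisFun ι ℂ), Finset.sum_comm]
  refine Finset.sum_congr rfl fun b _ => ?_
  rw [PiLp.inner_apply, map_sum]
  refine Finset.sum_congr rfl fun a _ => ?_
  simp [Matrix.toLpLin_apply]
  ring

theorem inner_ofSlices (M : SliceIdx n → Matrix (Fin n₁) (Fin n₂) ℂ) (X : Tensor n₁ n₂ n) :
    inner ℝ (ofSlices M) X =
      (1 / (numSlices n : ℝ)) * ∑ i, hs (Matrix.toEuclideanLin (M i)) (slice X i) := by
  rw [PiLp.inner_apply, Fintype.sum_prod_type]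
  simp only [Fintype.sum_prod_type, slice, hs_toEuclideanLin]
  rw [Finset.sum_comm (s := Finset.univ (α := SliceIdx n)), Finset.mul_sum]
  refine Finset.sum_congr rfl fun a _ => ?_
  rw [Finset.sum_comm (s := Finset.univ (α := SliceIdx n)), Finset.mul_sum]
  refine Finset.sum_congr rfl fun b _ => ?_
  simp only [ofSlices_apply, fslice_apply, Finset.mul_sum, Complex.re_sum, inner,
    starRingEnd_apply, star_trivial]
  rw [Finset.sum_comm]
  refine Finset.sum_congr rfl fun i _ => Finset.sum_congr rfl fun l _ => ?_
  simp
  ring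

theorem inner_eq_sum_hs (X Y : Tensor n₁ n₂ n) :
    inner ℝ X Y = (1 / (numSlices n : ℝ)) * ∑ i, hs (slice X i) (slice Y i) := by
  conv_lhs => rw [← ofSlices_fslice X]
  exact inner_ofSlices _ _

theorem norm_sq_eq_sum_hs (X : Tensor n₁ n₂ n) :
    ‖X‖ ^ 2 = (1 / (numSlices n : ℝ)) * ∑ i, hs (slice X i) (slice X i) := by
  rw [← real_inner_self_eq_norm_sq, inner_eq_sum_hs]

theorem norm_sq_ofSlices_le (M : SliceIdx n → Matrix (Fin n₁) (Fin n₂) ℂ) :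
    ‖ofSlices M‖ ^ 2 ≤ (1 / (numSlices n : ℝ)) *
      ∑ i, hs (Matrix.toEuclideanLin (M i)) (Matrix.toEuclideanLin (M i)) := by
  have hinner : (1 / (numSlices n : ℝ)) *
      ∑ i, hs (Matrix.toEuclideanLin (M i)) (slice (ofSlices M) i) = ‖ofSlices M‖ ^ 2 := by
    rw [← inner_ofSlices, real_inner_self_eq_norm_sq]
  have hnonneg : 0 ≤ (1 / (numSlices n : ℝ)) * ∑ i,
      hs (Matrix.toEuclideanLin (M i) - slice (ofSlices M) i)
        (Matrix.toEuclideanLin (M i) - slice (ofSlices M) i) :=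
    mul_nonneg (by positivity) (Finset.sum_nonneg fun i _ => hs_self_nonneg _)
  simp only [hs_sub_left, hs_sub_right, hs_comm (slice (ofSlices M) _) (Matrix.toEuclideanLin _),
    Finset.sum_sub_distrib, mul_sub, hinner, ← norm_sq_eq_sum_hs] at hnonneg
  linarith

theorem tnn_eq_sum_nuc (X : Tensor n₁ n₂ n) :
    tnn X = (1 / (numSlices n : ℝ)) * ∑ i, nuc (slice X i) := by
  rw [tnn]
  congr 1
  refine Finset.sum_congr rfl fun i _ => ?_
  exact (sum_range_singularValues (φ := fun x => x) rfl (slice X i) (by simp)).symm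

theorem tnn_ofSlices_le (M : SliceIdx n → Matrix (Fin n₁) (Fin n₂) ℂ) :
    tnn (ofSlices M) ≤ (1 / (numSlices n : ℝ)) * ∑ i, nuc (Matrix.toEuclideanLin (M i)) := by
  rw [tnn_eq_sum_nuc]
  gcongr 1
  have hslice : ∀ i, nuc (slice (ofSlices M) i) ≤
      (1 / 2) * (nuc (Matrix.toEuclideanLin (M i)) +
        nuc (Matrix.toEuclideanLin (M (conjIdx i)))) := by
    intro i
    rw [slice_ofSlices, ← nuc_conjMap (Matrix.toEuclideanLin (M (conjIdx i)))]
    exact (nuc_smul_le one_half_pos.le _).trans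
      (mul_le_mul_of_nonneg_left (nuc_add_le _ _) one_half_pos.le)
  refine (Finset.sum_le_sum fun i _ => hslice i).trans_eq ?_
  rw [← Finset.mul_sum, Finset.sum_add_distrib,
    sum_conjIdx (fun i => nuc (Matrix.toEuclideanLin (M i)))]
  ring

end Fourier

section MatrixSVD

variable {𝕜 𝕜' : Type*} [RCLike 𝕜] [RCLike 𝕜'] {p q : ℕ}

/-- The `p × q` matrix with main diagonal `s 0, s 1, …` and zeros elsewhere. -/
def rectDiag (𝕜 : Type*) [RCLike 𝕜] (p q : ℕ) (s : ℕ → ℝ) : Matrix (Fin p) (Fin q) 𝕜 :=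
  Matrix.of fun a b => if (a : ℕ) = (b : ℕ) then ((s a : ℝ) : 𝕜) else 0

theorem mul_rectDiag_apply (U : Matrix (Fin p) (Fin p) 𝕜) (s : ℕ → ℝ) (i : Fin p) (j : Fin q) :
    (U * rectDiag 𝕜 p q s) i j = if h : (j : ℕ) < p then (s j : 𝕜) * U i ⟨j, h⟩ else 0 := by
  rw [Matrix.mul_apply]
  split_ifs with h
  · rw [Finset.sum_eq_single ⟨j, h⟩]
    · simp [rectDiag, mul_comm]
    · intro k _ hk
      have : (k : ℕ) ≠ j := fun h' => hk (Fin.ext h')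
      simp [rectDiag, this]
    · simp
  · refine Finset.sum_eq_zero fun k _ => ?_
    have : (k : ℕ) ≠ j := by lia
    simp [rectDiag, this]

theorem rectDiag_congr {s t : ℕ → ℝ} (h : ∀ j, j < p → j < q → s j = t j) :
    rectDiag 𝕜 p q s = rectDiag 𝕜 p q t := by
  ext a b
  simp only [rectDiag, Matrix.of_apply]
  split_ifs with hab
  · rw [h a a.2 (hab ▸ b.2)]
  · rfl

theorem rectDiag_map {φ : 𝕜 →+* 𝕜'} (hφ : ∀ x : ℝ, φ x = x) (s : ℕ → ℝ) :
    (rectDiag 𝕜 p q s).map φ = rectDiag 𝕜' p q s := by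
  ext a b
  simp [rectDiag, apply_ite φ, hφ]

theorem map_mul_rectDiag_mul_conjTranspose {φ : 𝕜 →+* 𝕜'} (hstar : Function.Semiconj φ star star)
    (hreal : ∀ x : ℝ, φ x = x) (U : Matrix (Fin p) (Fin p) 𝕜) (V : Matrix (Fin q) (Fin q) 𝕜)
    (s : ℕ → ℝ) :
    (U * rectDiag 𝕜 p q s * V.conjTranspose).map φ =
      U.map φ * rectDiag 𝕜' p q s * (V.map φ).conjTranspose := by
  rw [Matrix.map_mul, Matrix.map_mul, rectDiag_map hreal, Matrix.conjTranspose_map φ hstar]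

theorem map_mem_unitaryGroup {ι : Type*} [Fintype ι] [DecidableEq ι] {φ : 𝕜 →+* 𝕜'}
    (hφ : Function.Semiconj φ star star) {A : Matrix ι ι 𝕜} (hA : A ∈ Matrix.unitaryGroup ι 𝕜) :
    A.map φ ∈ Matrix.unitaryGroup ι 𝕜' := by
  rw [Matrix.mem_unitaryGroup_iff, Matrix.star_eq_conjTranspose] at hA ⊢
  rw [← Matrix.conjTranspose_map φ hφ, ← Matrix.map_mul, hA, Matrix.map_one φ φ.map_zero φ.map_one]

theorem exists_orthonormalBasis_eq_col {ι : Type*} [Fintype ι] [DecidableEq ι] {U : Matrix ι ι 𝕜}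
    (hU : U ∈ Matrix.unitaryGroup ι 𝕜) :
    ∃ a : OrthonormalBasis ι 𝕜 (EuclideanSpace 𝕜 ι), ∀ i j, a j i = U i j := by
  have horth : Orthonormal 𝕜 fun j => (WithLp.toLp 2 fun i => U i j : EuclideanSpace 𝕜 ι) := by
    rw [orthonormal_iff_ite]
    intro j k
    rw [← Matrix.one_apply, ← Matrix.mem_unitaryGroup_iff'.1 hU, Matrix.mul_apply, PiLp.inner_apply]
    simp [Matrix.star_apply, mul_comm]
  obtain ⟨a, ha⟩ := exists_orthonormalBasis_eq horth (by simp)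
  exact ⟨a, fun i j => by rw [ha]⟩

theorem exists_toEuclideanLin_eq_diagMap {U : Matrix (Fin p) (Fin p) 𝕜}
    {V : Matrix (Fin q) (Fin q) 𝕜} (hU : U ∈ Matrix.unitaryGroup (Fin p) 𝕜)
    (hV : V ∈ Matrix.unitaryGroup (Fin q) 𝕜) :
    ∃ (b : OrthonormalBasis (Fin q) 𝕜 (EuclideanSpace 𝕜 (Fin q)))
      (a : OrthonormalBasis (Fin p) 𝕜 (EuclideanSpace 𝕜 (Fin p))), ∀ s : ℕ → ℝ,
      Matrix.toEuclideanLin (U * rectDiag 𝕜 p q s * V.conjTranspose) = diagMap b a s := by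
  obtain ⟨a, ha⟩ := exists_orthonormalBasis_eq_col hU
  obtain ⟨b, hb⟩ := exists_orthonormalBasis_eq_col hV
  refine ⟨b, a, fun s => eq_diagMap b a fun j => ?_⟩
  have hcancel : U * rectDiag 𝕜 p q s * V.conjTranspose * V = U * rectDiag 𝕜 p q s := by
    rw [Matrix.mul_assoc, ← Matrix.star_eq_conjTranspose, Matrix.mem_unitaryGroup_iff'.1 hV,
      Matrix.mul_one]
  ext i
  have hcol : Matrix.toEuclideanLin (U * rectDiag 𝕜 p q s * V.conjTranspose) (b j) i =
      (U * rectDiag 𝕜 p q s * V.conjTranspose * V) i j := by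
    rw [Matrix.toLpLin_apply, Matrix.mul_apply]
    simp only [Matrix.mulVec, dotProduct, hb]
  rw [hcol, hcancel, mul_rectDiag_apply]
  split_ifs <;> simp [ha, RCLike.real_smul_eq_coe_mul]

theorem singularValues_toEuclideanLin_svd {U : Matrix (Fin p) (Fin p) 𝕜}
    {V : Matrix (Fin q) (Fin q) 𝕜} (hU : U ∈ Matrix.unitaryGroup (Fin p) 𝕜)
    (hV : V ∈ Matrix.unitaryGroup (Fin q) 𝕜) {s : ℕ → ℝ} (hs0 : ∀ j, 0 ≤ s j) (hs : Antitone s)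
    {j : ℕ} (hjp : j < p) (hjq : j < q) :
    (Matrix.toEuclideanLin (U * rectDiag 𝕜 p q s * V.conjTranspose)).singularValues j = s j := by
  obtain ⟨b, a, h⟩ := exists_toEuclideanLin_eq_diagMap hU hV
  have hnorm : ∀ k : Fin q, ‖diagMap b a s (b k)‖ = if (k : ℕ) < p then s k else 0 := by
    intro k
    rw [diagMap_basis]
    split_ifs
    · simp [norm_smul, abs_of_nonneg (hs0 _)]
    · simp
  have hanti : Antitone fun k => ‖diagMap b a s (b k)‖ := by
    intro k l hkl
    simp only [hnorm]
    split_ifs with hl hk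
    · exact hs hkl
    · exact absurd ((Fin.le_def.1 hkl).trans_lt hl) hk
    · exact hs0 _
    · exact le_rfl
  rw [h, singularValues_eq_norm_apply_basis b _ (pairwise_inner_diagMap_basis b a s) hanti ⟨j, hjq⟩,
    hnorm, if_pos hjp]

/-- `U` and `V` are the unitary factors of a singular value decomposition of `M`, with the singular
values in decreasing order. -/
structure IsSVD (M : Matrix (Fin p) (Fin q) 𝕜) (U : Matrix (Fin p) (Fin p) 𝕜)
    (V : Matrix (Fin q) (Fin q) 𝕜) : Prop where
  left_mem : U ∈ Matrix.unitaryGroup (Fin p) 𝕜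
  right_mem : V ∈ Matrix.unitaryGroup (Fin q) 𝕜
  eq_mul : M = U * rectDiag 𝕜 p q (Matrix.toEuclideanLin M).singularValues * V.conjTranspose

theorem exists_isSVD (M : Matrix (Fin p) (Fin q) 𝕜) : ∃ U V, IsSVD M U V := by
  obtain ⟨b, a, h⟩ := exists_svd (p := q) (q := p) (by simp) (by simp) (Matrix.toEuclideanLin M)
  have hunit : ∀ {m : ℕ} (c : OrthonormalBasis (Fin m) 𝕜 (EuclideanSpace 𝕜 (Fin m))),
      (EuclideanSpace.basisFun (Fin m) 𝕜).toBasis.toMatrix c ∈ Matrix.unitaryGroup (Fin m) 𝕜 :=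
    fun c => OrthonormalBasis.toMatrix_orthonormalBasis_mem_unitary _ c
  refine ⟨_, _, hunit a, hunit b, ?_⟩
  have hMV : M * (EuclideanSpace.basisFun (Fin q) 𝕜).toBasis.toMatrix b =
      (EuclideanSpace.basisFun (Fin p) 𝕜).toBasis.toMatrix a *
        rectDiag 𝕜 p q (Matrix.toEuclideanLin M).singularValues := by
    ext i j
    have hcol : (M * (EuclideanSpace.basisFun (Fin q) 𝕜).toBasis.toMatrix b) i j =
        Matrix.toEuclideanLin M (b j) i := rfl
    rw [mul_rectDiag_apply, hcol, h j]
    split_ifs <;> simp [Basis.toMatrix_apply, RCLike.real_smul_eq_coe_mul]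
  rw [← hMV, Matrix.mul_assoc, ← Matrix.star_eq_conjTranspose,
    Matrix.mem_unitaryGroup_iff.1 (hunit b), Matrix.mul_one]

theorem IsSVD.map {M : Matrix (Fin p) (Fin q) 𝕜} {U : Matrix (Fin p) (Fin p) 𝕜}
    {V : Matrix (Fin q) (Fin q) 𝕜} (h : IsSVD M U V) {φ : 𝕜 →+* 𝕜'}
    (hstar : Function.Semiconj φ star star) (hreal : ∀ x : ℝ, φ x = x) :
    IsSVD (M.map φ) (U.map φ) (V.map φ) := by
  have hU := map_mem_unitaryGroup hstar h.left_mem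
  have hV := map_mem_unitaryGroup hstar h.right_mem
  have hmap : M.map φ = U.map φ * rectDiag 𝕜' p q (Matrix.toEuclideanLin M).singularValues *
      (V.map φ).conjTranspose := by
    conv_lhs => rw [h.eq_mul]
    exact map_mul_rectDiag_mul_conjTranspose hstar hreal _ _ _
  refine ⟨hU, hV, ?_⟩
  conv_lhs => rw [hmap]
  congr 2
  refine rectDiag_congr fun j hjp hjq => ?_
  rw [hmap, singularValues_toEuclideanLin_svd hU hV (LinearMap.singularValues_nonneg _)
    (LinearMap.singularValues_antitone _) hjp hjq]

theorem exists_isSVD_of_map_conj_eq {M : Matrix (Fin p) (Fin q) ℂ} (hM : M.map conj = M) :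
    ∃ U V, IsSVD M U V ∧ U.map conj = U ∧ V.map conj = V := by
  have hre : M = (M.map Complex.re).map Complex.ofRealHom := by
    ext a b
    exact (Complex.conj_eq_iff_re.1 (congrFun (congrFun hM a) b)).symm
  have hconj : ∀ {m : ℕ} (A : Matrix (Fin m) (Fin m) ℝ),
      (A.map Complex.ofRealHom).map conj = A.map Complex.ofRealHom := by
    intro m A
    ext i j
    simp
  obtain ⟨U, V, h⟩ := exists_isSVD (M.map Complex.re)
  refine ⟨_, _, ?_, hconj U, hconj V⟩
  rw [hre]
  exact h.map (fun x => (Complex.conj_ofReal x).symm) fun _ => rfl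

end MatrixSVD

theorem exists_equivariant_choice {ι β : Type*} {c : ι → ι} (hc : c.Involutive) {σ : β → β}
    (hσ : σ.Involutive) {P : ι → β → Prop} (hP : ∀ i b, P i b → P (c i) (σ b))
    (h : ∀ i, ∃ b, P i b ∧ (c i = i → σ b = b)) :
    ∃ B : ι → β, (∀ i, P i (B i)) ∧ ∀ i, B (c i) = σ (B i) := by
  classical
  let _ : LinearOrder ι := IsWellOrder.linearOrder WellOrderingRel
  choose b hb hfix using h
  refine ⟨fun i => if i ≤ c i then b i else σ (b (c i)), fun i => ?_, fun i => ?_⟩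
  · dsimp only
    split_ifs
    · exact hb i
    · simpa only [hc i] using hP _ _ (hb (c i))
  · dsimp only
    rw [hc i]
    rcases lt_trichotomy i (c i) with hi | hi | hi
    · rw [if_neg hi.not_ge, if_pos hi.le]
    · rw [if_pos hi.ge, if_pos hi.le, ← hi, hfix i hi.symm]
    · rw [if_pos hi.le, if_neg hi.not_ge, hσ]

section TSVD

variable {n₁ n₂ k : ℕ} {n : Fin k → ℕ}

theorem exists_isTSVD (X : Tensor n₁ n₂ n) :
    ∃ (U : Tensor n₁ n₁ n) (V : Tensor n₂ n₂ n), IsTSVD X U V := by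
  obtain ⟨W, hW, hconj⟩ := exists_equivariant_choice (conjIdx_involutive (n := n))
    (σ := fun W : Matrix (Fin n₁) (Fin n₁) ℂ × Matrix (Fin n₂) (Fin n₂) ℂ =>
      (W.1.map conj, W.2.map conj))
    (fun W => by ext <;> simp)
    (P := fun i W => IsSVD (fslice X i) W.1 W.2)
    (fun i W hW => by
      rw [fslice_conjIdx]
      exact hW.map (fun _ => rfl) Complex.conj_ofReal)
    fun i => by
      by_cases hi : conjIdx i = i
      · obtain ⟨U, V, h, hU, hV⟩ :=
          exists_isSVD_of_map_conj_eq (M := fslice X i) (by rw [← fslice_conjIdx, hi])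
        exact ⟨(U, V), h, fun _ => Prod.ext hU hV⟩
      · obtain ⟨U, V, h⟩ := exists_isSVD (fslice X i)
        exact ⟨(U, V), h, fun h => absurd h hi⟩
  refine ⟨ofSlices fun i => (W i).1, ofSlices fun i => (W i).2, fun i => ?_⟩
  rw [fslice_ofSlices_of_conj fun i => congrArg Prod.fst (hconj i),
    fslice_ofSlices_of_conj fun i => congrArg Prod.snd (hconj i)]
  exact ⟨(hW i).left_mem, (hW i).right_mem, (hW i).eq_mul⟩

/-- Soft thresholding at level `s` of the first `r` terms of a sequence; the remaining terms are
set to zero. -/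
noncomputable def truncThreshold (r : ℕ) (s : ℝ) (c : ℕ → ℝ) (j : ℕ) : ℝ :=
  if j < r then max 0 (c j - s) else 0

theorem truncThreshold_nonneg (r : ℕ) (s : ℝ) (c : ℕ → ℝ) (j : ℕ) : 0 ≤ truncThreshold r s c j := by
  unfold truncThreshold
  split_ifs <;> simp

theorem sum_range_truncThreshold {r K : ℕ} (hr : r ≤ K) (s : ℝ) (c : ℕ → ℝ) :
    ∑ j ∈ Finset.range K, truncThreshold r s c j = ∑ j ∈ Finset.range r, max 0 (c j - s) := by
  unfold truncThreshold
  rw [← Finset.sum_filter]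
  congr 1
  grind

theorem sub_truncThreshold_mul (r : ℕ) (s : ℝ) (c : ℕ → ℝ) (j : ℕ) :
    (c j - truncThreshold r s c j) * truncThreshold r s c j = s * truncThreshold r s c j := by
  unfold truncThreshold
  split_ifs
  · rcases le_total (c j - s) 0 with h | h
    · rw [max_eq_left h, mul_zero, mul_zero]
    · rw [max_eq_right h, sub_sub_cancel]
  · rw [mul_zero, mul_zero]

theorem abs_sub_truncThreshold_le {r : ℕ} {s : ℝ} {c : ℕ → ℝ} (hs : 0 ≤ s) (hc0 : ∀ j, 0 ≤ c j)
    (hc : Antitone c) (hr : c r ≤ s) (j : ℕ) : |c j - truncThreshold r s c j| ≤ s := by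
  unfold truncThreshold
  split_ifs with hj
  · rcases le_total (c j - s) 0 with h | h
    · rw [max_eq_left h, sub_zero, abs_of_nonneg (hc0 j)]
      exact sub_nonpos.1 h
    · rw [max_eq_right h, sub_sub_cancel, abs_of_nonneg hs]
  · rw [sub_zero, abs_of_nonneg (hc0 j)]
    exact (hc (not_lt.1 hj)).trans hr

/-- The sum of the soft-thresholded leading `r` singular values of all frontal slices in the Fourier
domain. The rank-`r` truncated projection onto the ball of radius `τ` uses a level `s` at which it
equals `N τ`. -/
noncomputable def thresholdSum (r : ℕ) (X : Tensor n₁ n₂ n) (s : ℝ) : ℝ :=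
  ∑ i : SliceIdx n, ∑ j ∈ Finset.range r, max 0 (sv (fslice X i) j - s)

theorem rectDiag_truncThreshold (r : ℕ) (s : ℝ) (c : ℕ → ℝ) :
    rectDiag ℂ n₁ n₂ (truncThreshold r s c) =
      Matrix.of fun (a : Fin n₁) (b : Fin n₂) =>
        if (a : ℕ) = (b : ℕ) ∧ (a : ℕ) < r then ((max 0 (c a - s) : ℝ) : ℂ) else 0 := by
  ext a b
  simp only [rectDiag, truncThreshold, Matrix.of_apply, ite_and]
  split_ifs <;> simp

theorem IsTruncProj.exists_diagMap {r : ℕ} {τ : ℝ} {X Y : Tensor n₁ n₂ n}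
    (h : IsTruncProj r τ X Y) :
    ∃ s : ℝ, 0 ≤ s ∧ (1 / (numSlices n : ℝ)) * thresholdSum r X s = τ ∧ ∀ i,
      ∃ (b : OrthonormalBasis (Fin n₂) ℂ (EuclideanSpace ℂ (Fin n₂)))
        (a : OrthonormalBasis (Fin n₁) ℂ (EuclideanSpace ℂ (Fin n₁))),
        slice X i = diagMap b a (sv (fslice X i)) ∧
        slice Y i = diagMap b a (truncThreshold r s (sv (fslice X i))) := by
  obtain ⟨U, V, s, hUV, hs, hsum, hY⟩ := h
  refine ⟨s, hs, hsum, fun i => ?_⟩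
  obtain ⟨hU, hV, hX⟩ := hUV i
  obtain ⟨b, a, h⟩ := exists_toEuclideanLin_eq_diagMap hU hV
  refine ⟨b, a, ?_, ?_⟩
  · rw [← h]
    exact congrArg Matrix.toEuclideanLin hX
  · rw [← h, slice, hY, rectDiag_truncThreshold]

theorem exists_isTruncProj {X : Tensor n₁ n₂ n} {r : ℕ} {τ s : ℝ} (hs : 0 ≤ s)
    (hsum : (1 / (numSlices n : ℝ)) * thresholdSum r X s = τ) : ∃ Y, IsTruncProj r τ X Y := by
  obtain ⟨U, V, hUV⟩ := exists_isTSVD X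
  have hsv : ∀ i, sv (fslice X (conjIdx i)) = sv (fslice X i) := fun i => by
    funext j
    rw [fslice_conjIdx, sv_map_conj]
  refine ⟨ofSlices fun i => fslice U i * rectDiag ℂ n₁ n₂ (truncThreshold r s (sv (fslice X i))) *
    (fslice V i).conjTranspose, U, V, s, hUV, hs, hsum, fun i => ?_⟩
  rw [fslice_ofSlices_of_conj fun i => ?_, ← rectDiag_truncThreshold]
  rw [hsv, fslice_conjIdx, fslice_conjIdx,
    map_mul_rectDiag_mul_conjTranspose (fun _ => rfl) Complex.conj_ofReal]

theorem tnn_add_le (X Y : Tensor n₁ n₂ n) : tnn (X + Y) ≤ tnn X + tnn Y := by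
  simp only [tnn_eq_sum_nuc, slice_add]
  rw [← mul_add, ← Finset.sum_add_distrib]
  gcongr
  exact nuc_add_le _ _

theorem tnn_smul_le {c : ℝ} (hc : 0 ≤ c) (X : Tensor n₁ n₂ n) : tnn (c • X) ≤ c * tnn X := by
  simp only [tnn_eq_sum_nuc, slice_smul]
  rw [mul_left_comm c, Finset.mul_sum (a := c)]
  gcongr
  exact nuc_smul_le hc _

theorem convex_ball (τ : ℝ) : Convex ℝ (ball n₁ n₂ n τ) := by
  intro X hX Y hY a b ha hb hab
  calc tnn (a • X + b • Y) ≤ tnn (a • X) + tnn (b • Y) := tnn_add_le _ _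
    _ ≤ a * tnn X + b * tnn Y := add_le_add (tnn_smul_le ha X) (tnn_smul_le hb Y)
    _ ≤ a * τ + b * τ := by
        gcongr
        exacts [hX, hY]
    _ = τ := by rw [← add_mul, hab, one_mul]

theorem inner_le_mul_tnn {G : Tensor n₁ n₂ n} {c : ℝ} (hG : ∀ i x, ‖slice G i x‖ ≤ c * ‖x‖)
    (X : Tensor n₁ n₂ n) : inner ℝ G X ≤ c * tnn X := by
  rw [inner_eq_sum_hs, tnn_eq_sum_nuc, mul_left_comm c, Finset.mul_sum (a := c)]
  gcongr with i
  exact hs_le_mul_nuc (hG i) _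

theorem IsTruncProj.mem_ball {r : ℕ} (hr : r ≤ min n₁ n₂) {τ : ℝ} {X Y : Tensor n₁ n₂ n}
    (h : IsTruncProj r τ X Y) : Y ∈ ball n₁ n₂ n τ := by
  obtain ⟨s, -, hsum, hslice⟩ := h.exists_diagMap
  refine (tnn_eq_sum_nuc Y).trans_le ?_
  rw [← hsum, thresholdSum]
  gcongr with i
  obtain ⟨b, a, -, hY⟩ := hslice i
  rw [hY, ← sum_range_truncThreshold hr]
  exact nuc_diagMap_le b a (truncThreshold_nonneg _ _ _)

theorem IsTruncProj.inner_nonpos {r : ℕ} (hr : r ≤ min n₁ n₂) {τ : ℝ} {X Y : Tensor n₁ n₂ n}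
    (h : IsTruncProj r τ X Y)
    (hX : ∀ s, 0 ≤ s → (1 / (numSlices n : ℝ)) * thresholdSum r X s = τ →
      ∀ i, sv (fslice X i) r ≤ s)
    {Z : Tensor n₁ n₂ n} (hZ : Z ∈ ball n₁ n₂ n τ) : inner ℝ (X - Y) (Z - Y) ≤ 0 := by
  obtain ⟨s, hs, hsum, hslice⟩ := h.exists_diagMap
  choose b a hXd hYd using hslice
  have hsub : ∀ i, slice (X - Y) i =
      diagMap (b i) (a i) (sv (fslice X i) - truncThreshold r s (sv (fslice X i))) := fun i => by
    rw [slice_sub, hXd, hYd, diagMap_sub]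
  have hXYZ : inner ℝ (X - Y) Z ≤ s * tnn Z := by
    refine inner_le_mul_tnn (fun i => ?_) Z
    rw [hsub]
    exact norm_diagMap_le _ _ hs fun j _ => abs_sub_truncThreshold_le hs
      (LinearMap.singularValues_nonneg _) (LinearMap.singularValues_antitone _) (hX s hs hsum i) j
  have hXYY : inner ℝ (X - Y) Y = s * τ := by
    rw [inner_eq_sum_hs, ← hsum, thresholdSum, mul_left_comm, Finset.mul_sum (a := s)]
    congr 1
    refine Finset.sum_congr rfl fun i _ => ?_
    rw [hsub, hYd, hs_diagMap_diagMap, ← sum_range_truncThreshold hr, Finset.mul_sum]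
    exact Finset.sum_congr rfl fun j _ => sub_truncThreshold_mul _ _ _ _
  rw [inner_sub_right, hXYY, sub_nonpos]
  exact hXYZ.trans (mul_le_mul_of_nonneg_left hZ hs)

end TSVD

section IsometricSubspace

variable {𝕜 : Type*} [RCLike 𝕜]
  {E : Type*} [NormedAddCommGroup E] [InnerProductSpace 𝕜 E] [FiniteDimensional 𝕜 E]
  {F : Type*} [NormedAddCommGroup F] [InnerProductSpace 𝕜 F] [FiniteDimensional 𝕜 F]
  {W T : E →ₗ[𝕜] F}

theorem norm_apply_of_mem_isometricSubspace {x : E} (hx : x ∈ isometricSubspace W) :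
    ‖W x‖ = ‖x‖ := by
  have hinner : inner 𝕜 (W x) (W x) = inner 𝕜 x x := by
    rw [← LinearMap.adjoint_inner_left, mem_isometricSubspace.1 hx]
  rw [norm_eq_sqrt_re_inner (𝕜 := 𝕜), hinner, ← norm_eq_sqrt_re_inner]

theorem singularValues_le_one (hW : ∀ x, ‖W x‖ ≤ ‖x‖) (j : ℕ) : W.singularValues j ≤ 1 :=
  singularValues_le_of_subspace W zero_le_one (S := ⊥) (by simp) fun x _ => by simpa using hW x

theorem singularValues_eq_one (hW : ∀ x, ‖W x‖ ≤ ‖x‖) {j : ℕ}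
    (hj : j < finrank 𝕜 (isometricSubspace W)) : W.singularValues j = 1 :=
  (singularValues_le_one hW j).antisymm <| le_singularValues_of_subspace W hj fun x hx => by
    rw [one_mul, norm_apply_of_mem_isometricSubspace hx]

theorem singularValues_finrank_isometricSubspace_lt_one (hW : ∀ x, ‖W x‖ ≤ ‖x‖) :
    W.singularValues (finrank 𝕜 (isometricSubspace W)) < 1 := by
  obtain ⟨κ, hκ, hgap⟩ := exists_pos_mul_norm_sub_starProjection_sq_le hW
  refine (singularValues_le_of_subspace W (Real.sqrt_nonneg (1 - κ)) le_rfl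
    fun x hx => ?_).trans_lt ((Real.sqrt_lt' one_pos).2 (by linarith))
  have h := hgap x
  rw [(Submodule.starProjection_apply_eq_zero_iff _).2 hx, sub_zero] at h
  calc ‖W x‖ ≤ √((1 - κ) * ‖x‖ ^ 2) := Real.le_sqrt_of_sq_le (by linarith)
    _ = √(1 - κ) * ‖x‖ := by rw [Real.sqrt_mul' _ (sq_nonneg _), Real.sqrt_sq (norm_nonneg _)]

theorem isometricSubspace_le_headSpan {p : ℕ} {b : OrthonormalBasis (Fin p) 𝕜 E}
    (hb : Pairwise fun j l => inner 𝕜 (W (b j)) (W (b l)) = 0) {k : ℕ}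
    (hk : ∀ l : Fin p, k ≤ l → ‖W (b l)‖ < 1) : isometricSubspace W ≤ headSpan b k := by
  refine fun x hx => mem_headSpan_iff.2 fun l hl => ?_
  have hcoord : inner 𝕜 (b l) x = inner 𝕜 (b l) x * ((‖W (b l)‖ ^ 2 : ℝ) : 𝕜) := by
    conv_lhs => rw [← mem_isometricSubspace.1 hx, LinearMap.adjoint_inner_right,
      ← b.sum_repr' x, map_sum, inner_sum]
    rw [Finset.sum_eq_single l (fun j _ hj => by rw [map_smul, inner_smul_right, hb hj.symm,
      mul_zero]) (by simp), map_smul, inner_smul_right, inner_self_eq_norm_sq_to_K]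
    push_cast
    rfl
  by_contra hne
  have hone : ‖W (b l)‖ ^ 2 = 1 := by
    exact_mod_cast mul_left_cancel₀ hne (hcoord.symm.trans (mul_one _).symm)
  exact (pow_lt_one₀ (norm_nonneg _) (hk l hl) two_ne_zero).ne hone

theorem apply_eq_zero_of_mem_isometricSubspace_orthogonal (hW : ∀ x, ‖W x‖ ≤ ‖x‖)
    (h : hs W T = nuc T) {x : E} (hx : x ∈ (isometricSubspace W)ᗮ) : T x = 0 := by
  obtain ⟨H, hH, hHW, rfl⟩ := exists_isPositive_eq_comp_of_hs_eq_nuc hW h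
  have hHx : H x = 0 := by
    rw [← inner_self_eq_zero (𝕜 := 𝕜), ← hH.1]
    exact hx _ (hHW (H x))
  rw [LinearMap.comp_apply, hHx, map_zero]

/- Off the leading `k` right singular vectors of `W` the map `T` vanishes, and there `W` and `D` are
bounded by their next singular values. -/
theorem singularValues_add_smul_add_le (hW : ∀ x, ‖W x‖ ≤ ‖x‖) (h : hs W T = nuc T) {c : ℝ}
    (hc : 0 ≤ c) {k : ℕ} (hk : W.singularValues k < 1) (D : E →ₗ[𝕜] F) (μ : ℕ) :
    (T + (c : 𝕜) • W + D).singularValues (k + μ) ≤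
      c * W.singularValues k + D.singularValues μ := by
  obtain ⟨b, hb, hbσ⟩ := exists_rightSingularBasis rfl W
  obtain ⟨d, hd, hdσ⟩ := exists_rightSingularBasis rfl D
  have hWσ := W.singularValues_nonneg k
  have hDσ := D.singularValues_nonneg μ
  refine singularValues_le_of_subspace _ (S := headSpan b k ⊔ headSpan d μ) (by positivity) ?_
    fun x hx => ?_
  · have hdim := Submodule.finrank_add_le_finrank_add_finrank (headSpan b k) (headSpan d μ)
    rw [finrank_headSpan, finrank_headSpan] at hdim
    omega
  rw [← Submodule.inf_orthogonal] at hx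
  have hT : T x = 0 :=
    apply_eq_zero_of_mem_isometricSubspace_orthogonal hW h <| Submodule.orthogonal_le
      (isometricSubspace_le_headSpan hb fun l hl => by
        rw [hbσ]; exact (W.singularValues_antitone hl).trans_lt hk) hx.1
  have hWx : ‖W x‖ ≤ W.singularValues k * ‖x‖ :=
    norm_apply_le_of_mem_headSpan_orthogonal hb hWσ
      (fun l hl => by rw [hbσ]; exact W.singularValues_antitone hl) hx.1
  have hDx : ‖D x‖ ≤ D.singularValues μ * ‖x‖ :=
    norm_apply_le_of_mem_headSpan_orthogonal hd hDσ
      (fun l hl => by rw [hdσ]; exact D.singularValues_antitone hl) hx.2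
  calc ‖(T + (c : 𝕜) • W + D) x‖ = ‖(c : 𝕜) • W x + D x‖ := by simp [hT]
    _ ≤ c * ‖W x‖ + ‖D x‖ := by
      refine (norm_add_le _ _).trans_eq ?_
      rw [norm_smul, RCLike.norm_ofReal, abs_of_nonneg hc]
    _ ≤ c * (W.singularValues k * ‖x‖) + D.singularValues μ * ‖x‖ := by gcongr
    _ = (c * W.singularValues k + D.singularValues μ) * ‖x‖ := by ring

theorem hs_comp_of_isSymmetric (W T : E →ₗ[𝕜] F) {A : E →ₗ[𝕜] E} (hA : A.IsSymmetric) :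
    hs (W ∘ₗ A) T = hs W (T ∘ₗ A) := by
  have b := stdOrthonormalBasis 𝕜 F
  rw [← hs_adjoint, ← hs_adjoint W, LinearMap.adjoint_comp, LinearMap.adjoint_comp, hA.adjoint_eq,
    hs_eq_sum b, hs_eq_sum b]
  exact Finset.sum_congr rfl fun j _ => congrArg RCLike.re (hA _ _)

/-- The restriction of `W` to its isometric subspace, extended by zero. -/
noncomputable def isometricPart (W : E →ₗ[𝕜] F) : E →ₗ[𝕜] F :=
  W ∘ₗ (isometricSubspace W).starProjection

theorem norm_isometricPart_le (hW : ∀ x, ‖W x‖ ≤ ‖x‖) (x : E) : ‖isometricPart W x‖ ≤ ‖x‖ :=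
  (hW _).trans ((isometricSubspace W).norm_starProjection_apply_le x)

theorem hs_isometricPart (W T : E →ₗ[𝕜] F) :
    hs (isometricPart W) T = hs W (T ∘ₗ (isometricSubspace W).starProjection) :=
  hs_comp_of_isSymmetric W T (isometricSubspace W).starProjection_isSymmetric

theorem hs_isometricPart_self (W : E →ₗ[𝕜] F) :
    hs (isometricPart W) (isometricPart W) = finrank 𝕜 (isometricSubspace W) := by
  set V := isometricSubspace W
  have hproj : LinearMap.IsProj V V.starProjection.toLinearMap :=
    ⟨V.starProjection_apply_mem, fun x hx => V.starProjection_eq_self_iff.2 hx⟩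
  have b := stdOrthonormalBasis 𝕜 E
  calc hs (isometricPart W) (isometricPart W)
      = ∑ j, RCLike.re (inner 𝕜 (b j) (V.starProjection (b j))) := by
        rw [hs_self_eq_sum b]
        refine Finset.sum_congr rfl fun j _ => ?_
        rw [isometricPart, LinearMap.comp_apply, ContinuousLinearMap.coe_coe,
          norm_apply_of_mem_isometricSubspace (V.starProjection_apply_mem _),
          ← inner_self_eq_norm_sq (𝕜 := 𝕜), V.inner_starProjection_left_eq_right,
          V.starProjection_eq_self_iff.2 (V.starProjection_apply_mem _)]
    _ = RCLike.re (LinearMap.trace 𝕜 E V.starProjection.toLinearMap) := by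
        rw [LinearMap.trace_eq_sum_inner _ b, map_sum]
        rfl
    _ = finrank 𝕜 V := by rw [hproj.trace, RCLike.natCast_re]

theorem hs_isometricPart_right (W : E →ₗ[𝕜] F) :
    hs W (isometricPart W) = finrank 𝕜 (isometricSubspace W) := by
  have hidem : isometricPart W ∘ₗ (isometricSubspace W).starProjection.toLinearMap =
      isometricPart W := by
    ext x
    exact congrArg W ((isometricSubspace W).starProjection_eq_self_iff.2
      ((isometricSubspace W).starProjection_apply_mem x))
  rw [← hs_isometricPart_self W, hs_isometricPart W (isometricPart W), hidem]

theorem nuc_isometricPart_le (hW : ∀ x, ‖W x‖ ≤ ‖x‖) :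
    nuc (isometricPart W) ≤ finrank 𝕜 (isometricSubspace W) := by
  rw [← hs_isometricPart_right]
  exact nuc_comp_le_hs hW
    (Submodule.isSymmetricProjection_starProjection _).isPositive
    (Submodule.starProjection_apply_mem _)

theorem hs_isometricPart_of_hs_eq_nuc (hW : ∀ x, ‖W x‖ ≤ ‖x‖) (h : hs W T = nuc T) :
    hs (isometricPart W) T = nuc T := by
  rw [hs_isometricPart, ← h]
  congr 1
  ext x
  have hx := apply_eq_zero_of_mem_isometricSubspace_orthogonal hW h
    ((isometricSubspace W).sub_starProjection_mem_orthogonal x)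
  rw [map_sub, sub_eq_zero] at hx
  exact hx.symm

/- The dual bound for the soft threshold is tested on the isometric part of `W`, which pairs with
`T` as `W` itself does but has the smallest possible nuclear norm. -/
theorem nuc_add_mul_sub_le_sum_threshold (hW : ∀ x, ‖W x‖ ≤ ‖x‖) (h : hs W T = nuc T)
    (D : E →ₗ[𝕜] F) (c : ℝ) {s : ℝ} (hs0 : 0 ≤ s) :
    nuc T + (c - s) * finrank 𝕜 (isometricSubspace W) -
        √(finrank 𝕜 (isometricSubspace W)) * √(hs D D) ≤
      ∑ j ∈ Finset.range (finrank 𝕜 E), max 0 ((T + (c : 𝕜) • W + D).singularValues j - s) := by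
  have hthreshold := hs_le_sum_threshold (norm_isometricPart_le hW) (T + (c : 𝕜) • W + D) hs0
  have hnuc := mul_le_mul_of_nonneg_left (nuc_isometricPart_le hW) hs0
  have hD := hs_le_sqrt_mul_sqrt (isometricPart W) (-D)
  rw [hs_neg_right, hs_neg_right, hs_neg_left, neg_neg, hs_isometricPart_self] at hD
  rw [hs_add_right, hs_add_right, hs_smul_right, hs_isometricPart_of_hs_eq_nuc hW h,
    hs_comm (isometricPart W) W, hs_isometricPart_right] at hthreshold
  linarith

end IsometricSubspace

section BlockDiagonal

variable {𝕜 : Type*} [RCLike 𝕜] {ι α : Type*} {p : ℕ}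

/-- The component with block index `i` of a vector indexed by pairs (index in block, block). -/
def blockPart (x : EuclideanSpace 𝕜 (α × ι)) (i : ι) : EuclideanSpace 𝕜 α :=
  WithLp.toLp 2 fun a => x (a, i)

/-- The vector with the single nonzero component `v`, at the block index `i`. -/
def blockSingle [DecidableEq ι] (i : ι) (v : EuclideanSpace 𝕜 α) : EuclideanSpace 𝕜 (α × ι) :=
  WithLp.toLp 2 fun y => if y.2 = i then v y.1 else 0

theorem blockPart_blockSingle [DecidableEq ι] (i : ι) (v : EuclideanSpace 𝕜 α) :
    blockPart (blockSingle i v) i = v := by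
  ext a
  simp [blockPart, blockSingle]

variable [Fintype ι]

theorem norm_sq_eq_sum_blockPart [Fintype α] (x : EuclideanSpace 𝕜 (α × ι)) :
    ‖x‖ ^ 2 = ∑ i, ‖blockPart x i‖ ^ 2 := by
  simp only [EuclideanSpace.norm_sq_eq, blockPart]
  rw [Fintype.sum_prod_type, Finset.sum_comm]

variable [DecidableEq ι]

theorem blockPart_blockDiagonal_apply (M : ι → Matrix α (Fin p) 𝕜)
    (x : EuclideanSpace 𝕜 (Fin p × ι)) (i : ι) :
    blockPart (Matrix.toEuclideanLin (Matrix.blockDiagonal M) x) i =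
      Matrix.toEuclideanLin (M i) (blockPart x i) := by
  ext a
  simp [blockPart, Matrix.toLpLin_apply, Matrix.mulVec, dotProduct, Fintype.sum_prod_type,
    Matrix.blockDiagonal_apply]

variable [Fintype α]

theorem inner_blockSingle (i : ι) (v : EuclideanSpace 𝕜 α) (x : EuclideanSpace 𝕜 (α × ι)) :
    inner 𝕜 (blockSingle i v) x = inner 𝕜 v (blockPart x i) := by
  simp [PiLp.inner_apply, blockSingle, blockPart, Fintype.sum_prod_type, apply_ite]

theorem norm_blockSingle (i : ι) (v : EuclideanSpace 𝕜 α) : ‖blockSingle i v‖ = ‖v‖ := by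
  rw [norm_eq_sqrt_re_inner (𝕜 := 𝕜), inner_blockSingle, blockPart_blockSingle,
    ← norm_eq_sqrt_re_inner]

theorem singularValues_blockDiagonal_sum_le (M : ι → Matrix α (Fin p) 𝕜) (m : ι → ℕ) {c : ℝ}
    (hc : 0 ≤ c) (h : ∀ i, (Matrix.toEuclideanLin (M i)).singularValues (m i) ≤ c) :
    (Matrix.toEuclideanLin (Matrix.blockDiagonal M)).singularValues (∑ i, m i) ≤ c := by
  choose b hb hn using fun i =>
    exists_rightSingularBasis (p := p) (by simp) (Matrix.toEuclideanLin (M i))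
  let v : (Σ i, Fin (m i)) → EuclideanSpace 𝕜 (Fin p × ι) := fun y =>
    if hj : (y.2 : ℕ) < p then blockSingle y.1 (b y.1 ⟨y.2, hj⟩) else 0
  refine singularValues_le_of_subspace _ hc (S := Submodule.span 𝕜 (Set.range v))
    ((finrank_range_le_card v).trans (by simp)) fun x hx => ?_
  have horth : ∀ i, blockPart x i ∈ (headSpan (b i) (m i))ᗮ := fun i => by
    have hle : headSpan (b i) (m i) ≤ LinearMap.ker (innerₛₗ 𝕜 (blockPart x i)) := by
      refine Submodule.span_le.2 ?_
      rintro _ ⟨l, hl, rfl⟩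
      have hv : v ⟨i, l, hl⟩ = blockSingle i (b i l) := by simp [v]
      have hvx : inner 𝕜 (v ⟨i, l, hl⟩) x = 0 := hx _ (Submodule.subset_span ⟨_, rfl⟩)
      rw [hv, inner_blockSingle] at hvx
      exact inner_eq_zero_symm.1 hvx
    exact (Submodule.mem_orthogonal' _ _).2 fun u hu => hle hu
  have hpart : ∀ i, ‖Matrix.toEuclideanLin (M i) (blockPart x i)‖ ≤ c * ‖blockPart x i‖ :=
    fun i => norm_apply_le_of_mem_headSpan_orthogonal (hb i) hc
      (fun l hl => (hn i l).trans_le ((LinearMap.singularValues_antitone _ hl).trans (h i)))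
      (horth i)
  refine le_of_sq_le_sq ?_ (by positivity)
  rw [norm_sq_eq_sum_blockPart, mul_pow, norm_sq_eq_sum_blockPart x, Finset.mul_sum]
  refine Finset.sum_le_sum fun i _ => ?_
  rw [blockPart_blockDiagonal_apply, ← mul_pow]
  exact pow_le_pow_left₀ (norm_nonneg _) (hpart i) 2

theorem norm_apply_le_singularValues_zero_blockDiagonal_mul (M : ι → Matrix α (Fin p) 𝕜) (i : ι)
    (x : EuclideanSpace 𝕜 (Fin p)) :
    ‖Matrix.toEuclideanLin (M i) x‖ ≤
      (Matrix.toEuclideanLin (Matrix.blockDiagonal M)).singularValues 0 * ‖x‖ := by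
  have hsingle := norm_apply_le_singularValues_zero_mul
    (Matrix.toEuclideanLin (Matrix.blockDiagonal M)) (blockSingle i x)
  rw [norm_blockSingle] at hsingle
  refine (le_of_sq_le_sq ?_ (norm_nonneg _)).trans hsingle
  calc ‖Matrix.toEuclideanLin (M i) x‖ ^ 2
      = ‖blockPart (Matrix.toEuclideanLin (Matrix.blockDiagonal M) (blockSingle i x)) i‖ ^ 2 := by
        rw [blockPart_blockDiagonal_apply, blockPart_blockSingle]
    _ ≤ _ := by
        rw [norm_sq_eq_sum_blockPart]
        exact Finset.single_le_sum (f := fun j => ‖blockPart (Matrix.toEuclideanLin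
          (Matrix.blockDiagonal M) (blockSingle i x)) j‖ ^ 2) (fun _ _ => sq_nonneg _)
          (Finset.mem_univ i)

end BlockDiagonal

section TopMultiplicity

variable {p q : Type*} [Fintype p] [Fintype q] [DecidableEq q] {M : Matrix p q ℂ} {d : ℕ}

theorem sv_eq_zero_of_min_card_le (M : Matrix p q ℂ) {j : ℕ}
    (hj : min (Fintype.card p) (Fintype.card q) ≤ j) : sv M j = 0 := by
  rcases min_le_iff.1 hj with h | h
  · exact singularValues_eq_zero_of_finrank_codomain_le _ (by simpa using h)
  · exact LinearMap.singularValues_of_finrank_le _ (by simpa using h)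

theorem topMult_le_of_sv_lt (h : sv M d < sv M 0) : topMult M ≤ d := by
  rw [topMult, ← Finset.card_range d, ← Set.ncard_coe_finset]
  refine Set.ncard_le_ncard (fun j hj => ?_) (Finset.finite_toSet _)
  rw [Finset.coe_range, Set.mem_Iio]
  by_contra! hdj
  exact h.not_ge (hj.2.ge.trans (LinearMap.singularValues_antitone _ hdj))

theorem le_topMult_of_forall_sv_eq (hM : 0 < sv M 0) (h : ∀ j < d, sv M j = sv M 0) :
    d ≤ topMult M := by
  rw [topMult, ← Finset.card_range d, ← Set.ncard_coe_finset]
  refine Set.ncard_le_ncard (fun j hj => ?_)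
    ((Set.finite_Iio (min (Fintype.card p) (Fintype.card q))).subset fun _ hj => hj.1)
  have hsv : sv M j = sv M 0 := h j (by simpa using hj)
  refine ⟨?_, hsv⟩
  by_contra! hj'
  exact hM.ne' (hsv ▸ sv_eq_zero_of_min_card_le M hj')

end TopMultiplicity

section Scaling

variable {𝕜 : Type*} [RCLike 𝕜]
  {E : Type*} [NormedAddCommGroup E] [InnerProductSpace 𝕜 E] [FiniteDimensional 𝕜 E]
  {F : Type*} [NormedAddCommGroup F] [InnerProductSpace 𝕜 F] [FiniteDimensional 𝕜 F]

theorem singularValues_smul (c : 𝕜) (T : E →ₗ[𝕜] F) (j : ℕ) :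
    (c • T).singularValues j = ‖c‖ * T.singularValues j := by
  rcases le_or_gt (finrank 𝕜 E) j with hj | hj
  · rw [LinearMap.singularValues_of_finrank_le _ hj, LinearMap.singularValues_of_finrank_le _ hj,
      mul_zero]
  obtain ⟨b, hb, hσ⟩ := exists_rightSingularBasis rfl T
  have hnorm : ∀ l, ‖(c • T) (b l)‖ = ‖c‖ * T.singularValues l := fun l => by
    rw [LinearMap.smul_apply, norm_smul, hσ]
  rw [singularValues_eq_norm_apply_basis b (c • T) (fun l m hlm => by
    simp [inner_smul_left, inner_smul_right, hb hlm]) (fun l m hlm => ?_) ⟨j, hj⟩, hnorm]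
  simp only [hnorm]
  gcongr
  exact T.singularValues_antitone hlm

theorem exists_nuc_le_one_hs_eq_neg_singularValues_zero (T : E →ₗ[𝕜] F) :
    ∃ D : E →ₗ[𝕜] F, nuc D ≤ 1 ∧ hs T D = -T.singularValues 0 := by
  rcases Nat.eq_zero_or_pos (finrank 𝕜 E) with hE | hE
  · refine ⟨0, by simp [nuc], ?_⟩
    rw [T.singularValues_of_finrank_le hE.le]
    simp [hs]
  obtain ⟨b, -, hσ⟩ := exists_rightSingularBasis rfl T
  set v := b ⟨0, hE⟩
  have hv : ‖T v‖ = T.singularValues 0 := hσ ⟨0, hE⟩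
  refine ⟨rankOne 𝕜 (((-‖T v‖⁻¹ : ℝ) : 𝕜) • T v) v, (nuc_rankOne_le _ _).trans ?_, ?_⟩
  · rw [norm_smul, RCLike.norm_ofReal, abs_neg, abs_of_nonneg (by positivity),
      b.orthonormal.norm_eq_one, mul_one]
    exact inv_mul_le_one
  · rw [hs_comm, hs_rankOne, inner_smul_left, RCLike.conj_ofReal, RCLike.re_ofReal_mul,
      inner_self_eq_norm_sq, ← hv]
    rcases eq_or_ne ‖T v‖ 0 with h | h
    · simp [h]
    · field_simp

end Scaling

section Duality

variable {n₁ n₂ k : ℕ} {n : Fin k → ℕ} {G X : Tensor n₁ n₂ n}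

theorem norm_slice_le_sv_bdiag_mul (G : Tensor n₁ n₂ n) (i : SliceIdx n)
    (x : EuclideanSpace ℂ (Fin n₂)) : ‖slice G i x‖ ≤ sv (bdiag G) 0 * ‖x‖ :=
  norm_apply_le_singularValues_zero_blockDiagonal_mul (fslice G) i x

theorem sv_fslice_le_sv_bdiag (G : Tensor n₁ n₂ n) (i : SliceIdx n) (j : ℕ) :
    sv (fslice G i) j ≤ sv (bdiag G) 0 :=
  singularValues_le_of_subspace _ (LinearMap.singularValues_nonneg _ _) (S := ⊥) (by simp)
    fun x _ => norm_slice_le_sv_bdiag_mul G i x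

theorem sv_bdiag_sum_le (G : Tensor n₁ n₂ n) (m : SliceIdx n → ℕ) {c : ℝ} (hc : 0 ≤ c)
    (h : ∀ i, sv (fslice G i) (m i) ≤ c) : sv (bdiag G) (∑ i, m i) ≤ c :=
  singularValues_blockDiagonal_sum_le (fslice G) m hc h

theorem sv_bdiag_pos (hG : G ≠ 0) : 0 < sv (bdiag G) 0 := by
  refine lt_of_le_of_ne (LinearMap.singularValues_nonneg _ _) fun h => hG ?_
  have hslice : ∀ i, slice G i = 0 := fun i => by
    ext1 x
    simpa [← h] using norm_slice_le_sv_bdiag_mul G i x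
  have hnorm := norm_sq_eq_sum_hs G
  simpa [hslice, hs] using hnorm

theorem nonempty_sliceIdx (hG : G ≠ 0) : Nonempty (SliceIdx n) := by
  by_contra! h
  exact hG (Subsingleton.elim _ _)

theorem exists_sv_fslice_eq_sv_bdiag [Nonempty (SliceIdx n)] (G : Tensor n₁ n₂ n) :
    ∃ i, sv (fslice G i) 0 = sv (bdiag G) 0 := by
  obtain ⟨i, hi⟩ := Finite.exists_max fun i => sv (fslice G i) 0
  refine ⟨i, (sv_fslice_le_sv_bdiag G i 0).antisymm ?_⟩
  simpa using sv_bdiag_sum_le G (fun _ => 0) (c := sv (fslice G i) 0)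
    (LinearMap.singularValues_nonneg _ _) hi

/-- The real tensor obtained by the inverse Fourier transform from the single slice `L` at `i₀`.
Pairing with it reads off the slice `i₀` of a real tensor. -/
noncomputable def singleSlice (i₀ : SliceIdx n)
    (L : EuclideanSpace ℂ (Fin n₂) →ₗ[ℂ] EuclideanSpace ℂ (Fin n₁)) : Tensor n₁ n₂ n :=
  ofSlices (Pi.single i₀ (Matrix.toEuclideanLin.symm L))

theorem inner_singleSlice (i₀ : SliceIdx n)
    (L : EuclideanSpace ℂ (Fin n₂) →ₗ[ℂ] EuclideanSpace ℂ (Fin n₁)) (X : Tensor n₁ n₂ n) :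
    inner ℝ (singleSlice i₀ L) X = (1 / (numSlices n : ℝ)) * hs L (slice X i₀) := by
  rw [singleSlice, inner_ofSlices, Finset.sum_eq_single i₀ _ (by simp), Pi.single_eq_same,
    LinearEquiv.apply_symm_apply]
  intro i _ hi
  simp [Pi.single_eq_of_ne hi, hs]

theorem tnn_singleSlice_le (i₀ : SliceIdx n)
    (L : EuclideanSpace ℂ (Fin n₂) →ₗ[ℂ] EuclideanSpace ℂ (Fin n₁)) :
    tnn (singleSlice i₀ L) ≤ (1 / (numSlices n : ℝ)) * nuc L := by
  refine (tnn_ofSlices_le _).trans_eq ?_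
  rw [Finset.sum_eq_single i₀ _ (by simp), Pi.single_eq_same, LinearEquiv.apply_symm_apply]
  intro i _ hi
  simp [Pi.single_eq_of_ne hi, nuc]

theorem exists_mem_ball_inner_eq_neg_sv_bdiag [Nonempty (SliceIdx n)] (G : Tensor n₁ n₂ n) :
    ∃ Z ∈ ball n₁ n₂ n 1, inner ℝ G Z = -sv (bdiag G) 0 := by
  obtain ⟨i₀, hi₀⟩ := exists_sv_fslice_eq_sv_bdiag G
  have hN := numSlices_pos i₀
  obtain ⟨D, hD, hGD⟩ := exists_nuc_le_one_hs_eq_neg_singularValues_zero (slice G i₀)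
  refine ⟨(numSlices n : ℝ) • singleSlice i₀ D, ?_, ?_⟩
  · calc tnn ((numSlices n : ℝ) • singleSlice i₀ D)
        ≤ numSlices n * ((1 / (numSlices n : ℝ)) * nuc D) :=
          (tnn_smul_le hN.le _).trans (by gcongr; exact tnn_singleSlice_le i₀ D)
      _ = nuc D := by field_simp
      _ ≤ 1 := hD
  · rw [real_inner_comm, real_inner_smul_left, inner_singleSlice, hs_comm, hGD, ← hi₀, sv_fslice]
    field_simp

/-- The slices of `-G`, scaled so that the largest of their operator norms becomes `1`. -/
noncomputable def dualSlice (G : Tensor n₁ n₂ n) (i : SliceIdx n) :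
    EuclideanSpace ℂ (Fin n₂) →ₗ[ℂ] EuclideanSpace ℂ (Fin n₁) :=
  slice (-(sv (bdiag G) 0)⁻¹ • G) i

theorem slice_eq_neg_smul_dualSlice (hG : G ≠ 0) (i : SliceIdx n) :
    slice G i = ((-sv (bdiag G) 0 : ℝ) : ℂ) • dualSlice G i := by
  rw [dualSlice, ← slice_smul, smul_smul, neg_mul_neg, mul_inv_cancel₀ (sv_bdiag_pos hG).ne',
    one_smul]

theorem singularValues_dualSlice (hG : G ≠ 0) (i : SliceIdx n) (j : ℕ) :
    (dualSlice G i).singularValues j = sv (fslice G i) j / sv (bdiag G) 0 := by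
  have hg := sv_bdiag_pos hG
  rw [sv_fslice, slice_eq_neg_smul_dualSlice hG, singularValues_smul, Complex.norm_real,
    norm_neg, Real.norm_of_nonneg hg.le, mul_div_cancel_left₀ _ hg.ne']

theorem norm_dualSlice_le (hG : G ≠ 0) (i : SliceIdx n) (x : EuclideanSpace ℂ (Fin n₂)) :
    ‖dualSlice G i x‖ ≤ ‖x‖ := by
  refine (norm_apply_le_singularValues_zero_mul _ x).trans
    (mul_le_of_le_one_left (norm_nonneg x) ?_)
  rw [singularValues_dualSlice hG]
  exact div_le_one_of_le₀ (sv_fslice_le_sv_bdiag G i 0) (sv_bdiag_pos hG).le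

theorem inner_eq_neg_mul_sum_hs_dualSlice (hG : G ≠ 0) (X : Tensor n₁ n₂ n) :
    inner ℝ G X =
      -(sv (bdiag G) 0 * ((1 / (numSlices n : ℝ)) * ∑ i, hs (dualSlice G i) (slice X i))) := by
  simp only [inner_eq_sum_hs, slice_eq_neg_smul_dualSlice hG, ← RCLike.ofReal_eq_complex_ofReal,
    hs_smul_left, ← Finset.mul_sum]
  ring

theorem neg_inner_le_sv_bdiag_mul_tnn (G X : Tensor n₁ n₂ n) :
    -inner ℝ G X ≤ sv (bdiag G) 0 * tnn X := by
  rw [← inner_neg_left]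
  refine inner_le_mul_tnn (fun i x => ?_) X
  rw [slice_neg, LinearMap.neg_apply, norm_neg]
  exact norm_slice_le_sv_bdiag_mul G i x

theorem hs_dualSlice_eq_nuc (hG : G ≠ 0) (h : sv (bdiag G) 0 * tnn X ≤ -inner ℝ G X)
    (i : SliceIdx n) : hs (dualSlice G i) (slice X i) = nuc (slice X i) := by
  have hle : ∀ i, hs (dualSlice G i) (slice X i) ≤ nuc (slice X i) := fun i =>
    hs_le_nuc (norm_dualSlice_le hG i) _
  rw [inner_eq_neg_mul_sum_hs_dualSlice hG, neg_neg, tnn_eq_sum_nuc] at h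
  have hsum := le_of_mul_le_mul_left (le_of_mul_le_mul_left h (sv_bdiag_pos hG))
    (one_div_pos.2 (numSlices_pos i))
  exact (Finset.sum_eq_sum_iff_of_le fun i _ => hle i).1
    ((Finset.sum_le_sum fun i _ => hle i).antisymm hsum) i (Finset.mem_univ i)

theorem tnn_eq_one_and_hs_dualSlice_eq_nuc (hG : G ≠ 0) (hX : X ∈ ball n₁ n₂ n 1)
    (hmin : ∀ Z ∈ ball n₁ n₂ n 1, 0 ≤ inner ℝ G (Z - X)) :
    tnn X = 1 ∧ ∀ i, hs (dualSlice G i) (slice X i) = nuc (slice X i) := by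
  have := nonempty_sliceIdx hG
  have hg := sv_bdiag_pos hG
  obtain ⟨Z, hZ, hGZ⟩ := exists_mem_ball_inner_eq_neg_sv_bdiag G
  have hgX : sv (bdiag G) 0 ≤ -inner ℝ G X := by
    have hZX := hmin Z hZ
    rw [inner_sub_right, hGZ] at hZX
    linarith
  have htnn : tnn X = 1 := hX.antisymm <| le_of_mul_le_mul_left
    ((mul_one _).trans_le (hgX.trans (neg_inner_le_sv_bdiag_mul_tnn G X))) hg
  exact ⟨htnn, hs_dualSlice_eq_nuc hG (by rwa [htnn, mul_one])⟩

end Duality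

section Truncation

variable {n₁ n₂ k : ℕ} {n : Fin k → ℕ} {G P X : Tensor n₁ n₂ n} {β : ℝ}

/-- The multiplicity of `σ₁(Ḡ)` as a singular value of the slice `i` of the Fourier transform of
`G`, encoded as the dimension of the space on which the normalized slice is isometric. -/
noncomputable def globalMult (G : Tensor n₁ n₂ n) (i : SliceIdx n) : ℕ :=
  finrank ℂ (isometricSubspace (dualSlice G i))

theorem sv_globalMult_lt (hG : G ≠ 0) (i : SliceIdx n) :
    sv (fslice G i) (globalMult G i) < sv (bdiag G) 0 := by
  have h := singularValues_finrank_isometricSubspace_lt_one (norm_dualSlice_le hG i)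
  rwa [singularValues_dualSlice hG, div_lt_one (sv_bdiag_pos hG)] at h

theorem sv_eq_of_lt_globalMult (hG : G ≠ 0) {i : SliceIdx n} {j : ℕ} (hj : j < globalMult G i) :
    sv (fslice G i) j = sv (bdiag G) 0 := by
  have h := singularValues_eq_one (norm_dualSlice_le hG i) hj
  rwa [singularValues_dualSlice hG, div_eq_one_iff_eq (sv_bdiag_pos hG).ne'] at h

theorem fslice_ne_zero_of_sv_eq (hG : G ≠ 0) {i : SliceIdx n} {j : ℕ}
    (h : sv (fslice G i) j = sv (bdiag G) 0) : fslice G i ≠ 0 := by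
  intro hi
  rw [hi, sv, map_zero, LinearMap.singularValues_zero] at h
  exact (sv_bdiag_pos hG).ne h

theorem topMult_le_maxTopMult {i : SliceIdx n} (hi : fslice G i ≠ 0) :
    topMult (fslice G i) ≤ maxTopMult G :=
  le_ciSup (f := fun i : {i : SliceIdx n // fslice G i ≠ 0} => topMult (fslice G i.1))
    (Set.finite_range _).bddAbove ⟨i, hi⟩

theorem le_maxTopMult_of_forall_sv_eq (hG : G ≠ 0) {i : SliceIdx n} {d : ℕ} (hd : 0 < d)
    (h : ∀ j < d, sv (fslice G i) j = sv (bdiag G) 0) : d ≤ maxTopMult G :=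
  (le_topMult_of_forall_sv_eq ((sv_bdiag_pos hG).trans_eq (h 0 hd).symm)
    fun j hj => (h j hj).trans (h 0 hd).symm).trans
    (topMult_le_maxTopMult (fslice_ne_zero_of_sv_eq hG (h 0 hd)))

theorem sv_lt_of_maxTopMult_le (hG : G ≠ 0) {r : ℕ} (hr : maxTopMult G ≤ r) (i : SliceIdx n) :
    sv (fslice G i) r < sv (bdiag G) 0 := by
  refine lt_of_le_of_ne (sv_fslice_le_sv_bdiag G i r) fun heq => ?_
  have hle := le_maxTopMult_of_forall_sv_eq (i := i) hG r.succ_pos fun j hj =>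
    (sv_fslice_le_sv_bdiag G i j).antisymm
      (heq.ge.trans (LinearMap.singularValues_antitone _ (Nat.lt_succ_iff.1 hj)))
  omega

theorem maxTopMult_pos (hG : G ≠ 0) : 0 < maxTopMult G := by
  have := nonempty_sliceIdx hG
  obtain ⟨i, hi⟩ := exists_sv_fslice_eq_sv_bdiag G
  exact le_maxTopMult_of_forall_sv_eq hG one_pos fun j hj => by rwa [Nat.lt_one_iff.1 hj]

theorem sum_globalMult_le (hG : G ≠ 0) : ∑ i, globalMult G i ≤ maxTopMult G * nnzb G := by
  classical
  have hle : ∀ i, globalMult G i ≤ if fslice G i ≠ 0 then maxTopMult G else 0 := fun i => by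
    rcases Nat.eq_zero_or_pos (globalMult G i) with h | h
    · exact h.trans_le (Nat.zero_le _)
    · rw [if_pos (fslice_ne_zero_of_sv_eq hG (sv_eq_of_lt_globalMult hG h))]
      exact le_maxTopMult_of_forall_sv_eq hG h fun j hj => sv_eq_of_lt_globalMult hG hj
  refine (Finset.sum_le_sum fun i _ => hle i).trans_eq ?_
  rw [← Finset.sum_filter, Finset.sum_const, smul_eq_mul, mul_comm, nnzb,
    Set.ncard_eq_toFinset_card']
  simp

theorem topMult_bdiag_le_sum_globalMult (hG : G ≠ 0) :
    topMult (bdiag G) ≤ ∑ i, globalMult G i := by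
  have := nonempty_sliceIdx hG
  obtain ⟨i, hi⟩ := Finite.exists_max fun i => sv (fslice G i) (globalMult G i)
  exact topMult_le_of_sv_lt <|
    (sv_bdiag_sum_le G (globalMult G) (LinearMap.singularValues_nonneg _ _) hi).trans_lt
      (sv_globalMult_lt hG i)

theorem topMult_bdiag_pos (hG : G ≠ 0) : 0 < topMult (bdiag G) :=
  le_topMult_of_forall_sv_eq (sv_bdiag_pos hG) fun j hj => by rw [Nat.lt_one_iff.1 hj]

theorem sv_le_sub_gap (G : Tensor n₁ n₂ n) (i : SliceIdx n) (r : ℕ) :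
    sv (fslice G i) r ≤ sv (bdiag G) 0 - gap G r := by
  rw [gap, sub_sub_cancel]
  exact le_ciSup (f := fun i => sv (fslice G i) r) (Set.finite_range _).bddAbove i

theorem sum_hs_self (X : Tensor n₁ n₂ n) [Nonempty (SliceIdx n)] :
    ∑ i, hs (slice X i) (slice X i) = numSlices n * ‖X‖ ^ 2 := by
  have hN := numSlices_pos (Classical.arbitrary (SliceIdx n))
  rw [norm_sq_eq_sum_hs]
  field_simp

theorem sqrt_hs_self_le (X : Tensor n₁ n₂ n) (i : SliceIdx n) :
    √(hs (slice X i) (slice X i)) ≤ √(numSlices n : ℝ) * ‖X‖ := by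
  have : Nonempty (SliceIdx n) := ⟨i⟩
  refine Real.sqrt_le_iff.2 ⟨by positivity, ?_⟩
  rw [mul_pow, Real.sq_sqrt (Nat.cast_nonneg _), ← sum_hs_self]
  exact Finset.single_le_sum (f := fun i => hs (slice X i) (slice X i))
    (fun i _ => hs_self_nonneg _) (Finset.mem_univ i)

theorem slice_eq_add_smul_dualSlice_add (hG : G ≠ 0) (P X : Tensor n₁ n₂ n) (β : ℝ)
    (i : SliceIdx n) :
    slice P i = slice X i + ((sv (bdiag G) 0 / β : ℝ) : ℂ) • dualSlice G i +
      slice (P - (X - (1 / β) • G)) i := by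
  rw [dualSlice, ← slice_smul, ← slice_add, ← slice_add, smul_smul, div_mul_eq_mul_div, mul_neg,
    mul_inv_cancel₀ (sv_bdiag_pos hG).ne']
  congr 1
  module

theorem sv_le_sub_gap_div_add (hβ : 0 < β) (hG : G ≠ 0)
    (hX : ∀ i, hs (dualSlice G i) (slice X i) = nuc (slice X i)) {i : SliceIdx n} {l : ℕ}
    (hl : sv (fslice G i) l < sv (bdiag G) 0) (μ : ℕ) :
    sv (fslice P i) (l + μ) ≤ (sv (bdiag G) 0 - gap G l) / β +
      √(numSlices n : ℝ) * ‖P - (X - (1 / β) • G)‖ / √((μ : ℝ) + 1) := by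
  have hg := sv_bdiag_pos hG
  set D := P - (X - (1 / β) • G)
  calc sv (fslice P i) (l + μ)
      ≤ sv (bdiag G) 0 / β * (dualSlice G i).singularValues l + (slice D i).singularValues μ := by
        rw [sv_fslice, slice_eq_add_smul_dualSlice_add hG P X β i]
        refine singularValues_add_smul_add_le (norm_dualSlice_le hG i) (hX i)
          (div_nonneg hg.le hβ.le) ?_ _ _
        rwa [singularValues_dualSlice hG, div_lt_one hg]
    _ = sv (fslice G i) l / β + (slice D i).singularValues μ := by
        rw [singularValues_dualSlice hG, div_mul_div_cancel₀' hg.ne']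
    _ ≤ _ := by
        gcongr
        · exact sv_le_sub_gap G i l
        · refine (singularValues_le_sqrt_hs_div _ μ).trans ?_
          gcongr
          exact sqrt_hs_self_le D i

theorem thresholdSum_eq_of_forall_sv_le {r r' : ℕ} (hr : r ≤ r') {s : ℝ}
    (h : ∀ i, sv (fslice P i) r ≤ s) : thresholdSum r' P s = thresholdSum r P s := by
  refine Finset.sum_congr rfl fun i _ => (Finset.sum_subset (Finset.range_subset_range.2 hr)
    fun j _ hj => max_eq_left (sub_nonpos.2 ?_)).symm
  exact (LinearMap.singularValues_antitone _ (by simpa using hj)).trans (h i)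

theorem mul_tnn_add_mul_sub_le_thresholdSum (hG : G ≠ 0)
    (hX : ∀ i, hs (dualSlice G i) (slice X i) = nuc (slice X i)) {s : ℝ} (hs0 : 0 ≤ s) :
    numSlices n * tnn X + (sv (bdiag G) 0 / β - s) * ∑ i, (globalMult G i : ℝ) -
        √(∑ i, (globalMult G i : ℝ)) * (√(numSlices n : ℝ) * ‖P - (X - (1 / β) • G)‖) ≤
      thresholdSum n₂ P s := by
  have := nonempty_sliceIdx hG
  have hN := numSlices_pos (Classical.arbitrary (SliceIdx n))
  set D := P - (X - (1 / β) • G)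
  have hslice : ∀ i, nuc (slice X i) + (sv (bdiag G) 0 / β - s) * globalMult G i -
      √(globalMult G i) * √(hs (slice D i) (slice D i)) ≤
      ∑ j ∈ Finset.range n₂, max 0 (sv (fslice P i) j - s) := fun i => by
    have h := nuc_add_mul_sub_le_sum_threshold (norm_dualSlice_le hG i) (hX i) (slice D i)
      (sv (bdiag G) 0 / β) hs0
    rwa [RCLike.ofReal_eq_complex_ofReal, ← slice_eq_add_smul_dualSlice_add hG,
      finrank_euclideanSpace_fin] at h
  have hCauchySchwarz : ∑ i, √(globalMult G i : ℝ) * √(hs (slice D i) (slice D i)) ≤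
      √(∑ i, (globalMult G i : ℝ)) * (√(numSlices n : ℝ) * ‖D‖) := by
    have h := Real.sum_mul_le_sqrt_mul_sqrt Finset.univ (fun i => √(globalMult G i : ℝ))
      (fun i => √(hs (slice D i) (slice D i)))
    simp only [Real.sq_sqrt (hs_self_nonneg _), Real.sq_sqrt (Nat.cast_nonneg _)] at h
    rwa [sum_hs_self, Real.sqrt_mul hN.le, Real.sqrt_sq (norm_nonneg _)] at h
  have hnuc : ∑ i, nuc (slice X i) = numSlices n * tnn X := by
    rw [tnn_eq_sum_nuc]
    field_simp
  have hsum := Finset.sum_le_sum fun i (_ : i ∈ Finset.univ) => hslice i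
  rw [Finset.sum_sub_distrib, Finset.sum_add_distrib, ← Finset.mul_sum, hnuc] at hsum
  rw [thresholdSum]
  linarith

theorem sqrt_sum_globalMult_mul_le (hG : G ≠ 0) {δ t : ℝ} (hδ : 0 ≤ δ)
    (h : δ * (√((maxTopMult G : ℝ) * (nnzb G : ℝ)) / (topMult (bdiag G) : ℝ)) ≤ t) :
    √(∑ i, (globalMult G i : ℝ)) * δ ≤ t * ∑ i, (globalMult G i : ℝ) := by
  have hpos : (0 : ℝ) < topMult (bdiag G) := Nat.cast_pos.2 (topMult_bdiag_pos hG)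
  have hle : (topMult (bdiag G) : ℝ) ≤ ∑ i, (globalMult G i : ℝ) := by
    exact_mod_cast topMult_bdiag_le_sum_globalMult hG
  calc √(∑ i, (globalMult G i : ℝ)) * δ
      ≤ √((maxTopMult G : ℝ) * (nnzb G : ℝ)) * δ := by
        gcongr
        exact_mod_cast sum_globalMult_le hG
    _ = δ * (√((maxTopMult G : ℝ) * (nnzb G : ℝ)) / (topMult (bdiag G) : ℝ)) *
          topMult (bdiag G) := by field_simp
    _ ≤ t * ∑ i, (globalMult G i : ℝ) := by
        gcongr
        exact le_trans (by positivity) h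

theorem exists_level_of_gap (hβ : 0 < β) (hG : G ≠ 0) (htnn : tnn X = 1)
    (hX : ∀ i, hs (dualSlice G i) (slice X i) = nuc (slice X i)) {l μ : ℕ} (hr : l + μ ≤ n₂)
    (hl : ∀ i, sv (fslice G i) l < sv (bdiag G) 0)
    (hD : β * √(numSlices n : ℝ) * ‖P - (X - (1 / β) • G)‖ *
      (1 / √((μ : ℝ) + 1) + √((maxTopMult G : ℝ) * (nnzb G : ℝ)) / (topMult (bdiag G) : ℝ)) ≤
      gap G l) :
    ∃ s : ℝ, 0 ≤ s ∧ (∀ i, sv (fslice P i) (l + μ) ≤ s) ∧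
      (numSlices n : ℝ) ≤ thresholdSum (l + μ) P s := by
  have := nonempty_sliceIdx hG
  obtain ⟨i₀, hi₀⟩ := Finite.exists_max fun i => sv (fslice P i) (l + μ)
  set s := sv (fslice P i₀) (l + μ)
  have hs0 : 0 ≤ s := LinearMap.singularValues_nonneg _ _
  refine ⟨s, hs0, hi₀, ?_⟩
  rw [← thresholdSum_eq_of_forall_sv_le hr hi₀]
  have hmass := mul_tnn_add_mul_sub_le_thresholdSum (P := P) (β := β) hG hX hs0
  have hlevel := sv_le_sub_gap_div_add (P := P) hβ hG hX (hl i₀) μ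
  set δ := √(numSlices n : ℝ) * ‖P - (X - (1 / β) • G)‖
  set Q := √((maxTopMult G : ℝ) * (nnzb G : ℝ))
  set M := (topMult (bdiag G) : ℝ)
  have hdrop : δ * (Q / M) ≤ sv (bdiag G) 0 / β - s := by
    have hgap : δ * (1 / √((μ : ℝ) + 1) + Q / M) ≤ gap G l / β := by
      rw [le_div_iff₀ hβ]
      linarith
    have hsplit : δ * (1 / √((μ : ℝ) + 1) + Q / M) = δ / √((μ : ℝ) + 1) + δ * (Q / M) := by ring
    rw [sub_div] at hlevel
    linarith
  have hgain := sqrt_sum_globalMult_mul_le hG (by positivity) hdrop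
  rw [htnn, mul_one] at hmass
  linarith

end Truncation

section LocalExactness

variable {n₁ n₂ k : ℕ} {n : Fin k → ℕ} {r : ℕ} {P X Y Y₀ G : Tensor n₁ n₂ n}

theorem continuous_thresholdSum (r : ℕ) (P : Tensor n₁ n₂ n) : Continuous (thresholdSum r P) := by
  unfold thresholdSum
  fun_prop

theorem thresholdSum_eq_zero_of_forall_sv_le {s : ℝ} (h : ∀ i j, sv (fslice P i) j ≤ s) :
    thresholdSum r P s = 0 :=
  Finset.sum_eq_zero fun i _ => Finset.sum_eq_zero fun j _ => max_eq_left (sub_nonpos.2 (h i j))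

theorem thresholdSum_lt_thresholdSum {s s₀ : ℝ} (hs : s < s₀) (h : 0 < thresholdSum r P s₀) :
    thresholdSum r P s₀ < thresholdSum r P s := by
  have hterm : ∀ i j, max 0 (sv (fslice P i) j - s₀) ≤ max 0 (sv (fslice P i) j - s) :=
    fun i j => max_le_max le_rfl (by linarith)
  have hnonneg : ∀ i j, 0 ≤ max 0 (sv (fslice P i) j - s₀) := fun i j => le_max_left _ _
  obtain ⟨i, hi, hpos⟩ := (Finset.sum_pos_iff_of_nonneg fun i _ =>
    Finset.sum_nonneg fun j _ => hnonneg i j).1 h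
  obtain ⟨j, hj, hpos⟩ := (Finset.sum_pos_iff_of_nonneg fun j _ => hnonneg i j).1 hpos
  refine Finset.sum_lt_sum (fun i _ => Finset.sum_le_sum fun j _ => hterm i j)
    ⟨i, hi, Finset.sum_lt_sum (fun j _ => hterm i j) ⟨j, hj, ?_⟩⟩
  have hlt := (lt_max_iff.1 hpos).resolve_left (lt_irrefl 0)
  rw [max_eq_right hlt.le]
  exact lt_max_of_lt_right (by linarith)

theorem exists_thresholdSum_eq {s₀ c : ℝ} (hc : 0 ≤ c) (h : c ≤ thresholdSum r P s₀) :
    ∃ s, s₀ ≤ s ∧ thresholdSum r P s = c := by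
  set B := max s₀ (sv (bdiag P) 0)
  have hB : thresholdSum r P B = 0 := thresholdSum_eq_zero_of_forall_sv_le fun i j =>
    (sv_fslice_le_sv_bdiag P i j).trans (le_max_right _ _)
  obtain ⟨s, hs, hsc⟩ := intermediate_value_Icc' (le_max_left s₀ (sv (bdiag P) 0))
    (continuous_thresholdSum r P).continuousOn ⟨hB.trans_le hc, h⟩
  exact ⟨s, hs.1, hsc⟩

theorem isTruncProj_iff_eq [Nonempty (SliceIdx n)] (hr : r ≤ min n₁ n₂) {τ : ℝ} (hτ : 0 < τ)
    (hproj : IsProj (ball n₁ n₂ n τ) P Y₀) {s₀ : ℝ} (hs₀ : 0 ≤ s₀)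
    (hsr : ∀ i, sv (fslice P i) r ≤ s₀) (hsum : numSlices n * τ ≤ thresholdSum r P s₀) :
    IsTruncProj r τ P Y ↔ Y = Y₀ := by
  have hN := numSlices_pos (Classical.arbitrary (SliceIdx n))
  have hlevel : ∀ s, (1 / (numSlices n : ℝ)) * thresholdSum r P s = τ ↔
      thresholdSum r P s = numSlices n * τ := fun s => by
    rw [one_div, inv_mul_eq_iff_eq_mul₀ hN.ne']
  have hle : ∀ s, thresholdSum r P s = numSlices n * τ → s₀ ≤ s := fun s hs => by
    by_contra! hlt
    exact (thresholdSum_lt_thresholdSum hlt ((mul_pos hN hτ).trans_le hsum)).not_ge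
      (hs.trans_le hsum)
  have hunique : ∀ Y, IsTruncProj r τ P Y → Y = Y₀ := fun Y hY =>
    hproj.eq_of_forall_inner_nonpos (convex_ball τ) (hY.mem_ball hr) fun Z hZ =>
      hY.inner_nonpos hr (fun s _ hs i => (hsr i).trans (hle s ((hlevel s).1 hs))) hZ
  refine ⟨hunique Y, ?_⟩
  rintro rfl
  obtain ⟨s, hs, hsN⟩ := exists_thresholdSum_eq (mul_pos hN hτ).le hsum
  obtain ⟨Y', hY'⟩ := exists_isTruncProj (hs₀.trans hs) ((hlevel s).2 hsN)
  rwa [← hunique Y' hY']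

theorem gap_pos_iff [Nonempty (SliceIdx n)] (G : Tensor n₁ n₂ n) (r : ℕ) :
    0 < gap G r ↔ ∀ i, sv (fslice G i) r < sv (bdiag G) 0 := by
  refine ⟨fun h i => by linarith [sv_le_sub_gap G i r], fun h => ?_⟩
  obtain ⟨i, hi⟩ := exists_eq_ciSup_of_finite (f := fun i => sv (fslice G i) r)
  rw [gap, ← hi, sub_pos]
  exact h i

theorem exists_gap_of_le_radius {β ρ : ℝ} (hβ : 0 < β) (hG : G ≠ 0) (hr : maxTopMult G ≤ r)
    (hρ : ρ ≤ radius β G r) :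
    ∃ l μ, l + μ = r ∧ 0 < gap G l ∧ β * √(numSlices n : ℝ) * (2 * ρ) *
      (1 / √((μ : ℝ) + 1) + √((maxTopMult G : ℝ) * (nnzb G : ℝ)) / (topMult (bdiag G) : ℝ)) ≤
        gap G l := by
  have := nonempty_sliceIdx hG
  have hN : 0 < √(numSlices n : ℝ) :=
    Real.sqrt_pos.2 (numSlices_pos (Classical.arbitrary (SliceIdx n)))
  have hm := maxTopMult_pos hG
  have hm0 : 0 < √(maxTopMult G : ℝ) := Real.sqrt_pos.2 (Nat.cast_pos.2 hm)
  set Q := √((maxTopMult G : ℝ) * (nnzb G : ℝ)) / (topMult (bdiag G) : ℝ)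
  have hQ : 0 ≤ Q := by positivity
  have hscale : ∀ {d c : ℝ}, 0 < c → ρ ≤ 1 / (2 * β * √(numSlices n : ℝ)) * (d / c) →
      β * √(numSlices n : ℝ) * (2 * ρ) * c ≤ d := fun {d c} hc h =>
    calc β * √(numSlices n : ℝ) * (2 * ρ) * c ≤ β * √(numSlices n : ℝ) *
          (2 * (1 / (2 * β * √(numSlices n : ℝ)) * (d / c))) * c := by gcongr
      _ = d := by field_simp
  have hgap : 0 < gap G r := (gap_pos_iff G r).2 (sv_lt_of_maxTopMult_le hG hr)
  have hfirst : β * √(numSlices n : ℝ) * (2 * ρ) * (1 + Q) ≤ gap G r →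
      β * √(numSlices n : ℝ) * (2 * ρ) * (1 / √(((0 : ℕ) : ℝ) + 1) + Q) ≤ gap G r := by
    simp
  rw [radius] at hρ
  rcases le_total (gap G (r - maxTopMult G + 1) / (1 / √(maxTopMult G : ℝ) + Q))
    (gap G r / (1 + Q)) with h | h
  · rw [max_eq_left h] at hρ
    exact ⟨r, 0, rfl, hgap, hfirst (hscale (by positivity) hρ)⟩
  · rw [max_eq_right h] at hρ
    have hc : 0 < 1 / √(maxTopMult G : ℝ) + Q := by positivity
    refine ⟨r - maxTopMult G + 1, maxTopMult G - 1, by omega, ?_, ?_⟩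
    · exact (div_pos_iff_of_pos_right hc).1 ((div_pos hgap (by positivity)).trans_le h)
    · rw [← Nat.cast_add_one, Nat.sub_add_cancel hm]
      exact hscale hc hρ

theorem isTruncProj_iff_eq_of_norm_sub_le_radius {f : Tensor n₁ n₂ n → ℝ} {β : ℝ} (hβ : 0 < β)
    (hf : IsSmoothOn f β (ball n₁ n₂ n 1)) {Xs : Tensor n₁ n₂ n} (hXs : Xs ∈ ball n₁ n₂ n 1)
    (hmin : IsMinOn f (ball n₁ n₂ n 1) Xs) (hG : gradient f Xs ≠ 0)
    (hmr : maxTopMult (gradient f Xs) ≤ r) (hr : r ≤ min n₁ n₂)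
    (hX : X ∈ ball n₁ n₂ n 1) (hrad : ‖X - Xs‖ ≤ radius β (gradient f Xs) r)
    (hproj : IsProj (ball n₁ n₂ n 1) (X - (1 / β) • gradient f X) Y₀) :
    IsTruncProj r 1 (X - (1 / β) • gradient f X) Y ↔ Y = Y₀ := by
  have := nonempty_sliceIdx hG
  obtain ⟨htnn, hnuc⟩ := tnn_eq_one_and_hs_dualSlice_eq_nuc hG hXs fun Z hZ =>
    inner_gradient_sub_nonneg_of_isMinOn (convex_ball 1) hXs (hf.differentiableAt Xs hXs) hmin hZ
  obtain ⟨l, μ, rfl, hgap, hle⟩ := exists_gap_of_le_radius hβ hG hmr hrad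
  have hD : ‖X - (1 / β) • gradient f X - (Xs - (1 / β) • gradient f Xs)‖ ≤ 2 * ‖X - Xs‖ := by
    have hLip : ‖(1 / β) • (gradient f X - gradient f Xs)‖ ≤ ‖X - Xs‖ := by
      rw [norm_smul, Real.norm_of_nonneg (by positivity), one_div, inv_mul_le_iff₀ hβ]
      exact hf.norm_gradient_sub_le X hX Xs hXs
    rw [sub_sub_sub_comm, ← smul_sub]
    exact (norm_sub_le _ _).trans (by linarith)
  obtain ⟨s, hs0, hsr, hsum⟩ := exists_level_of_gap hβ hG htnn hnuc (hr.trans (min_le_right _ _))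
    ((gap_pos_iff _ l).1 hgap) (le_trans (by gcongr) hle)
  exact isTruncProj_iff_eq hr one_pos hproj hs0 hsr (by rwa [mul_one])

end LocalExactness

theorem norm_sub_inner_smul_le {𝕜 E : Type*} [RCLike 𝕜] [NormedAddCommGroup E]
    [InnerProductSpace 𝕜 E] {v : E} (hv : ‖v‖ = 1) (x : E) : ‖x - inner 𝕜 v x • v‖ ≤ ‖x‖ := by
  rw [← Submodule.starProjection_unit_singleton 𝕜 hv, ← Submodule.starProjection_orthogonal_val]
  exact Submodule.norm_starProjection_apply_le _ x

theorem exists_pos_add_smul_sub_mem {E : Type*} [NormedAddCommGroup E] [NormedSpace ℝ E]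
    {S : Set E} {x y : E} (hx : x ∈ intrinsicInterior ℝ S) (hy : y ∈ S) :
    ∃ ε : ℝ, 0 < ε ∧ x + ε • (x - y) ∈ S := by
  obtain ⟨⟨x, hxa⟩, hxi, rfl⟩ := hx
  set φ : ℝ → affineSpan ℝ S := fun t => ⟨AffineMap.lineMap x y (-t),
    AffineMap.lineMap_mem _ hxa (subset_affineSpan ℝ S hy)⟩ with hφ
  have hcont : Continuous φ :=
    (AffineMap.lineMap_continuous.comp continuous_neg).subtype_mk _
  have hzero : φ 0 = ⟨x, hxa⟩ := by simp [hφ]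
  have hmem₀ : ∀ᶠ t in nhds (0 : ℝ), φ t ∈ interior ((↑) ⁻¹' S) :=
    hcont.continuousAt.eventually_mem (isOpen_interior.mem_nhds (by rwa [hzero]))
  obtain ⟨ε, hmem, hε⟩ :=
    ((hmem₀.filter_mono nhdsWithin_le_nhds).and (self_mem_nhdsWithin (s := Set.Ioi 0))).exists
  refine ⟨ε, hε, ?_⟩
  have hline : AffineMap.lineMap x y (-ε) ∈ S :=
    interior_subset (s := ((↑) : affineSpan ℝ S → E) ⁻¹' S) hmem
  rw [AffineMap.lineMap_apply_module'] at hline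
  convert hline using 1
  module

section Face

variable {n₁ n₂ k : ℕ} {n : Fin k → ℕ} {G Xs X D : Tensor n₁ n₂ n}

theorem dualSlice_conjIdx (G : Tensor n₁ n₂ n) (i : SliceIdx n) :
    dualSlice G (conjIdx i) = conjMap (dualSlice G i) := slice_conjIdx _ i

/-- The linear span of the face of the unit ball on which `⟪G, ·⟫` is minimal. In the Fourier
domain it consists of the slices `W ∘ H` with `W` the normalized slice of `-G` and `H` symmetric
with range in the space on which `W` is isometric. -/
noncomputable def faceSpan (G : Tensor n₁ n₂ n) : Submodule ℝ (Tensor n₁ n₂ n) where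
  carrier := {D | ∀ i, ∃ H : EuclideanSpace ℂ (Fin n₂) →ₗ[ℂ] EuclideanSpace ℂ (Fin n₂),
    H.IsSymmetric ∧ (∀ x, H x ∈ isometricSubspace (dualSlice G i)) ∧
      slice D i = dualSlice G i ∘ₗ H}
  zero_mem' i := ⟨0, LinearMap.IsSymmetric.zero, fun _ => zero_mem _, by
    simpa using slice_smul 0 (0 : Tensor n₁ n₂ n) i⟩
  add_mem' {X Y} hX hY i := by
    obtain ⟨H, hH, hHW, hXH⟩ := hX i
    obtain ⟨K, hK, hKW, hYK⟩ := hY i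
    exact ⟨H + K, hH.add hK, fun x => add_mem (hHW x) (hKW x), by
      rw [slice_add, hXH, hYK, LinearMap.comp_add]⟩
  smul_mem' c X hX i := by
    obtain ⟨H, hH, hHW, hXH⟩ := hX i
    exact ⟨(c : ℂ) • H, hH.smul (Complex.conj_ofReal c), fun x => Submodule.smul_mem _ _ (hHW x), by
      rw [slice_smul, hXH, LinearMap.comp_smul]⟩

theorem mem_faceSpan_of_hs_eq_nuc (hG : G ≠ 0)
    (hX : ∀ i, hs (dualSlice G i) (slice X i) = nuc (slice X i)) : X ∈ faceSpan G := fun i => by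
  obtain ⟨H, hH, hHW, hXH⟩ := exists_isPositive_eq_comp_of_hs_eq_nuc (norm_dualSlice_le hG i) (hX i)
  exact ⟨H, hH.1, hHW, hXH⟩

theorem inner_eq_neg_sv_bdiag (hG : G ≠ 0) (htnn : tnn X = 1)
    (hX : ∀ i, hs (dualSlice G i) (slice X i) = nuc (slice X i)) :
    inner ℝ G X = -sv (bdiag G) 0 := by
  rw [inner_eq_neg_mul_sum_hs_dualSlice hG, Finset.sum_congr rfl fun i _ => hX i,
    ← tnn_eq_sum_nuc, htnn, mul_one]

theorem sum_hs_le_tnn {L : SliceIdx n → EuclideanSpace ℂ (Fin n₂) →ₗ[ℂ] EuclideanSpace ℂ (Fin n₁)}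
    (hL : ∀ i x, ‖L i x‖ ≤ ‖x‖) (X : Tensor n₁ n₂ n) :
    (1 / (numSlices n : ℝ)) * ∑ i, hs (L i) (slice X i) ≤ tnn X := by
  rw [tnn_eq_sum_nuc]
  gcongr with i
  exact hs_le_nuc (hL i) _

theorem neg_sub_smul_singleSlice_mem_normalCone (hG : G ≠ 0) (htnn : tnn Xs = 1)
    (hXs : ∀ i, hs (dualSlice G i) (slice Xs i) = nuc (slice Xs i)) {i : SliceIdx n}
    {L : EuclideanSpace ℂ (Fin n₂) →ₗ[ℂ] EuclideanSpace ℂ (Fin n₁)}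
    (hL : ∀ x, ‖(dualSlice G i - L) x‖ ≤ ‖x‖) (hLX : hs L (slice Xs i) = 0) :
    -G - sv (bdiag G) 0 • singleSlice i L ∈ normalCone (ball n₁ n₂ n 1) Xs := by
  intro Z hZ
  set W := Function.update (dualSlice G) i (dualSlice G i - L)
  have hW : ∀ j x, ‖W j x‖ ≤ ‖x‖ := by
    intro j
    rcases eq_or_ne j i with rfl | hj
    · simpa only [W, Function.update_self] using hL
    · simpa only [W, Function.update_of_ne hj] using norm_dualSlice_le hG j
  have hsum : ∑ j, hs (W j) (slice Z j) =
      ∑ j, hs (dualSlice G j) (slice Z j) - hs L (slice Z i) := by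
    rw [← Finset.add_sum_erase _ _ (Finset.mem_univ i),
      ← Finset.add_sum_erase _ (fun j => hs (dualSlice G j) (slice Z j)) (Finset.mem_univ i),
      Finset.sum_congr rfl fun j hj => by
        rw [show W j = dualSlice G j from Function.update_of_ne (Finset.ne_of_mem_erase hj) _ _],
      show W i = dualSlice G i - L from Function.update_self _ _ _, hs_sub_left]
    ring
  have hle := mul_le_mul_of_nonneg_left ((sum_hs_le_tnn hW Z).trans hZ) (sv_bdiag_pos hG).le
  rw [hsum] at hle
  simp only [inner_sub_right, inner_sub_left, inner_neg_left, real_inner_smul_left,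
    inner_eq_neg_sv_bdiag hG htnn hXs, inner_eq_neg_mul_sum_hs_dualSlice hG Z, inner_singleSlice,
    hLX]
  linarith

theorem slice_apply_ne_zero_of_norm_eq_one (hG : G ≠ 0) (htnn : tnn Xs = 1)
    (hXs : ∀ i, hs (dualSlice G i) (slice Xs i) = nuc (slice Xs i))
    (hri : -G ∈ intrinsicInterior ℝ (normalCone (ball n₁ n₂ n 1) Xs)) {i : SliceIdx n}
    {v : EuclideanSpace ℂ (Fin n₂)} (hv : v ∈ isometricSubspace (dualSlice G i))
    (hv1 : ‖v‖ = 1) : slice Xs i v ≠ 0 := by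
  intro hXv
  have hN := numSlices_pos i
  have hg := sv_bdiag_pos hG
  set g := sv (bdiag G) 0
  set W := dualSlice G i
  set L : EuclideanSpace ℂ (Fin n₂) →ₗ[ℂ] EuclideanSpace ℂ (Fin n₁) :=
    (rankOne ℂ (W v) v).toLinearMap with hL
  set S := singleSlice (n := n) i L
  have hLX : hs L (slice Xs i) = 0 := by rw [hs_rankOne, hXv, inner_zero_right, map_zero]
  have hLW : hs L W = 1 := by
    rw [hs_rankOne, inner_self_eq_norm_sq, norm_apply_of_mem_isometricSubspace hv, hv1, one_pow]
  have hSX : inner ℝ S Xs = 0 := by rw [inner_singleSlice, hLX, mul_zero]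
  have hSG : numSlices n * inner ℝ S G = -g := by
    rw [inner_singleSlice, slice_eq_neg_smul_dualSlice hG, ← RCLike.ofReal_eq_complex_ofReal,
      hs_smul_right, hLW]
    field_simp
    rfl
  have hWL : ∀ x, ‖(W - L) x‖ ≤ ‖x‖ := fun x => by
    have hx : (W - L) x = W (x - inner ℂ v x • v) := by simp [hL]
    rw [hx]
    exact (norm_dualSlice_le hG i _).trans (norm_sub_inner_smul_le hv1 x)
  obtain ⟨ε, hε, hmem⟩ := exists_pos_add_smul_sub_mem hri
    (neg_sub_smul_singleSlice_mem_normalCone hG htnn hXs hWL hLX)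
  have hball : (numSlices n : ℝ) • S ∈ ball n₁ n₂ n 1 :=
    calc tnn ((numSlices n : ℝ) • S) ≤ numSlices n * ((1 / (numSlices n : ℝ)) * nuc L) :=
          (tnn_smul_le hN.le S).trans (by gcongr; exact tnn_singleSlice_le i L)
      _ = nuc L := by field_simp
      _ ≤ ‖W v‖ * ‖v‖ := nuc_rankOne_le _ _
      _ = 1 := by rw [norm_apply_of_mem_isometricSubspace hv, hv1, one_mul]
  have hle := hmem _ hball
  have hshift : -G + ε • (-G - (-G - g • S)) = -G + (ε * g) • S := by module
  rw [hshift] at hle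
  simp only [inner_sub_right, inner_add_left, inner_neg_left, real_inner_smul_left,
    real_inner_smul_right, hSX, inner_eq_neg_sv_bdiag hG htnn hXs, real_inner_comm S G,
    real_inner_self_eq_norm_sq, hSG] at hle
  have hS : S ≠ 0 := fun h => by
    rw [h, inner_zero_left, mul_zero] at hSG
    linarith
  have hpos : 0 < ε * g * (numSlices n * ‖S‖ ^ 2) := by positivity
  linarith

theorem slice_apply_ne_zero (hG : G ≠ 0) (htnn : tnn Xs = 1)
    (hXs : ∀ i, hs (dualSlice G i) (slice Xs i) = nuc (slice Xs i))
    (hri : -G ∈ intrinsicInterior ℝ (normalCone (ball n₁ n₂ n 1) Xs)) {i : SliceIdx n}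
    {v : EuclideanSpace ℂ (Fin n₂)} (hv : v ∈ isometricSubspace (dualSlice G i)) (hv0 : v ≠ 0) :
    slice Xs i v ≠ 0 := by
  have h := slice_apply_ne_zero_of_norm_eq_one hG htnn hXs hri
    (Submodule.smul_mem _ ((‖v‖ : ℂ)⁻¹) hv) (norm_smul_inv_norm hv0)
  rw [map_smul] at h
  exact right_ne_zero_of_smul h

theorem tnn_le_one_of_slice_eq_comp (hG : G ≠ 0)
    {H : SliceIdx n → EuclideanSpace ℂ (Fin n₂) →ₗ[ℂ] EuclideanSpace ℂ (Fin n₂)}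
    (hH : ∀ i, (H i).IsPositive) (hHW : ∀ i x, H i x ∈ isometricSubspace (dualSlice G i))
    (hX : ∀ i, slice X i = dualSlice G i ∘ₗ H i) (hGX : inner ℝ G X = -sv (bdiag G) 0) :
    tnn X ≤ 1 := by
  have hg := sv_bdiag_pos hG
  have hsum : (1 / (numSlices n : ℝ)) * ∑ i, hs (dualSlice G i) (slice X i) = 1 := by
    rw [inner_eq_neg_mul_sum_hs_dualSlice hG, neg_inj] at hGX
    exact mul_left_cancel₀ hg.ne' (hGX.trans (mul_one _).symm)
  rw [← hsum, tnn_eq_sum_nuc]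
  gcongr with i
  rw [hX i]
  exact nuc_comp_le_hs (norm_dualSlice_le hG i) (hH i) (hHW i)

theorem exists_pos_add_smul_mem_ball (hG : G ≠ 0) (htnn : tnn Xs = 1)
    (hXs : ∀ i, hs (dualSlice G i) (slice Xs i) = nuc (slice Xs i))
    (hri : -G ∈ intrinsicInterior ℝ (normalCone (ball n₁ n₂ n 1) Xs))
    (hD : D ∈ faceSpan G) (hGD : inner ℝ G D = 0) :
    ∃ t : ℝ, 0 < t ∧ Xs + t • D ∈ ball n₁ n₂ n 1 := by
  choose K hK hKW hDK using hD
  choose H hH hHW hXH using fun i =>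
    exists_isPositive_eq_comp_of_hs_eq_nuc (norm_dualSlice_le hG i) (hXs i)
  have hinj : ∀ i, ∀ x ∈ isometricSubspace (dualSlice G i), H i x = 0 → x = 0 :=
    fun i x hx hHx => by
      by_contra hx0
      refine slice_apply_ne_zero hG htnn hXs hri hx hx0 ?_
      rw [hXH i, LinearMap.comp_apply, hHx, map_zero]
  choose ε hε0 hε using fun i =>
    exists_isPositive_add_smul (hH i) (hK i) (hHW i) (hKW i) (hinj i)
  have hpos : ∀ᶠ t : ℝ in nhdsWithin 0 (Set.Ioi 0), ∀ i, (H i + (t : ℂ) • K i).IsPositive :=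
    Filter.eventually_all.2 fun i => by
      filter_upwards [Ioc_mem_nhdsGT (hε0 i)] with t ht using hε i t ht.1.le ht.2
  obtain ⟨t, ht, ht0⟩ := (hpos.and self_mem_nhdsWithin).exists
  refine ⟨t, ht0, tnn_le_one_of_slice_eq_comp hG ht
    (fun i x => add_mem (hHW i x) (Submodule.smul_mem _ _ (hKW i x))) (fun i => ?_) ?_⟩
  · rw [slice_add, slice_smul, hXH i, hDK i, LinearMap.comp_add, LinearMap.comp_smul]
  · rw [inner_add_right, real_inner_smul_right, hGD, mul_zero, add_zero,
      inner_eq_neg_sv_bdiag hG htnn hXs]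

theorem ofSlices_mem_faceSpan
    {H : SliceIdx n → EuclideanSpace ℂ (Fin n₂) →ₗ[ℂ] EuclideanSpace ℂ (Fin n₂)}
    (hH : ∀ i, (H i).IsSymmetric) (hHW : ∀ i x, H i x ∈ isometricSubspace (dualSlice G i)) :
    ofSlices (fun i => Matrix.toEuclideanLin.symm (dualSlice G i ∘ₗ H i)) ∈ faceSpan G := by
  intro i
  have hW : conjMap (dualSlice G (conjIdx i)) = dualSlice G i := by
    rw [← dualSlice_conjIdx, conjIdx_involutive i]
  refine ⟨((1 / 2 : ℝ) : ℂ) • (H i + conjMap (H (conjIdx i))),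
    ((hH i).add (conjMap_isSymmetric (hH _))).smul (Complex.conj_ofReal _),
    fun x => Submodule.smul_mem _ _ (add_mem (hHW i x) ?_), ?_⟩
  · rw [← hW, conjMap_apply]
    exact conjVec_mem_isometricSubspace (hHW _ _)
  · rw [slice_ofSlices, LinearEquiv.apply_symm_apply, LinearEquiv.apply_symm_apply, conjMap_comp,
      hW, LinearMap.comp_smul, LinearMap.comp_add]

theorem norm_sub_ofSlices_sq_le (X : Tensor n₁ n₂ n)
    (L : SliceIdx n → EuclideanSpace ℂ (Fin n₂) →ₗ[ℂ] EuclideanSpace ℂ (Fin n₁)) :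
    ‖X - ofSlices fun i => Matrix.toEuclideanLin.symm (L i)‖ ^ 2 ≤
      (1 / (numSlices n : ℝ)) * ∑ i, hs (slice X i - L i) (slice X i - L i) := by
  have h := norm_sq_ofSlices_le (fslice X - fun i => Matrix.toEuclideanLin.symm (L i))
  simpa only [ofSlices_sub, ofSlices_fslice, Pi.sub_apply, map_sub, slice,
    LinearEquiv.apply_symm_apply] using h

theorem nuc_slice_le_of_mem_ball {τ : ℝ} (hX : X ∈ ball n₁ n₂ n τ) (i : SliceIdx n) :
    nuc (slice X i) ≤ numSlices n * τ := by
  have hle : tnn X ≤ τ := hX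
  rw [tnn_eq_sum_nuc, one_div, inv_mul_le_iff₀ (numSlices_pos i)] at hle
  exact (Finset.single_le_sum (f := fun i => nuc (slice X i)) (fun j _ => nuc_nonneg _)
    (Finset.mem_univ i)).trans hle

theorem exists_mem_faceSpan_norm_sub_sq_le (hG : G ≠ 0) :
    ∃ K : ℝ, 0 ≤ K ∧ ∀ X ∈ ball n₁ n₂ n 1, ∃ D ∈ faceSpan G,
      ‖X - D‖ ^ 2 ≤ K * (sv (bdiag G) 0 + inner ℝ G X) := by
  have := nonempty_sliceIdx hG
  have hN := numSlices_pos (Classical.arbitrary (SliceIdx n))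
  have hg := sv_bdiag_pos hG
  choose C hC0 hC using fun i => exists_isPositive_hs_sub_comp_le (norm_dualSlice_le hG i)
  set κ := ∑ i, C i
  have hκ0 : 0 ≤ κ := Finset.sum_nonneg fun i _ => hC0 i
  refine ⟨κ * numSlices n / sv (bdiag G) 0, by positivity, fun X hX => ?_⟩
  choose H hH hHW hdist using fun i => hC i (slice X i)
  refine ⟨_, ofSlices_mem_faceSpan (fun i => (hH i).1) hHW, (norm_sub_ofSlices_sq_le X _).trans ?_⟩
  have hdefect : ∀ i, 0 ≤ nuc (slice X i) - hs (dualSlice G i) (slice X i) := fun i =>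
    sub_nonneg.2 (hs_le_nuc (norm_dualSlice_le hG i) _)
  calc (1 / (numSlices n : ℝ)) * ∑ i, hs (slice X i - dualSlice G i ∘ₗ H i)
        (slice X i - dualSlice G i ∘ₗ H i)
      ≤ (1 / (numSlices n : ℝ)) * ∑ i, κ * (numSlices n *
          (nuc (slice X i) - hs (dualSlice G i) (slice X i))) := by
        gcongr with i
        refine (hdist i).trans (mul_le_mul ?_ ?_ (mul_nonneg (nuc_nonneg _) (hdefect i)) hκ0)
        · exact Finset.single_le_sum (fun j _ => hC0 j) (Finset.mem_univ i)
        · exact mul_le_mul_of_nonneg_right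
            ((nuc_slice_le_of_mem_ball hX i).trans_eq (mul_one _)) (hdefect i)
    _ = κ * numSlices n *
          (tnn X - (1 / (numSlices n : ℝ)) * ∑ i, hs (dualSlice G i) (slice X i)) := by
        rw [← Finset.mul_sum, ← Finset.mul_sum, Finset.sum_sub_distrib, tnn_eq_sum_nuc]
        ring
    _ ≤ κ * numSlices n *
          (1 - (1 / (numSlices n : ℝ)) * ∑ i, hs (dualSlice G i) (slice X i)) := by
        gcongr
        exact hX
    _ = κ * numSlices n / sv (bdiag G) 0 * (sv (bdiag G) 0 + inner ℝ G X) := by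
        rw [inner_eq_neg_mul_sum_hs_dualSlice hG]
        field_simp
        ring

end Face

section Growth

theorem strongConvexOn_of_subset {E : Type*} [NormedAddCommGroup E] [NormedSpace ℝ E]
    {S T : Set E} {α : ℝ} {g : E → ℝ} (hg : StrongConvexOn T α g) (hST : S ⊆ T)
    (hS : Convex ℝ S) : StrongConvexOn S α g :=
  ⟨hS, fun _ hx _ hy => hg.2 (hST hx) (hST hy)⟩

theorem inner_gradient_add_le_of_strongConvexOn {H V : Type*} [NormedAddCommGroup H]
    [InnerProductSpace ℝ H] [CompleteSpace H] [NormedAddCommGroup V] [NormedSpace ℝ V]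
    {f : H → ℝ} {g : V → ℝ} {A : H →ₗ[ℝ] V} {C : H} {α : ℝ} {K : Set H} (hK : Convex ℝ K)
    (hg : StrongConvexOn (A '' K) α g) (hf : ∀ x ∈ K, f x = g (A x) + inner ℝ C x) {x y : H}
    (hx : x ∈ K) (hy : y ∈ K) (hdiff : DifferentiableAt ℝ f x) :
    inner ℝ (gradient f x) (y - x) + α / 2 * ‖A (y - x)‖ ^ 2 ≤ f y - f x := by
  have h := inner_gradient_le_of_forall_add_smul_le (v := y - x) hdiff (D := f y - f x)
    (c := α / 2 * ‖A (y - x)‖ ^ 2) fun t ht0 ht1 => by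
      have hconv := hg.2 (Set.mem_image_of_mem A hx) (Set.mem_image_of_mem A hy)
        (sub_nonneg.2 ht1.le) ht0.le (sub_add_cancel 1 t)
      have hline : A (x + t • (y - x)) = (1 - t) • A x + t • A y := by
        rw [map_add, map_smul, map_sub]
        module
      rw [hf x hx, hf y hy, hf _ (hK.add_smul_sub_mem hx hy ⟨ht0.le, ht1.le⟩), hline,
        inner_add_right, real_inner_smul_right, inner_sub_right]
      rw [← map_sub, ← neg_sub y x, map_neg, norm_neg, smul_eq_mul, smul_eq_mul] at hconv
      linarith
  linarith

theorem inner_nonneg_of_add_smul_mem {H V : Type*} [NormedAddCommGroup H]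
    [InnerProductSpace ℝ H] [AddCommGroup V] [Module ℝ V] {f : H → ℝ} {g : V → ℝ}
    {A : H →ₗ[ℝ] V} {C : H} {K : Set H} (hf : ∀ x ∈ K, f x = g (A x) + inner ℝ C x) {x v : H}
    (hx : x ∈ K) (hmin : IsMinOn f K x) (hAv : A v = 0) {t : ℝ} (ht : 0 < t)
    (hmem : x + t • v ∈ K) : 0 ≤ inner ℝ C v := by
  have hle : f x ≤ f (x + t • v) := hmin hmem
  rw [hf x hx, hf _ hmem, map_add, map_smul, hAv, smul_zero, add_zero, inner_add_right,
    real_inner_smul_right] at hle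
  exact nonneg_of_mul_nonneg_right (by linarith) ht

theorem eq_zero_of_add_smul_mem_of_unique {H V : Type*} [NormedAddCommGroup H]
    [InnerProductSpace ℝ H] [AddCommGroup V] [Module ℝ V] {f : H → ℝ} {g : V → ℝ}
    {A : H →ₗ[ℝ] V} {C : H} {K : Set H} (hf : ∀ x ∈ K, f x = g (A x) + inner ℝ C x) {x v : H}
    (hx : x ∈ K) (hmin : IsMinOn f K x) (huniq : ∀ y ∈ K, f y = f x → y = x) (hAv : A v = 0)
    (hpos : ∃ t : ℝ, 0 < t ∧ x + t • v ∈ K) (hneg : ∃ t : ℝ, 0 < t ∧ x + t • -v ∈ K) : v = 0 := by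
  obtain ⟨t, ht, hmem⟩ := hpos
  obtain ⟨s, hs, hmem'⟩ := hneg
  have hCv := inner_nonneg_of_add_smul_mem hf hx hmin hAv ht hmem
  have hCv' := inner_nonneg_of_add_smul_mem hf hx hmin (by rw [map_neg, hAv, neg_zero]) hs hmem'
  rw [inner_neg_right, neg_nonneg] at hCv'
  have hfix : x + t • v = x := huniq _ hmem <| by
    rw [hf x hx, hf _ hmem, map_add, map_smul, hAv, smul_zero, add_zero, inner_add_right,
      real_inner_smul_right, hCv'.antisymm hCv, mul_zero, add_zero]
  exact (smul_eq_zero.1 (add_eq_left.1 hfix)).resolve_left ht.ne'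

theorem exists_norm_sq_le_of_injOn {E F : Type*} [NormedAddCommGroup E] [NormedSpace ℝ E]
    [FiniteDimensional ℝ E] [NormedAddCommGroup F] [NormedSpace ℝ F] (L : Submodule ℝ E)
    (Φ : E →ₗ[ℝ] F) (hΦ : ∀ y ∈ L, Φ y = 0 → y = 0) :
    ∃ c : ℝ, 0 ≤ c ∧ ∀ x, ∀ y ∈ L, ‖x‖ ^ 2 ≤ c * (‖x - y‖ ^ 2 + ‖Φ x‖ ^ 2) := by
  have hker : LinearMap.ker (Φ.domRestrict L) = ⊥ :=
    LinearMap.ker_eq_bot'.2 fun y hy => Subtype.ext (hΦ y y.2 hy)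
  obtain ⟨K, -, hK⟩ := (Φ.domRestrict L).exists_antilipschitzWith hker
  set a := ‖LinearMap.toContinuousLinearMap Φ‖
  have hΦa : ∀ x, ‖Φ x‖ ≤ a * ‖x‖ := (LinearMap.toContinuousLinearMap Φ).le_opNorm
  refine ⟨2 * (1 + K * a + K) ^ 2, by positivity, fun x y hy => ?_⟩
  have hy' : ‖y‖ ≤ K * (‖Φ x‖ + a * ‖x - y‖) :=
    calc ‖y‖ ≤ K * ‖Φ y‖ := by simpa [dist_eq_norm] using hK.le_mul_dist ⟨y, hy⟩ 0
      _ ≤ K * (‖Φ x‖ + a * ‖x - y‖) := by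
        gcongr
        calc ‖Φ y‖ ≤ ‖Φ x‖ + ‖Φ x - Φ y‖ := norm_le_norm_add_norm_sub _ _
          _ ≤ ‖Φ x‖ + a * ‖x - y‖ := by
            rw [← map_sub]
            gcongr
            exact hΦa _
  have hx : ‖x‖ ≤ (1 + K * a + K) * (‖x - y‖ + ‖Φ x‖) := by
    have htriangle := norm_le_norm_add_norm_sub y x
    rw [norm_sub_rev y x] at htriangle
    have hK0 : 0 ≤ (K : ℝ) * ‖x - y‖ := by positivity
    have ha0 : 0 ≤ (1 + K * a) * ‖Φ x‖ := by positivity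
    linarith
  calc ‖x‖ ^ 2 ≤ (1 + K * a + K) ^ 2 * (‖x - y‖ + ‖Φ x‖) ^ 2 := by
        rw [← mul_pow]
        gcongr
    _ ≤ (1 + K * a + K) ^ 2 * (2 * (‖x - y‖ ^ 2 + ‖Φ x‖ ^ 2)) := by
        gcongr
        exact add_sq_le
    _ = 2 * (1 + K * a + K) ^ 2 * (‖x - y‖ ^ 2 + ‖Φ x‖ ^ 2) := by ring

variable {n₁ n₂ k : ℕ} {n : Fin k → ℕ} {V : Type*} [NormedAddCommGroup V] [NormedSpace ℝ V]
  {G Xs : Tensor n₁ n₂ n} {A : Tensor n₁ n₂ n →ₗ[ℝ] V}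

theorem exists_norm_sub_sq_le_of_injOn_faceSpan (hG : G ≠ 0) (htnn : tnn Xs = 1)
    (hXs : ∀ i, hs (dualSlice G i) (slice Xs i) = nuc (slice Xs i))
    (hinj : ∀ D ∈ faceSpan G, A D = 0 → inner ℝ G D = 0 → D = 0) :
    ∃ c : ℝ, 0 ≤ c ∧ ∀ X ∈ ball n₁ n₂ n 1,
      ‖X - Xs‖ ^ 2 ≤ c * (inner ℝ G (X - Xs) + ‖A (X - Xs)‖ ^ 2) := by
  have hg := sv_bdiag_pos hG
  obtain ⟨κ, hκ0, hκ⟩ := exists_mem_faceSpan_norm_sub_sq_le hG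
  obtain ⟨c, hc0, hc⟩ := exists_norm_sq_le_of_injOn (faceSpan G) (A.prod (innerₛₗ ℝ G))
    fun D hD hΦ => hinj D hD (congrArg Prod.fst hΦ) (congrArg Prod.snd hΦ)
  refine ⟨c * (κ + 2 * sv (bdiag G) 0 + 1), by positivity, fun X hX => ?_⟩
  obtain ⟨D, hD, hXD⟩ := hκ X hX
  have hinner : inner ℝ G (X - Xs) = sv (bdiag G) 0 + inner ℝ G X := by
    rw [inner_sub_right, inner_eq_neg_sv_bdiag hG htnn hXs]
    ring
  have hnonneg : 0 ≤ inner ℝ G (X - Xs) := by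
    have hle := neg_inner_le_sv_bdiag_mul_tnn G X
    have hball := mul_le_mul_of_nonneg_left hX hg.le
    linarith
  have hle : inner ℝ G (X - Xs) ≤ 2 * sv (bdiag G) 0 := by
    have hle := inner_le_mul_tnn (norm_slice_le_sv_bdiag_mul G) X
    have hball := mul_le_mul_of_nonneg_left hX hg.le
    linarith
  rw [← hinner] at hXD
  set p := inner ℝ G (X - Xs)
  have hΦ : ‖A.prod (innerₛₗ ℝ G) (X - Xs)‖ ^ 2 ≤
      ‖A (X - Xs)‖ ^ 2 + 2 * sv (bdiag G) 0 * p := by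
    have hnorm : ‖A.prod (innerₛₗ ℝ G) (X - Xs)‖ = max ‖A (X - Xs)‖ |p| := rfl
    have hsq : |p| ^ 2 ≤ 2 * sv (bdiag G) 0 * p := by
      rw [sq_abs, sq]
      gcongr
    rw [hnorm]
    rcases max_choice ‖A (X - Xs)‖ |p| with h | h <;> rw [h]
    · exact le_add_of_nonneg_right ((sq_nonneg _).trans hsq)
    · exact hsq.trans (le_add_of_nonneg_left (sq_nonneg _))
  calc ‖X - Xs‖ ^ 2
      ≤ c * (‖X - Xs - (D - Xs)‖ ^ 2 + ‖A.prod (innerₛₗ ℝ G) (X - Xs)‖ ^ 2) :=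
        hc _ _ (sub_mem hD (mem_faceSpan_of_hs_eq_nuc hG hXs))
    _ ≤ c * (κ * p + (‖A (X - Xs)‖ ^ 2 + 2 * sv (bdiag G) 0 * p)) := by
        rw [sub_sub_sub_cancel_right]
        gcongr
    _ ≤ c * (κ + 2 * sv (bdiag G) 0 + 1) * (p + ‖A (X - Xs)‖ ^ 2) := by
        have hslack : 0 ≤ c * (p + (κ + 2 * sv (bdiag G) 0) * ‖A (X - Xs)‖ ^ 2) := by positivity
        linarith

theorem exists_quadratic_growth {f : Tensor n₁ n₂ n → ℝ} (hXs : Xs ∈ ball n₁ n₂ n 1)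
    (hdiff : DifferentiableAt ℝ f Xs) (hmin : IsMinOn f (ball n₁ n₂ n 1) Xs)
    (hG : gradient f Xs ≠ 0) {α : ℝ} (hα : 0 < α) {g : V → ℝ} {C : Tensor n₁ n₂ n}
    (hg : StrongConvexOn (A '' ball n₁ n₂ n 1) α g)
    (hf : ∀ X ∈ ball n₁ n₂ n 1, f X = g (A X) + inner ℝ C X)
    (huniq : ∀ X ∈ ball n₁ n₂ n 1, f X = f Xs → X = Xs) (hsc : StrictCompl f Xs) :
    ∃ γ : ℝ, 0 < γ ∧ ∀ X ∈ ball n₁ n₂ n 1, γ * ‖X - Xs‖ ^ 2 ≤ f X - f Xs := by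
  have hinner : ∀ X ∈ ball n₁ n₂ n 1, 0 ≤ inner ℝ (gradient f Xs) (X - Xs) := fun X =>
    inner_gradient_sub_nonneg_of_isMinOn (convex_ball 1) hXs hdiff hmin
  obtain ⟨htnn, hnuc⟩ := tnn_eq_one_and_hs_dualSlice_eq_nuc hG hXs hinner
  obtain ⟨c, hc0, hc⟩ := exists_norm_sub_sq_le_of_injOn_faceSpan (A := A) hG htnn hnuc
    fun D hD hAD hGD => eq_zero_of_add_smul_mem_of_unique hf hXs hmin huniq hAD
      (exists_pos_add_smul_mem_ball hG htnn hnuc hsc hD hGD)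
      (exists_pos_add_smul_mem_ball hG htnn hnuc hsc (neg_mem hD)
        (by rw [inner_neg_right, hGD, neg_zero]))
  refine ⟨1 / (c * (1 + 2 / α) + 1), by positivity, fun X hX => ?_⟩
  have hgrowth := inner_gradient_add_le_of_strongConvexOn (convex_ball 1) hg hf hXs hX hdiff
  set p := inner ℝ (gradient f Xs) (X - Xs)
  set q := α / 2 * ‖A (X - Xs)‖ ^ 2
  have hp : 0 ≤ p := hinner X hX
  have hq : 0 ≤ q := by positivity
  have hAq : ‖A (X - Xs)‖ ^ 2 = 2 / α * q := by
    simp only [q]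
    field_simp
  rw [one_div, inv_mul_le_iff₀ (by positivity)]
  calc ‖X - Xs‖ ^ 2 ≤ c * (p + 2 / α * q) := hAq ▸ hc X hX
    _ ≤ (c * (1 + 2 / α) + 1) * (p + q) := by
        have hslack : 0 ≤ c * (2 / α * p + q) :=
          mul_nonneg hc0 (add_nonneg (by positivity) hq)
        linarith
    _ ≤ (c * (1 + 2 / α) + 1) * (f X - f Xs) := by gcongr

end Growth

end TNN

theorem mainTheorem4_general {k : ℕ} {n₁ n₂ : ℕ} {n : Fin k → ℕ}
    {f : TNN.Tensor n₁ n₂ n → ℝ} {β : ℝ} (hβ : 0 < β)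
    (hconv : ConvexOn ℝ (TNN.ball n₁ n₂ n 1) f) (hf : TNN.IsSmoothOn f β (TNN.ball n₁ n₂ n 1))
    {Xs : TNN.Tensor n₁ n₂ n} (hXs : Xs ∈ TNN.ball n₁ n₂ n 1)
    (hmin : IsMinOn f (TNN.ball n₁ n₂ n 1) Xs) (hgrad : gradient f Xs ≠ 0) :
    (∀ r : ℕ, TNN.maxTopMult (gradient f Xs) ≤ r → r ≤ min n₁ n₂ →
      ∀ X : ℕ → TNN.Tensor n₁ n₂ n, TNN.IsPGD f β X →
        ‖X 1 - Xs‖ ≤ TNN.radius β (gradient f Xs) r →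
        (∀ t : ℕ, 1 ≤ t → ∀ Y : TNN.Tensor n₁ n₂ n,
          TNN.IsTruncProj r 1 (X t - (1 / β) • gradient f (X t)) Y ↔ Y = X (t + 1)) ∧
        (∀ Z : ℕ → TNN.Tensor n₁ n₂ n, Z 1 = X 1 →
          (∀ t : ℕ, 1 ≤ t →
            TNN.IsTruncProj r 1 (Z t - (1 / β) • gradient f (Z t)) (Z (t + 1))) →
          ∀ t : ℕ, 1 ≤ t → Z t = X t) ∧
        (∀ t : ℕ, 2 ≤ t →
          f (X t) - f Xs ≤ β * ‖X 1 - Xs‖ ^ 2 / (2 * ((t : ℝ) - 1)))) ∧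
    (∀ (V : Type*) [NormedAddCommGroup V] [NormedSpace ℝ V] (α : ℝ) (g : V → ℝ)
      (A : TNN.Tensor n₁ n₂ n →ₗ[ℝ] V) (C : TNN.Tensor n₁ n₂ n),
      0 < α → StrongConvexOn (A '' TNN.ball n₁ n₂ n 1) α g →
      (∀ X ∈ TNN.ball n₁ n₂ n 1, f X = g (A X) + inner ℝ C X) →
      (∀ X ∈ TNN.ball n₁ n₂ n 1, f X = f Xs → X = Xs) →
      TNN.StrictCompl f Xs →
      ∃ γ : ℝ, 0 < γ ∧
        (∀ X ∈ TNN.ball n₁ n₂ n 1, γ * ‖X - Xs‖ ^ 2 ≤ f X - f Xs) ∧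
        ∀ X : ℕ → TNN.Tensor n₁ n₂ n, TNN.IsPGD f β X → ∀ t : ℕ, 2 ≤ t →
          f (X t) - f Xs ≤
            β * ‖X 1 - Xs‖ ^ 2 / 2 * (1 / (1 + 2 * γ / β)) ^ (t - 1)) := by
  refine ⟨fun r hmr hr X hX hrad => ?_, fun V _ _ α g A C hα hg hfg huniq hsc => ?_⟩
  · have hrun : TNN.IsProjGradRun f β (TNN.ball n₁ n₂ n 1) X := hX
    have htrunc : ∀ t : ℕ, 1 ≤ t → ∀ Y : TNN.Tensor n₁ n₂ n,
        TNN.IsTruncProj r 1 (X t - (1 / β) • gradient f (X t)) Y ↔ Y = X (t + 1) := fun t ht _ =>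
      TNN.isTruncProj_iff_eq_of_norm_sub_le_radius hβ hf hXs hmin hgrad hmr hr (hrun.mem ht)
        ((hrun.norm_sub_le hβ hconv hf hXs hmin ht).trans hrad) (hX.2 t ht)
    refine ⟨htrunc, fun Z hZ₁ hZ t ht => ?_, fun t => hrun.sub_le_div hβ hconv hf hXs⟩
    induction t, ht using Nat.le_induction with
    | base => exact hZ₁
    | succ t ht ih => exact (htrunc t ht _).1 (ih ▸ hZ t ht)
  · obtain ⟨γ, hγ, hgrowth⟩ := TNN.exists_quadratic_growth hXs (hf.differentiableAt Xs hXs) hmin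
      hgrad hα hg hfg huniq hsc
    have hgrowth' : ∀ X ∈ TNN.ball n₁ n₂ n 1, min γ (β / 48) * ‖X - Xs‖ ^ 2 ≤ f X - f Xs :=
      fun X hX => (mul_le_mul_of_nonneg_right (min_le_left _ _) (sq_nonneg _)).trans (hgrowth X hX)
    exact ⟨min γ (β / 48), by positivity, hgrowth', fun X hX t =>
      TNN.IsProjGradRun.sub_le_mul_pow hX hβ hconv hf hXs (by positivity) (min_le_right _ _)
        hgrowth'⟩

theorem mainTheorem4 {k : ℕ} (n₁ n₂ : ℕ) (n : Fin k → ℕ)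
    (f : TNN.Tensor n₁ n₂ n → ℝ) (β : ℝ) (hβ : 0 < β)
    (hconv : ConvexOn ℝ Set.univ f)
    (hdiff : ∀ X ∈ TNN.ball n₁ n₂ n 1, DifferentiableAt ℝ f X)
    (hsmooth : ∀ X ∈ TNN.ball n₁ n₂ n 1, ∀ Y ∈ TNN.ball n₁ n₂ n 1,
      ‖gradient f X - gradient f Y‖ ≤ β * ‖X - Y‖)
    (Xs : TNN.Tensor n₁ n₂ n) (hXs : Xs ∈ TNN.ball n₁ n₂ n 1)
    (hopt : ∀ X ∈ TNN.ball n₁ n₂ n 1, f Xs ≤ f X)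
    (hgrad : gradient f Xs ≠ 0) :
    (∀ r : ℕ, TNN.maxTopMult (gradient f Xs) ≤ r → r < min n₁ n₂ →
      ∀ X : ℕ → TNN.Tensor n₁ n₂ n, TNN.IsPGD f β X →
        ‖X 1 - Xs‖ ≤ TNN.radius β (gradient f Xs) r →
        -- each exact projection coincides with the rank-`r` truncated projection, which exists
        -- and does not depend on the choices made in its computation
        (∀ t : ℕ, 1 ≤ t → ∀ Y : TNN.Tensor n₁ n₂ n,
          TNN.IsTruncProj r 1 (X t - (1 / β) • gradient f (X t)) Y ↔ Y = X (t + 1)) ∧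
        -- so the method with truncated projections produces the same sequence
        (∀ Z : ℕ → TNN.Tensor n₁ n₂ n, Z 1 = X 1 →
          (∀ t : ℕ, 1 ≤ t →
            TNN.IsTruncProj r 1 (Z t - (1 / β) • gradient f (Z t)) (Z (t + 1))) →
          ∀ t : ℕ, 1 ≤ t → Z t = X t) ∧
        (∀ t : ℕ, 2 ≤ t →
          f (X t) - f Xs ≤ β * ‖X 1 - Xs‖ ^ 2 / (2 * ((t : ℝ) - 1)))) ∧
    (∀ (m : ℕ) (α : ℝ) (g : EuclideanSpace ℝ (Fin m) → ℝ)
      (A : TNN.Tensor n₁ n₂ n →ₗ[ℝ] EuclideanSpace ℝ (Fin m)) (C : TNN.Tensor n₁ n₂ n),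
      0 < α → StrongConvexOn Set.univ α g →
      (∀ X, f X = g (A X) + inner ℝ C X) →
      (∀ X ∈ TNN.ball n₁ n₂ n 1, f X = f Xs → X = Xs) →
      TNN.StrictCompl f Xs →
      ∃ γ : ℝ, 0 < γ ∧
        (∀ X ∈ TNN.ball n₁ n₂ n 1, γ * ‖X - Xs‖ ^ 2 ≤ f X - f Xs) ∧
        ∀ X : ℕ → TNN.Tensor n₁ n₂ n, TNN.IsPGD f β X → ∀ t : ℕ, 2 ≤ t →
          f (X t) - f Xs ≤
            β * ‖X 1 - Xs‖ ^ 2 / 2 * (1 / (1 + 2 * γ / β)) ^ (t - 1)) :=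
  have h := mainTheorem4_general hβ (hconv.subset (Set.subset_univ _) (TNN.convex_ball 1))
    ⟨hdiff, hsmooth⟩ hXs hopt hgrad
  ⟨fun r hmr hr => h.1 r hmr hr.le, fun _ α g A C hα hg hf => h.2 _ α g A C hα
    (TNN.strongConvexOn_of_subset hg (Set.subset_univ _) ((TNN.convex_ball 1).linear_image A))
    fun X _ => hf X⟩
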